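/- Let $\Omega\subseteq\mathbb{C}$ be a simply connected domain. Equip $\hat{\mathbb C}=\mathbb C\cup\{\infty\}$ with the chordal metric $\chi(z,w)=\frac{|z-w|}{\sqrt{1+|z|^2}\sqrt{1+|w|^2}}$ for $z,w\in\mathbb C$, $\chi(z,\infty)=\chi(\infty,z)=\frac1{\sqrt{1+|z|^2}}$ for $z\in\mathbb C$, and $\chi(\infty,\infty)=0$. Let $\mathcal M_{l.u.}(\Omega)$ be the set of locally univalent meromorphic functions on $\Omega$, that is, of the meromorphic functions $f$ on $\Omega$ that have at most simple poles and satisfy $f'(z)\neq 0$ for all $z\in\Omega$ with $f(z)\ne\infty$; it carries the topology of locally uniform convergence on $\Omega$ with respect to $\chi$. A locally univalent self-map of $\Omega$ is a holomorphic map $\phi:\Omega\to\Omega$ with $\phi'(z)\ne0$ for all $z\in\Omega$. Let $\Phi$ be a family of locally univalent self-maps of $\Omega$ which contains a sequence $(\phi_n)$ that is * run-away: for every compact set $K\subseteq\Omega$ there is an $n\in\mathbb N$ with $\phi_n(K)\cap K=\emptyset$; and * eventually injective: for every compact set $K\subseteq\Omega$ there is an $N\in\mathbb N$ such that $\phi_n|_K$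 is injective for all $n\ge N$. Call $f\in\mathcal M_{l.u.}(\Omega)$ $\Phi$-universal in $\mathcal M_{l.u.}(\Omega)$ if $\{f\circ\phi:\phi\in\Phi\}$ is a dense subset of $\mathcal M_{l.u.}(\Omega)$. Then there is a $\Phi$-universal function in $\mathcal M_{l.u.}(\Omega)$, and the set of all such functions is a dense $G_\delta$-subset of $\mathcal M_{l.u.}(\Omega)$. -/

import Mathlib

open Set Filter Topology
open scoped OnePoint

noncomputable section

namespace ChordalSphere

/-- The chordal metric `χ` on the Riemann sphere `ℂ ∪ {∞}`. -/
def chi : OnePoint ℂ → OnePoint ℂ → ℝ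
  | OnePoint.some z, OnePoint.some w => ‖z - w‖ / (√(1 + ‖z‖ ^ 2) * √(1 + ‖w‖ ^ 2))
  | OnePoint.some z, ∞ => 1 / √(1 + ‖z‖ ^ 2)
  | ∞, OnePoint.some w => 1 / √(1 + ‖w‖ ^ 2)
  | ∞, ∞ => 0

/-- Stereographic projection onto the sphere of diameter one; used only to prove that `chi` is a
metric for the usual topology. -/
def stereo : OnePoint ℂ → WithLp 2 (ℂ × ℝ)
  | OnePoint.some z => WithLp.toLp 2 (((1 + ‖z‖ ^ 2)⁻¹ : ℝ) • z, 1 - (1 + ‖z‖ ^ 2)⁻¹)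
  | ∞ => WithLp.toLp 2 (0, 1)

theorem dist_toLp (a b : ℂ) (s t : ℝ) :
    dist (WithLp.toLp 2 (a, s)) (WithLp.toLp 2 (b, t)) = √(‖a - b‖ ^ 2 + ‖s - t‖ ^ 2) := by
  rw [WithLp.prod_dist_eq_of_L2, dist_eq_norm, dist_eq_norm]
  rfl

theorem chi_eq_dist (x y : OnePoint ℂ) : chi x y = dist (stereo x) (stereo y) := by
  have key : ∀ z : ℂ, 0 < 1 + ‖z‖ ^ 2 := fun z => by positivity
  induction x with
  | infty =>
    induction y with
    | infty => simp [chi]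
    | coe w =>
      have hw := key w
      simp only [chi, stereo]
      rw [dist_toLp]
      rw [eq_comm, Real.sqrt_eq_iff_mul_self_eq (by positivity) (by positivity)]
      rw [div_mul_div_comm, Real.mul_self_sqrt hw.le]
      simp only [zero_sub, norm_neg, norm_smul, Real.norm_eq_abs, mul_pow, sq_abs]
      field_simp
      ring
  | coe z =>
    have hz := key z
    induction y with
    | infty =>
      simp only [chi, stereo]
      rw [dist_toLp]
      rw [eq_comm, Real.sqrt_eq_iff_mul_self_eq (by positivity) (by positivity)]
      rw [div_mul_div_comm, Real.mul_self_sqrt hz.le]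
      simp only [sub_zero, norm_smul, Real.norm_eq_abs, mul_pow, sq_abs]
      field_simp
      ring
    | coe w =>
      have hw := key w
      simp only [chi, stereo]
      rw [dist_toLp]
      rw [eq_comm, Real.sqrt_eq_iff_mul_self_eq (by positivity) (by positivity)]
      rw [div_mul_div_comm, mul_mul_mul_comm, Real.mul_self_sqrt hz.le, Real.mul_self_sqrt hw.le]
      have h1 : ∀ u : ℂ, ‖u‖ ^ 2 = u.re ^ 2 + u.im ^ 2 := fun u => by
        rw [Complex.sq_norm, Complex.normSq_apply]; ring
      rw [← sq ‖z - w‖]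
      simp only [h1] at hz hw ⊢
      simp only [Complex.sub_re, Complex.sub_im, Complex.smul_re, Complex.smul_im, smul_eq_mul,
        Real.norm_eq_abs, sq_abs]
      field_simp
      ring

theorem stereo_injective : Function.Injective stereo := by
  intro x y h
  have h0 : chi x y = 0 := by rw [chi_eq_dist, h, dist_self]
  have key : ∀ z : ℂ, 0 < √(1 + ‖z‖ ^ 2) := fun z => by positivity
  induction x with
  | infty =>
    induction y with
    | infty => rfl
    | coe w => exact absurd h0 (one_div_pos.2 (key w)).ne'
  | coe z =>
    induction y with
    | infty => exact absurd h0 (one_div_pos.2 (key z)).ne'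
    | coe w =>
      have h1 : ‖z - w‖ / (√(1 + ‖z‖ ^ 2) * √(1 + ‖w‖ ^ 2)) = 0 := h0
      rw [div_eq_zero_iff, or_iff_left (mul_pos (key z) (key w)).ne', norm_eq_zero,
        sub_eq_zero] at h1
      rw [h1]

theorem stereo_continuous : Continuous stereo := by
  rw [OnePoint.continuous_iff]
  constructor
  · rw [tendsto_iff_dist_tendsto_zero, coclosedCompact_eq_cocompact]
    simp only [← chi_eq_dist]
    have h1 : Tendsto (fun z : ℂ => (√(1 + ‖z‖ ^ 2))⁻¹) (cocompact ℂ) (𝓝 0) := by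
      refine tendsto_inv_atTop_zero.comp (Real.tendsto_sqrt_atTop.comp ?_)
      exact tendsto_atTop_add_const_left _ _
        ((tendsto_pow_atTop two_ne_zero).comp (tendsto_norm_cocompact_atTop (E := ℂ)))
    refine h1.congr fun z => ?_
    change _ = 1 / √(1 + ‖z‖ ^ 2)
    exact (one_div (√(1 + ‖z‖ ^ 2))).symm
  · have h0 : ∀ z : ℂ, 1 + ‖z‖ ^ 2 ≠ 0 := fun z => by positivity
    have h1 : Continuous fun z : ℂ => (1 + ‖z‖ ^ 2)⁻¹ :=
      (by fun_prop : Continuous fun z : ℂ => 1 + ‖z‖ ^ 2).inv₀ h0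
    exact (WithLp.prod_continuous_toLp 2 ℂ ℝ).comp
      ((h1.smul continuous_id).prodMk (continuous_const.sub h1))

/-- The chordal metric as a metric space structure, with the topology it induces. -/
abbrev chordalMetricSpaceAux : MetricSpace (OnePoint ℂ) where
  dist := chi
  dist_self := fun x => by rw [chi_eq_dist, dist_self]
  dist_comm := fun x y => by rw [chi_eq_dist, chi_eq_dist, dist_comm]
  dist_triangle := fun x y z => by simp only [chi_eq_dist]; exact dist_triangle _ _ _
  eq_of_dist_eq_zero := fun {x y} h => by
    have h' : chi x y = 0 := h
    rw [chi_eq_dist] at h'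
    exact stereo_injective (dist_eq_zero.1 h')

theorem topology_eq : (inferInstance : TopologicalSpace (OnePoint ℂ)) =
    chordalMetricSpaceAux.toUniformSpace.toTopologicalSpace := by
  have h1 := (stereo_continuous.isClosedEmbedding stereo_injective).isInducing.eq_induced
  have h2 : @Isometry (OnePoint ℂ) (WithLp 2 (ℂ × ℝ))
      chordalMetricSpaceAux.toPseudoMetricSpace.toPseudoEMetricSpace _ stereo :=
    @Isometry.of_dist_eq _ _ chordalMetricSpaceAux.toPseudoMetricSpace _ stereo
      fun x y => (chi_eq_dist x y).symm
  exact h1.trans (@Topology.IsInducing.eq_induced _ _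
    chordalMetricSpaceAux.toUniformSpace.toTopologicalSpace _ _
    (@IsUniformInducing.isInducing _ _ chordalMetricSpaceAux.toUniformSpace _ _
      (@Isometry.isUniformInducing _ _
        chordalMetricSpaceAux.toPseudoMetricSpace.toPseudoEMetricSpace _ _ h2))).symm

/-- The Riemann sphere is a metric space under the chordal metric; the metric topology is the
topology of the one-point compactification. -/
instance chordalMetricSpace : MetricSpace (OnePoint ℂ) :=
  chordalMetricSpaceAux.replaceTopology topology_eq

theorem dist_eq_chi (x y : OnePoint ℂ) : dist x y = chi x y := rfl

end ChordalSphere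

/-- All functions from `Ω` to the Riemann sphere, with the topology of uniform convergence
with respect to the chordal metric on the compact subsets of `Ω`. For open `Ω` this is the topology
of locally uniform convergence. -/
abbrev SphereMap (Ω : Set ℂ) : Type :=
  UniformOnFun Ω (OnePoint ℂ) {K : Set Ω | IsCompact K}

/-- The underlying function. -/
abbrev SphereMap.toFun {Ω : Set ℂ} (f : SphereMap Ω) : Ω → OnePoint ℂ :=
  UniformOnFun.toFun {K : Set Ω | IsCompact K} f

/-- Composition `f ∘ φ` with a self-map of `Ω`. -/
def SphereMap.comp {Ω : Set ℂ} (f : SphereMap Ω) (φ : Ω → Ω) : SphereMap Ω :=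
  UniformOnFun.ofFun {K : Set Ω | IsCompact K} (f.toFun ∘ φ)

/-- Extension by `0` of a function on `Ω` to all of `ℂ`. -/
def extendZero {Ω : Set ℂ} (h : Ω → ℂ) : ℂ → ℂ := Function.extend Subtype.val h 0

/-- The complex-valued function on `ℂ` that agrees with `f` at the points of `Ω` where `f` is finite
(and has the irrelevant value `0` elsewhere). -/
def finitePart {Ω : Set ℂ} (f : SphereMap Ω) : ℂ → ℂ :=
  extendZero fun z => (f.toFun z).elim 0 id

/-- `f` is meromorphic on `Ω`: at every point, either `f` is finite and holomorphic, or `f` has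
the value `∞` and a pole. (The order at a point only depends on a punctured neighbourhood.) -/
def IsMeromorphic {Ω : Set ℂ} (f : SphereMap Ω) : Prop :=
  ∀ z : Ω, (f.toFun z ≠ ∞ ∧ AnalyticAt ℂ (finitePart f) z) ∨
    (f.toFun z = ∞ ∧ MeromorphicAt (finitePart f) z ∧ meromorphicOrderAt (finitePart f) z < 0)

/-- The set `M_{l.u.}(Ω)` of locally univalent meromorphic functions on `Ω`: meromorphic functions
with at most simple poles and with nonvanishing derivative at all points that are not poles. -/
def locallyUnivalentMeromorphic (Ω : Set ℂ) : Set (SphereMap Ω) :=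
  {f | IsMeromorphic f ∧
    (∀ z : Ω, f.toFun z = ∞ → meromorphicOrderAt (finitePart f) z = -1) ∧
    (∀ z : Ω, f.toFun z ≠ ∞ → deriv (finitePart f) z ≠ 0)}

/-- `φ` is a locally univalent (holomorphic) self-map of `Ω`. -/
def IsLocallyUnivalentSelfMap {Ω : Set ℂ} (φ : Ω → Ω) : Prop :=
  DifferentiableOn ℂ (extendZero fun z => (φ z : ℂ)) Ω ∧
    ∀ z ∈ Ω, deriv (extendZero fun z => (φ z : ℂ)) z ≠ 0

/-- The sequence `(φ n)` of self-maps is run-away. -/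
def IsRunAway {Ω : Set ℂ} (φ : ℕ → Ω → Ω) : Prop :=
  ∀ K : Set Ω, IsCompact K → ∃ n, φ n '' K ∩ K = ∅

/-- The sequence `(φ n)` of self-maps is eventually injective. -/
def IsEventuallyInjective {Ω : Set ℂ} (φ : ℕ → Ω → Ω) : Prop :=
  ∀ K : Set Ω, IsCompact K → ∃ N, ∀ n ≥ N, InjOn (φ n) K

/-- `g` is `Φ`-universal in `𝒢`: `g` belongs to `𝒢` and `{g ∘ φ | φ ∈ Φ}` is a dense subset
of `𝒢`. -/
def IsUniversalIn {Ω : Set ℂ} (Φ : Set (Ω → Ω)) (𝒢 : Set (SphereMap Ω)) (g : SphereMap Ω) :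
    Prop :=
  g ∈ 𝒢 ∧ {h | ∃ φ ∈ Φ, h = g.comp φ} ⊆ 𝒢 ∧ 𝒢 ⊆ closure {h | ∃ φ ∈ Φ, h = g.comp φ}

end

/-!
By the Baire category theorem it suffices that `M_{l.u.}(Ω)` is a Baire space and that, for every
`ε > 0`, compact `K ⊆ Ω` and `f, g ∈ M_{l.u.}(Ω)`, some `F ∈ M_{l.u.}(Ω)` and some `n` satisfy
`χ(F, f) < ε` and `χ(F ∘ φ n, g) < ε` on `K`.

The first point is Hurwitz's theorem: a limit of locally univalent functions is either locally
univalent or constant, so `M_{l.u.}(Ω)` is the intersection of its closure with an open set in the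
Polish space of continuous maps from `Ω` to the sphere.

For the second point, a Riemann map places `K` in a disc. For suitable large `n` the map `φ n`
embeds a larger disc conformally and moves it off itself, so that one has to approximate a locally
univalent function `H` on the union of two disjoint conformal discs by one that is locally univalent
on all of `ℂ`. Let `P` be a polynomial with simple zeros, exactly at the poles of `H`. Then
`H' = exp (-2 h) / P ^ 2`, where `h` is holomorphic on the two discs and is only constrained at the
zeros of `P`, by the vanishing of the residues of `H'`. Approximating `h` by polynomials `r` that
agree with it to second order at the zeros of `P` keeps the residues zero, so that
`exp (-2 r) / P ^ 2` has a locally univalent primitive on `ℂ`, whose derivative is close to `H'` on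
both discs. The constant of integration makes the primitive close to `H` on one disc; prescribing
also the integral of the derivative along a segment that joins the discs makes it close to `H` on
the other.
-/

namespace LocallyUnivalent

open Metric MeasureTheory Polynomial

/-! ### Conformal embeddings -/

/-- `θ` maps the set `B` conformally and injectively into the plane. Differentiability is not a
field, because `deriv θ z ≠ 0` forces `θ` to be differentiable at `z`. -/
structure IsConformalEmbedding (θ : ℂ → ℂ) (B : Set ℂ) : Prop where
  injOn : InjOn θ B
  deriv_ne_zero : ∀ z ∈ B, deriv θ z ≠ 0

namespace IsConformalEmbedding

variable {f g s θ : ℂ → ℂ} {B B' U V : Set ℂ} {z : ℂ}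

theorem mono (h : IsConformalEmbedding θ B) (hB : B' ⊆ B) : IsConformalEmbedding θ B' :=
  ⟨h.injOn.mono hB, fun z hz => h.deriv_ne_zero z (hB hz)⟩

theorem hasDerivAt (h : IsConformalEmbedding θ B) (hz : z ∈ B) : HasDerivAt θ (deriv θ z) z :=
  (differentiableAt_of_deriv_ne_zero (h.deriv_ne_zero z hz)).hasDerivAt

theorem differentiableOn (h : IsConformalEmbedding θ B) : DifferentiableOn ℂ θ B :=
  fun _ hz => (h.hasDerivAt hz).differentiableAt.differentiableWithinAt

theorem hasStrictDerivAt (h : IsConformalEmbedding θ B) (hB : IsOpen B) (hz : z ∈ B) :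
    HasStrictDerivAt θ (deriv θ z) z :=
  (h.differentiableOn.analyticAt (hB.mem_nhds hz)).hasStrictDerivAt

theorem image_mem_nhds (h : IsConformalEmbedding θ B) (hB : IsOpen B) (hz : z ∈ B) {s : Set ℂ}
    (hs : s ∈ 𝓝 z) : θ '' s ∈ 𝓝 (θ z) := by
  rw [← (h.hasStrictDerivAt hB hz).map_nhds_eq (h.deriv_ne_zero z hz)]
  exact image_mem_map hs

theorem isOpen_image (h : IsConformalEmbedding θ B) (hB : IsOpen B) : IsOpen (θ '' B) := by
  rw [isOpen_iff_mem_nhds]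
  rintro _ ⟨z, hz, rfl⟩
  exact h.image_mem_nhds hB hz (hB.mem_nhds hz)

theorem comp (hg : IsConformalEmbedding g V) (hf : IsConformalEmbedding f U) (h : MapsTo f U V) :
    IsConformalEmbedding (g ∘ f) U :=
  ⟨hg.injOn.comp hf.injOn h, fun z hz => by
    rw [((hg.hasDerivAt (h hz)).comp z (hf.hasDerivAt hz)).deriv]
    exact mul_ne_zero (hg.deriv_ne_zero _ (h hz)) (hf.deriv_ne_zero z hz)⟩

theorem of_sq_eq (hU : IsOpen U) (hg : IsConformalEmbedding g U) (hs : DifferentiableOn ℂ s U)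
    (h : ∀ z ∈ U, s z ^ 2 = g z) : IsConformalEmbedding s U := by
  refine ⟨fun x hx y hy hxy => hg.injOn hx hy (by rw [← h x hx, ← h y hy, hxy]),
    fun z hz hsz => hg.deriv_ne_zero z hz ?_⟩
  have hgs : g =ᶠ[𝓝 z] fun w => s w ^ 2 := by
    filter_upwards [hU.mem_nhds hz] with w hw using (h w hw).symm
  have hs2 := (hs.differentiableAt (hU.mem_nhds hz)).hasDerivAt.fun_pow 2
  rw [hgs.deriv_eq, hs2.deriv, hsz, mul_zero]

theorem exists_inverse (h : IsConformalEmbedding θ B) (hB : IsOpen B) :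
    ∃ ψ : ℂ → ℂ, IsConformalEmbedding ψ (θ '' B) ∧ ∀ z ∈ B, ψ (θ z) = z := by
  set ψ := Function.invFunOn θ B
  have hψ : ∀ z ∈ B, ψ (θ z) = z := h.injOn.leftInvOn_invFunOn
  have hder : ∀ z ∈ B, HasStrictDerivAt ψ (deriv θ z)⁻¹ (θ z) := by
    intro z hz
    refine HasStrictDerivAt.of_local_left_inverse (f := θ) ?_ ?_ (h.deriv_ne_zero z hz) ?_
    · rw [ContinuousAt, hψ z hz]
      intro s hs
      rw [mem_map]
      filter_upwards [h.image_mem_nhds hB hz (inter_mem hs (hB.mem_nhds hz))]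
      rintro _ ⟨v, ⟨hvs, hvB⟩, rfl⟩
      rwa [mem_preimage, hψ v hvB]
    · rw [hψ z hz]
      exact h.hasStrictDerivAt hB hz
    · filter_upwards [h.image_mem_nhds hB hz (hB.mem_nhds hz)]
      rintro _ ⟨v, hv, rfl⟩
      rw [hψ v hv]
  refine ⟨ψ, ⟨?_, ?_⟩, hψ⟩
  · rintro _ ⟨z, hz, rfl⟩ _ ⟨w, hw, rfl⟩ hzw
    rw [← hψ z hz, hzw, hψ w hw]
  · rintro _ ⟨z, hz, rfl⟩
    rw [(hder z hz).hasDerivAt.deriv]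
    exact inv_ne_zero (h.deriv_ne_zero z hz)

theorem isSimplyConnected_image (h : IsConformalEmbedding θ B) (hB : IsOpen B)
    (hsc : IsSimplyConnected B) : IsSimplyConnected (θ '' B) := by
  have hcont : Continuous (B.domRestrict θ) :=
    continuousOn_iff_continuous_domRestrict.1 h.differentiableOn.continuousOn
  have hopen : IsOpenMap (B.domRestrict θ) := by
    intro s hs
    rw [isOpen_iff_mem_nhds]
    rintro _ ⟨z, hz, rfl⟩
    have hs' : Subtype.val '' s ∈ 𝓝 (z : ℂ) :=
      (hB.isOpenMap_subtype_val s hs).mem_nhds ⟨z, hz, rfl⟩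
    simpa only [image_image] using! h.image_mem_nhds hB z.2 hs'
  have hemb := (IsOpenEmbedding.of_continuous_injective_isOpenMap hcont
    (injOn_iff_injective.1 h.injOn) hopen).isEmbedding
  have himage := hemb.isSimplyConnected_image (s := univ)
  have hval := (IsEmbedding.subtypeVal (p := (· ∈ B))).isSimplyConnected_image (s := univ)
  rw [image_univ, range_domRestrict] at himage
  rw [image_univ, Subtype.range_coe_subtype] at hval
  exact himage.2 (hval.1 hsc)

end IsConformalEmbedding

/-! ### Limits of holomorphic functions -/

theorem exists_differentiableOn_exp_eq {U : Set ℂ} (hU : IsOpen U) (hsc : IsSimplyConnected U)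
    {g : ℂ → ℂ} (hg : DifferentiableOn ℂ g U) (h0 : ∀ z ∈ U, g z ≠ 0) :
    ∃ l : ℂ → ℂ, DifferentiableOn ℂ l U ∧ ∀ z ∈ U, Complex.exp (l z) = g z := by
  obtain ⟨l, hlc, hl⟩ := Complex.exists_continuousOn_eqOn_exp_comp hsc hU hg.continuousOn
    (by rintro ⟨z, hz, h⟩; exact h0 z hz h)
  refine ⟨l, fun z hz => ?_, fun z hz => hl hz⟩
  have hexp : HasStrictDerivAt Complex.exp (Complex.exp (l z)) (l z) :=
    Complex.hasStrictDerivAt_exp _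
  set L := hexp.localInverse Complex.exp (Complex.exp (l z)) (l z) (Complex.exp_ne_zero _)
  have hLexp : ∀ᶠ w in 𝓝 (l z), L (Complex.exp w) = w :=
    hexp.eventually_left_inverse (Complex.exp_ne_zero _)
  have hLg : l =ᶠ[𝓝 z] L ∘ g := by
    filter_upwards [(hlc.continuousAt (hU.mem_nhds hz)).eventually hLexp, hU.mem_nhds hz]
      with w hw hwU
    rw [Function.comp_apply, ← hl hwU]
    exact hw.symm
  have hL : DifferentiableAt ℂ L (g z) := by
    rw [← hl hz]
    exact (hexp.to_localInverse (Complex.exp_ne_zero _)).hasDerivAt.differentiableAt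
  exact ((hL.comp z (hg.differentiableAt (hU.mem_nhds hz))).congr_of_eventuallyEq
    hLg).differentiableWithinAt

theorem exists_differentiableOn_sq_eq {U : Set ℂ} (hU : IsOpen U) (hsc : IsSimplyConnected U)
    {g : ℂ → ℂ} (hg : DifferentiableOn ℂ g U) (h0 : ∀ z ∈ U, g z ≠ 0) :
    ∃ s : ℂ → ℂ, DifferentiableOn ℂ s U ∧ ∀ z ∈ U, s z ^ 2 = g z := by
  obtain ⟨l, hl, hlg⟩ := exists_differentiableOn_exp_eq hU hsc hg h0
  refine ⟨fun z => Complex.exp (l z / 2), (hl.div_const 2).cexp, fun z hz => ?_⟩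
  rw [← hlg z hz, ← Complex.exp_nat_mul]
  congr 1
  push_cast
  ring

theorem le_norm_of_forall_sphere_le_norm {f : ℂ → ℂ} {z : ℂ} {r m : ℝ} (hr : 0 < r) (hm : 0 < m)
    (hf : DifferentiableOn ℂ f (closedBall z r)) (h0 : ∀ w ∈ closedBall z r, f w ≠ 0)
    (hfm : ∀ w ∈ sphere z r, m ≤ ‖f w‖) : m ≤ ‖f z‖ := by
  have hinv : DiffContOnCl ℂ (fun w => (f w)⁻¹) (ball z r) := by
    refine DifferentiableOn.diffContOnCl ?_
    rw [closure_ball _ hr.ne']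
    exact hf.inv h0
  have hmax : ‖(f z)⁻¹‖ ≤ m⁻¹ := by
    refine Complex.norm_le_of_forall_mem_frontier_norm_le isBounded_ball hinv (fun w hw => ?_)
      (subset_closure (mem_ball_self hr))
    rw [frontier_ball _ hr.ne'] at hw
    rw [norm_inv]
    exact inv_anti₀ hm (hfm w hw)
  rw [norm_inv] at hmax
  exact (inv_le_inv₀ (norm_pos_iff.2 (h0 z (mem_closedBall_self hr.le))) hm).1 hmax

section Hurwitz

variable {ι : Type*} {p : Filter ι} [p.NeBot] {U : Set ℂ} {f : ι → ℂ → ℂ} {g : ℂ → ℂ}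

theorem eventually_eq_zero_of_tendstoLocallyUniformlyOn (hU : IsOpen U)
    (hfg : TendstoLocallyUniformlyOn f g p U) (hf : ∀ᶠ n in p, DifferentiableOn ℂ (f n) U)
    (hf0 : ∀ᶠ n in p, ∀ z ∈ U, f n z ≠ 0) {z : ℂ} (hz : z ∈ U) (hgz : g z = 0) :
    ∀ᶠ w in 𝓝 z, g w = 0 := by
  have hg : DifferentiableOn ℂ g U := hfg.differentiableOn hf hU
  refine (hg.analyticAt (hU.mem_nhds hz)).eventually_eq_zero_or_eventually_ne_zero.resolve_right
    fun hne => ?_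
  rw [eventually_nhdsWithin_iff] at hne
  obtain ⟨r, hr, hsub⟩ := nhds_basis_closedBall.mem_iff.1 (hne.and (hU.mem_nhds hz))
  have hrU : closedBall z r ⊆ U := fun w hw => (hsub hw).2
  obtain ⟨w₀, hw₀, hmin⟩ := (isCompact_sphere z r).exists_isMinOn
    (NormedSpace.sphere_nonempty.2 hr.le) (hg.continuousOn.norm.mono
      (sphere_subset_closedBall.trans hrU))
  have hm : 0 < ‖g w₀‖ :=
    norm_pos_iff.2 ((hsub (sphere_subset_closedBall hw₀)).1 (ne_of_mem_sphere hw₀ hr.ne'))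
  have hunif := (tendstoLocallyUniformlyOn_iff_forall_isCompact hU).1 hfg _ hrU
    (isCompact_closedBall z r)
  obtain ⟨n, hn, hd, h0⟩ := ((Metric.tendstoUniformlyOn_iff.1 hunif (‖g w₀‖ / 2)
    (by positivity)).and (hf.and hf0)).exists
  have hcenter : ‖g w₀‖ / 2 ≤ ‖f n z‖ := by
    refine le_norm_of_forall_sphere_le_norm hr (by positivity) (hd.mono hrU)
      (fun w hw => h0 w (hrU hw)) fun w hw => ?_
    have hdist := hn w (sphere_subset_closedBall hw)
    rw [dist_eq_norm] at hdist
    have hmw : ‖g w₀‖ ≤ ‖g w‖ := hmin hw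
    linarith [norm_sub_norm_le (g w) (f n w)]
  have hdist := hn z (mem_closedBall_self hr.le)
  rw [hgz, dist_zero_left] at hdist
  linarith

theorem eqOn_zero_or_forall_ne_zero_of_tendstoLocallyUniformlyOn (hU : IsOpen U)
    (hconn : IsPreconnected U) (hfg : TendstoLocallyUniformlyOn f g p U)
    (hf : ∀ᶠ n in p, DifferentiableOn ℂ (f n) U) (hf0 : ∀ᶠ n in p, ∀ z ∈ U, f n z ≠ 0) :
    EqOn g 0 U ∨ ∀ z ∈ U, g z ≠ 0 := by
  by_contra! ⟨hne, z, hz, hgz⟩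
  exact hne (((hfg.differentiableOn hf hU).analyticOnNhd hU).eqOn_of_preconnected_of_eventuallyEq
    analyticOnNhd_const hconn hz
    (eventually_eq_zero_of_tendstoLocallyUniformlyOn hU hfg hf hf0 hz hgz))

theorem eqOn_const_or_injOn_of_tendstoLocallyUniformlyOn (hU : IsOpen U)
    (hconn : IsPreconnected U) (hfg : TendstoLocallyUniformlyOn f g p U)
    (hf : ∀ᶠ n in p, DifferentiableOn ℂ (f n) U) (hinj : ∀ᶠ n in p, InjOn (f n) U) :
    (∃ c, EqOn g (fun _ => c) U) ∨ InjOn g U := by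
  refine or_iff_not_imp_left.2 fun hc x hx y hy hxy => ?_
  by_contra hne
  have hconst : TendstoLocallyUniformlyOn (fun n _ => f n x) (fun _ : ℂ => g x) p U := by
    rw [Metric.tendstoLocallyUniformlyOn_iff]
    intro ε hε z _
    refine ⟨univ, univ_mem, ?_⟩
    filter_upwards [Metric.tendsto_nhds.1 (hfg.tendsto_at hx) ε hε] with n hn w _
    rwa [dist_comm]
  have hev := eventually_eq_zero_of_tendstoLocallyUniformlyOn (hU.inter isOpen_compl_singleton)
    ((hfg.sub hconst).mono inter_subset_left)
    (hf.mono fun n hn => (hn.sub_const _).mono inter_subset_left)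
    (hinj.mono fun n hn w hw h => hw.2 (hn hw.1 hx (sub_eq_zero.1 h)))
    (z := y) ⟨hy, Ne.symm hne⟩ (by simp [hxy])
  have hg : AnalyticOnNhd ℂ g U := (hfg.differentiableOn hf hU).analyticOnNhd hU
  exact hc ⟨g x, hg.eqOn_of_preconnected_of_eventuallyEq analyticOnNhd_const hconn hy
    (hev.mono fun w hw => sub_eq_zero.1 hw)⟩

end Hurwitz

theorem tendstoLocallyUniformlyOn_of_forall_tendsto {ι : Type*} {p : Filter ι} [p.NeBot]
    {U : Set ℂ} (hU : IsOpen U) {f : ι → ℂ → ℂ} {g : ℂ → ℂ} {M : ℝ}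
    (hf : ∀ n, DifferentiableOn ℂ (f n) U) (hM : ∀ n, ∀ z ∈ U, ‖f n z‖ ≤ M)
    (hlim : ∀ z ∈ U, Tendsto (fun n => f n z) p (𝓝 (g z))) :
    TendstoLocallyUniformlyOn f g p U := by
  rw [Metric.tendstoLocallyUniformlyOn_iff]
  intro ε hε z hz
  obtain ⟨d, hd, hdU⟩ := Metric.isOpen_iff.1 hU z hz
  have hlip : ∀ n, ∀ w ∈ ball z d, dist (f n w) (f n z) ≤ 2 * M / d * dist w z := by
    intro n w hw
    refine Complex.dist_le_div_mul_dist_of_mapsTo_ball ((hf n).mono hdU) (fun v hv => ?_) hw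
    rw [mem_closedBall]
    linarith [dist_le_norm_add_norm (f n v) (f n z), hM n v (hdU hv), hM n z hz]
  have hlipg : ∀ w ∈ ball z d, dist (g w) (g z) ≤ 2 * M / d * dist w z := fun w hw =>
    le_of_tendsto ((hlim w (hdU hw)).dist (hlim z hz)) (Eventually.of_forall fun n => hlip n w hw)
  have hsmall : ∀ᶠ w in 𝓝 z, 2 * M / d * dist w z < ε / 4 := by
    have hcont : Continuous fun w => 2 * M / d * dist w z := by fun_prop
    refine hcont.continuousAt.eventually_lt_const ?_
    simpa only [dist_self, mul_zero] using (by positivity : 0 < ε / 4)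
  refine ⟨_, mem_nhdsWithin_of_mem_nhds (inter_mem hsmall (ball_mem_nhds z hd)), ?_⟩
  filter_upwards [Metric.tendsto_nhds.1 (hlim z hz) (ε / 4) (by positivity)] with n hn w ⟨hw, hwd⟩
  have hw' : 2 * M / d * dist w z < ε / 4 := hw
  calc dist (g w) (f n w) ≤ dist (g w) (g z) + dist (f n z) (g z) + dist (f n w) (f n z) := by
        rw [dist_comm (f n z), dist_comm (f n w)]
        exact dist_triangle4 _ _ _ _
    _ < ε := by linarith [hlipg w hwd, hlip n w hwd]

theorem exists_tendstoLocallyUniformlyOn_ultrafilter {ι : Type*} (p : Ultrafilter ι) {U : Set ℂ}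
    (hU : IsOpen U) {f : ι → ℂ → ℂ} {M : ℝ} (hf : ∀ n, DifferentiableOn ℂ (f n) U)
    (hM : ∀ n, ∀ z ∈ U, ‖f n z‖ ≤ M) : ∃ g, TendstoLocallyUniformlyOn f g p U := by
  have hlim : ∀ z : ℂ, ∃ y, z ∈ U → Tendsto (fun n => f n z) p (𝓝 y) := by
    intro z
    by_cases hz : z ∈ U
    · obtain ⟨y, -, hy⟩ := (isCompact_closedBall (0 : ℂ) M).ultrafilter_le_nhds
        (p.map fun n => f n z) (by
          rw [Ultrafilter.coe_map, le_principal_iff, mem_map]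
          exact Eventually.of_forall fun n => mem_closedBall_zero_iff.2 (hM n z hz))
      exact ⟨y, fun _ => hy⟩
    · exact ⟨0, fun h => absurd h hz⟩
  choose g hg using hlim
  exact ⟨g, tendstoLocallyUniformlyOn_of_forall_tendsto hU hf hM hg⟩

/-! ### The Riemann mapping theorem -/

/-- The automorphism of the unit disc that takes `w` to zero. -/
noncomputable def discAut (w z : ℂ) : ℂ := (z - w) / (1 - (starRingEnd ℂ) w * z)

section DiscAut

variable {w z : ℂ}

theorem one_sub_conj_mul_ne_zero (hw : ‖w‖ < 1) (hz : ‖z‖ < 1) :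
    1 - (starRingEnd ℂ) w * z ≠ 0 := by
  intro h
  have hnorm : ‖(starRingEnd ℂ) w * z‖ = 1 := by rw [← sub_eq_zero.1 h, norm_one]
  rw [norm_mul, RCLike.norm_conj] at hnorm
  exact (mul_lt_one_of_nonneg_of_lt_one_left (norm_nonneg w) hw hz.le).ne hnorm

theorem discAut_self (w : ℂ) : discAut w w = 0 := by simp [discAut]

theorem sq_norm_one_sub_conj_mul_sub_sq_norm_sub (w z : ℂ) :
    ‖1 - (starRingEnd ℂ) w * z‖ ^ 2 - ‖z - w‖ ^ 2 = (1 - ‖w‖ ^ 2) * (1 - ‖z‖ ^ 2) := by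
  simp only [Complex.sq_norm, Complex.normSq_apply, Complex.sub_re, Complex.sub_im, Complex.mul_re,
    Complex.mul_im, Complex.conj_re, Complex.conj_im, Complex.one_re, Complex.one_im]
  ring

theorem norm_discAut_lt_one (hw : ‖w‖ < 1) (hz : ‖z‖ < 1) : ‖discAut w z‖ < 1 := by
  rw [discAut, norm_div, div_lt_one (norm_pos_iff.2 (one_sub_conj_mul_ne_zero hw hz))]
  refine lt_of_pow_lt_pow_left₀ 2 (norm_nonneg _) (sub_pos.1 ?_)
  rw [sq_norm_one_sub_conj_mul_sub_sq_norm_sub]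
  exact mul_pos (sub_pos.2 (pow_lt_one₀ (norm_nonneg w) hw two_ne_zero))
    (sub_pos.2 (pow_lt_one₀ (norm_nonneg z) hz two_ne_zero))

theorem one_sub_sq_norm_ne_zero (hw : ‖w‖ < 1) : 1 - (‖w‖ : ℂ) ^ 2 ≠ 0 := by
  rw [← Complex.conj_mul']
  exact one_sub_conj_mul_ne_zero hw hw

theorem hasDerivAt_discAut (hw : ‖w‖ < 1) (hz : ‖z‖ < 1) :
    HasDerivAt (discAut w) ((1 - (‖w‖ : ℂ) ^ 2) / (1 - (starRingEnd ℂ) w * z) ^ 2) z := by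
  have hquot := ((hasDerivAt_id z).sub_const w).div
    (((hasDerivAt_id z).const_mul ((starRingEnd ℂ) w)).const_sub 1) (one_sub_conj_mul_ne_zero hw hz)
  refine hquot.congr_deriv ?_
  rw [← Complex.conj_mul']
  simp only [id]
  ring

theorem isConformalEmbedding_discAut (hw : ‖w‖ < 1) :
    IsConformalEmbedding (discAut w) (ball 0 1) := by
  refine ⟨fun x hx y hy h => ?_, fun z hz => ?_⟩
  · rw [mem_ball_zero_iff] at hx hy
    rw [discAut, discAut, div_eq_div_iff (one_sub_conj_mul_ne_zero hw hx)
      (one_sub_conj_mul_ne_zero hw hy)] at h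
    have hprod : (x - y) * (1 - (starRingEnd ℂ) w * w) = 0 := by linear_combination h
    exact sub_eq_zero.1 ((mul_eq_zero.1 hprod).resolve_right (one_sub_conj_mul_ne_zero hw hw))
  · rw [mem_ball_zero_iff] at hz
    rw [(hasDerivAt_discAut hw hz).deriv]
    exact div_ne_zero (one_sub_sq_norm_ne_zero hw) (pow_ne_zero 2 (one_sub_conj_mul_ne_zero hw hz))

theorem mapsTo_discAut (hw : ‖w‖ < 1) : MapsTo (discAut w) (ball 0 1) (ball 0 1) := fun _ hz =>
  mem_ball_zero_iff.2 (norm_discAut_lt_one hw (mem_ball_zero_iff.1 hz))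

theorem norm_one_sub_sq_norm (hw : ‖w‖ < 1) : ‖1 - (‖w‖ : ℂ) ^ 2‖ = 1 - ‖w‖ ^ 2 := by
  have hreal : 1 - (‖w‖ : ℂ) ^ 2 = ((1 - ‖w‖ ^ 2 : ℝ) : ℂ) := by push_cast; rfl
  rw [hreal, Complex.norm_of_nonneg (sub_nonneg.2 (pow_le_one₀ (norm_nonneg w) hw.le))]

theorem norm_deriv_discAut_zero (hw : ‖w‖ < 1) : ‖deriv (discAut w) 0‖ = 1 - ‖w‖ ^ 2 := by
  rw [(hasDerivAt_discAut hw (by simp)).deriv, mul_zero, sub_zero, one_pow, div_one,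
    norm_one_sub_sq_norm hw]

theorem norm_deriv_discAut_self (hw : ‖w‖ < 1) : ‖deriv (discAut w) w‖ = (1 - ‖w‖ ^ 2)⁻¹ := by
  have h0 : 1 - ‖w‖ ^ 2 ≠ 0 := (sub_pos.2 (pow_lt_one₀ (norm_nonneg w) hw two_ne_zero)).ne'
  rw [(hasDerivAt_discAut hw hw).deriv, Complex.conj_mul', norm_div, norm_pow,
    norm_one_sub_sq_norm hw]
  field_simp

end DiscAut

/-- The competitors in the extremal problem of the Riemann mapping theorem: conformal embeddings of
`U` into the unit disc that take `z₀` to zero. -/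
structure IsNormalizedEmbedding (U : Set ℂ) (z₀ : ℂ) (f : ℂ → ℂ) : Prop
    extends IsConformalEmbedding f U where
  mapsTo : MapsTo f U (ball 0 1)
  map_zero : f z₀ = 0

theorem IsConformalEmbedding.isNormalizedEmbedding_discAut_comp {U : Set ℂ} {z₀ : ℂ} {f : ℂ → ℂ}
    (hf : IsConformalEmbedding f U) (hm : MapsTo f U (ball 0 1)) (hz₀ : z₀ ∈ U) :
    IsNormalizedEmbedding U z₀ (discAut (f z₀) ∘ f) :=
  have hfz₀ : ‖f z₀‖ < 1 := mem_ball_zero_iff.1 (hm hz₀)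
  ⟨(isConformalEmbedding_discAut hfz₀).comp hf hm, (mapsTo_discAut hfz₀).comp hm, discAut_self _⟩

theorem IsConformalEmbedding.const_div_sub {U : Set ℂ} {s : ℂ → ℂ} (hs : IsConformalEmbedding s U)
    {b c : ℂ} (hc : c ≠ 0) (hb : ∀ z ∈ U, s z ≠ b) :
    IsConformalEmbedding (fun z => c / (s z - b)) U := by
  have hb' : ∀ z ∈ U, s z - b ≠ 0 := fun z hz => sub_ne_zero.2 (hb z hz)
  refine ⟨fun x hx y hy h => hs.injOn hx hy ?_, fun z hz => ?_⟩
  · rw [div_eq_div_iff (hb' x hx) (hb' y hy)] at h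
    exact (sub_left_injective (mul_left_cancel₀ hc h)).symm
  · have hd := (((hs.hasDerivAt hz).sub_const b).fun_inv (hb' z hz)).const_mul c
    simp only [← div_eq_mul_inv] at hd
    rw [hd.deriv]
    exact mul_ne_zero hc (div_ne_zero (neg_ne_zero.2 (hs.deriv_ne_zero z hz))
      (pow_ne_zero 2 (hb' z hz)))

/-- A square root of `z - a` omits a disc, since its image is open and disjoint from its
negative. -/
theorem exists_isConformalEmbedding_forall_lt_norm_sub {U : Set ℂ} (hU : IsOpen U)
    (hsc : IsSimplyConnected U) (hne : U ≠ univ) :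
    ∃ s b, ∃ ε > 0, IsConformalEmbedding s U ∧ ∀ z ∈ U, ε < ‖s z - b‖ := by
  obtain ⟨a, ha⟩ := (ne_univ_iff_exists_notMem U).1 hne
  have ha0 : ∀ z ∈ U, z - a ≠ 0 := fun z hz => sub_ne_zero.2 (ne_of_mem_of_not_mem hz ha)
  obtain ⟨s, hs, hs2⟩ := exists_differentiableOn_sq_eq hU hsc (g := fun z => z - a)
    (by fun_prop) ha0
  have hid : IsConformalEmbedding (fun z => z - a) U :=
    ⟨sub_left_injective.injOn, fun z _ => by simp⟩
  have hsU : IsConformalEmbedding s U := .of_sq_eq hU hid hs hs2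
  obtain ⟨x, hx⟩ := hsc.nonempty
  obtain ⟨ε, hε, hball⟩ :=
    nhds_basis_closedBall.mem_iff.1 (hsU.image_mem_nhds hU hx (hU.mem_nhds hx))
  refine ⟨s, -s x, ε, hε, hsU, fun z hz => not_le.1 fun hle => ?_⟩
  obtain ⟨v, hv, hvs⟩ : -s z ∈ s '' U := hball (by
    rw [mem_closedBall, dist_eq_norm, ← norm_neg]
    rwa [neg_sub', neg_neg])
  have hvz : v = z := hid.injOn hv hz (by rw [← hs2 v hv, ← hs2 z hz, hvs, neg_sq])
  rw [hvz] at hvs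
  exact ha0 z hz (by rw [← hs2 z hz, self_eq_neg.1 hvs, zero_pow two_ne_zero])

theorem exists_isNormalizedEmbedding {U : Set ℂ} (hU : IsOpen U) (hsc : IsSimplyConnected U)
    (hne : U ≠ univ) {z₀ : ℂ} (hz₀ : z₀ ∈ U) : ∃ f, IsNormalizedEmbedding U z₀ f := by
  obtain ⟨s, b, ε, hε, hs, hfar⟩ := exists_isConformalEmbedding_forall_lt_norm_sub hU hsc hne
  have hpos : ∀ z ∈ U, 0 < ‖s z - b‖ := fun z hz => hε.trans (hfar z hz)
  have hemb := hs.const_div_sub (c := ε) (by exact_mod_cast hε.ne')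
    fun z hz => sub_ne_zero.1 (norm_pos_iff.1 (hpos z hz))
  refine ⟨_, hemb.isNormalizedEmbedding_discAut_comp (fun z hz => ?_) hz₀⟩
  rw [mem_ball_zero_iff, norm_div, Complex.norm_of_nonneg hε.le, div_lt_one (hpos z hz)]
  exact hfar z hz

theorem lt_inv_one_sub_sq_mul {b x y : ℝ} (hb0 : 0 < b) (hb1 : b < 1) (hy : 0 < y)
    (h : (1 - (b ^ 2) ^ 2) * x = 2 * b * y) : x < (1 - b ^ 2)⁻¹ * y := by
  have hb : 0 < 1 - b ^ 2 := by nlinarith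
  rw [inv_mul_eq_div, lt_div_iff₀ hb]
  have hprod : (1 + b ^ 2) * (x * (1 - b ^ 2)) < (1 + b ^ 2) * y := by
    calc (1 + b ^ 2) * (x * (1 - b ^ 2)) = 2 * b * y := by rw [← h]; ring
      _ < (1 + b ^ 2) * y := by
        have : 0 < (1 - b) ^ 2 := pow_pos (sub_pos.2 hb1) 2
        gcongr
        linarith
  exact lt_of_mul_lt_mul_left hprod (by positivity)

namespace IsNormalizedEmbedding

variable {U : Set ℂ} {z₀ : ℂ}

theorem norm_deriv_le {f : ℂ → ℂ} (hf : IsNormalizedEmbedding U z₀ f) {d : ℝ} (hd : 0 < d)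
    (hdU : ball z₀ d ⊆ U) : ‖deriv f z₀‖ ≤ 1 / d := by
  refine Complex.norm_deriv_le_div_of_mapsTo_ball (hf.differentiableOn.mono hdU) ?_ hd
  rw [hf.map_zero]
  exact fun v hv => ball_subset_closedBall (hf.mapsTo (hdU hv))

theorem of_tendstoLocallyUniformlyOn {ι : Type*} {p : Filter ι} [p.NeBot] (hU : IsOpen U)
    (hconn : IsPreconnected U) (hz₀ : z₀ ∈ U) {f : ι → ℂ → ℂ} {g : ℂ → ℂ}
    (hfg : TendstoLocallyUniformlyOn f g p U) (hf : ∀ n, IsNormalizedEmbedding U z₀ (f n))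
    (hgz₀ : deriv g z₀ ≠ 0) : IsNormalizedEmbedding U z₀ g := by
  have hfd : ∀ᶠ n in p, DifferentiableOn ℂ (f n) U := .of_forall fun n => (hf n).differentiableOn
  have hg : DifferentiableOn ℂ g U := hfg.differentiableOn hfd hU
  have hnc : ¬ ∃ c, EqOn g (fun _ => c) U := by
    rintro ⟨c, hc⟩
    rw [(hc.eventuallyEq_of_mem (hU.mem_nhds hz₀)).deriv_eq, deriv_const] at hgz₀
    exact hgz₀ rfl
  have hle : ∀ z ∈ U, ‖g z‖ ≤ 1 := fun z hz =>
    le_of_tendsto (hfg.tendsto_at hz).norm (.of_forall fun n =>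
      (mem_ball_zero_iff.1 ((hf n).mapsTo hz)).le)
  refine ⟨⟨?_, ?_⟩, fun z hz => ?_, ?_⟩
  · exact (eqOn_const_or_injOn_of_tendstoLocallyUniformlyOn hU hconn hfg hfd
      (.of_forall fun n => (hf n).injOn)).resolve_left hnc
  · exact (eqOn_zero_or_forall_ne_zero_of_tendstoLocallyUniformlyOn hU hconn (hfg.deriv hfd hU)
      (hfd.mono fun n hn => hn.deriv hU) (.of_forall fun n => (hf n).deriv_ne_zero)).resolve_left
      fun h => hgz₀ (h hz₀)
  · refine mem_ball_zero_iff.2 ((hle z hz).lt_of_ne fun h => hnc ⟨g z, ?_⟩)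
    exact Complex.eqOn_of_isPreconnected_of_isMaxOn_norm hconn hU hg hz
      fun w hw => by simpa [h] using hle w hw
  · exact tendsto_nhds_unique (hfg.tendsto_at hz₀)
      (tendsto_const_nhds.congr fun n => ((hf n).map_zero).symm)

theorem exists_forall_norm_deriv_le (hU : IsOpen U) (hconn : IsPreconnected U) (hz₀ : z₀ ∈ U)
    {f₀ : ℂ → ℂ} (hf₀ : IsNormalizedEmbedding U z₀ f₀) :
    ∃ g, IsNormalizedEmbedding U z₀ g ∧
      ∀ f, IsNormalizedEmbedding U z₀ f → ‖deriv f z₀‖ ≤ ‖deriv g z₀‖ := by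
  set D : Set ℝ := {x | ∃ f, IsNormalizedEmbedding U z₀ f ∧ x = ‖deriv f z₀‖}
  have hDb : BddAbove D := by
    obtain ⟨d, hd, hdU⟩ := Metric.isOpen_iff.1 hU z₀ hz₀
    refine ⟨1 / d, ?_⟩
    rintro _ ⟨f, hf, rfl⟩
    exact hf.norm_deriv_le hd hdU
  obtain ⟨u, -, hut, hu⟩ := exists_seq_tendsto_sSup (⟨_, f₀, hf₀, rfl⟩ : D.Nonempty) hDb
  choose f hf hfu using hu
  obtain ⟨g, hfg⟩ := exists_tendstoLocallyUniformlyOn_ultrafilter (hyperfilter ℕ) hU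
    (fun n => (hf n).differentiableOn) fun n z hz => (mem_ball_zero_iff.1 ((hf n).mapsTo hz)).le
  have hmax : ‖deriv g z₀‖ = sSup D := by
    have hlim := (hfg.deriv (.of_forall fun n => (hf n).differentiableOn) hU).tendsto_at hz₀
    exact tendsto_nhds_unique hlim.norm
      ((hut.mono_left Nat.hyperfilter_le_atTop).congr fun n => hfu n)
  have hle : ∀ f, IsNormalizedEmbedding U z₀ f → ‖deriv f z₀‖ ≤ ‖deriv g z₀‖ := fun f hf => by
    rw [hmax]
    exact le_csSup hDb ⟨f, hf, rfl⟩
  have hg0 : deriv g z₀ ≠ 0 :=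
    norm_pos_iff.1 ((norm_pos_iff.2 (hf₀.deriv_ne_zero z₀ hz₀)).trans_le (hle f₀ hf₀))
  exact ⟨g, of_tendstoLocallyUniformlyOn hU hconn hz₀ hfg hf hg0, hle⟩

/-- Koebe's square root trick: a square root of `discAut w ∘ g`, renormalized, has a larger
derivative. -/
theorem exists_norm_deriv_lt_of_notMem_image (hU : IsOpen U) (hsc : IsSimplyConnected U)
    (hz₀ : z₀ ∈ U) {g : ℂ → ℂ} (hg : IsNormalizedEmbedding U z₀ g) {w : ℂ} (hw : ‖w‖ < 1)
    (hwU : w ∉ g '' U) : ∃ f, IsNormalizedEmbedding U z₀ f ∧ ‖deriv g z₀‖ < ‖deriv f z₀‖ := by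
  have hq : IsConformalEmbedding (discAut w ∘ g) U :=
    (isConformalEmbedding_discAut hw).comp hg.toIsConformalEmbedding hg.mapsTo
  have hq1 : ∀ z ∈ U, ‖discAut w (g z)‖ < 1 := fun z hz =>
    norm_discAut_lt_one hw (mem_ball_zero_iff.1 (hg.mapsTo hz))
  have hq0 : ∀ z ∈ U, (discAut w ∘ g) z ≠ 0 := fun z hz => div_ne_zero
    (sub_ne_zero.2 fun h => hwU ⟨z, hz, h⟩)
    (one_sub_conj_mul_ne_zero hw (mem_ball_zero_iff.1 (hg.mapsTo hz)))
  obtain ⟨s, hs, hs2⟩ := exists_differentiableOn_sq_eq hU hsc hq.differentiableOn hq0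
  have hsU : IsConformalEmbedding s U := .of_sq_eq hU hq hs hs2
  have hs1 : MapsTo s U (ball 0 1) := fun z hz => by
    rw [mem_ball_zero_iff, ← pow_lt_one_iff_of_nonneg (norm_nonneg _) two_ne_zero, ← norm_pow,
      hs2 z hz]
    exact hq1 z hz
  have hsz₀ : ‖s z₀‖ < 1 := mem_ball_zero_iff.1 (hs1 hz₀)
  have hs0 : 0 < ‖s z₀‖ := norm_pos_iff.2 fun h => hq0 z₀ hz₀ (by rw [← hs2 z₀ hz₀, h]; simp)
  refine ⟨_, hsU.isNormalizedEmbedding_discAut_comp hs1 hz₀, ?_⟩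
  have hwb : ‖w‖ = ‖s z₀‖ ^ 2 := by
    rw [← norm_pow, hs2 z₀ hz₀, Function.comp_apply, hg.map_zero]
    simp [discAut]
  have hder : (1 - (‖s z₀‖ ^ 2) ^ 2) * ‖deriv g z₀‖ = 2 * ‖s z₀‖ * ‖deriv s z₀‖ := by
    have hsq : discAut w ∘ g =ᶠ[𝓝 z₀] fun z => s z ^ 2 := by
      filter_upwards [hU.mem_nhds hz₀] with z hz using (hs2 z hz).symm
    have hd := hsq.deriv_eq
    rw [deriv_comp _ (hasDerivAt_discAut hw (mem_ball_zero_iff.1 (hg.mapsTo hz₀))).differentiableAt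
      (hg.hasDerivAt hz₀).differentiableAt, ((hsU.hasDerivAt hz₀).fun_pow 2).deriv,
      hg.map_zero] at hd
    simpa [norm_deriv_discAut_zero hw, hwb] using congrArg norm hd
  rw [deriv_comp _ (hasDerivAt_discAut hsz₀ hsz₀).differentiableAt
    (hsU.hasDerivAt hz₀).differentiableAt, norm_mul, norm_deriv_discAut_self hsz₀]
  exact lt_inv_one_sub_sq_mul hs0 hsz₀ (norm_pos_iff.2 (hsU.deriv_ne_zero z₀ hz₀)) hder

end IsNormalizedEmbedding

theorem exists_isConformalEmbedding_image_eq_ball {U : Set ℂ} (hU : IsOpen U)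
    (hsc : IsSimplyConnected U) (hne : U ≠ univ) :
    ∃ g, IsConformalEmbedding g U ∧ g '' U = ball 0 1 := by
  obtain ⟨z₀, hz₀⟩ := hsc.nonempty
  obtain ⟨f₀, hf₀⟩ := exists_isNormalizedEmbedding hU hsc hne hz₀
  obtain ⟨g, hg, hmax⟩ := hf₀.exists_forall_norm_deriv_le hU
    hsc.isPathConnected.isConnected.isPreconnected hz₀
  refine ⟨g, hg.toIsConformalEmbedding, hg.mapsTo.image_subset.antisymm fun w hw => ?_⟩
  by_contra hwU
  obtain ⟨f, hf, hlt⟩ := hg.exists_norm_deriv_lt_of_notMem_image hU hsc hz₀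
    (mem_ball_zero_iff.1 hw) hwU
  exact (hmax f hf).not_gt hlt

/-! ### The Cauchy–Pompeiu formula -/

/-- The Wirtinger derivative `∂F/∂z̄`. -/
noncomputable def dbar (F : ℂ → ℂ) (z : ℂ) : ℂ :=
  (1 / 2) * (fderiv ℝ F z 1 + Complex.I * fderiv ℝ F z Complex.I)

theorem continuous_dbar {F : ℂ → ℂ} (hF : ContDiff ℝ 1 F) : Continuous (dbar F) := by
  have := hF.continuous_fderiv one_ne_zero
  unfold dbar
  fun_prop

theorem dbar_eq_zero_of_eventuallyEq {F g : ℂ → ℂ} {z : ℂ} (h : F =ᶠ[𝓝 z] g)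
    (hg : DifferentiableAt ℂ g z) : dbar F z = 0 := by
  have hreal : HasFDerivAt g ((fderiv ℂ g z).restrictScalars ℝ) z :=
    hg.hasFDerivAt.restrictScalars ℝ
  have hI : fderiv ℂ g z Complex.I = Complex.I * fderiv ℂ g z 1 := by
    rw [← smul_eq_mul, ← map_smul, smul_eq_mul, mul_one]
  rw [dbar, h.fderiv_eq, hreal.fderiv]
  simp only [ContinuousLinearMap.coe_restrictScalars', hI]
  rw [← mul_assoc, Complex.I_mul_I]
  ring

theorem dbar_eq_zero_of_notMem_tsupport {F : ℂ → ℂ} {z : ℂ} (h : z ∉ tsupport F) :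
    dbar F z = 0 :=
  dbar_eq_zero_of_eventuallyEq (notMem_tsupport_iff_eventuallyEq.1 h) (differentiableAt_const 0)

theorem map_add_I_mul_map_I_mul (L : ℂ →L[ℝ] ℂ) (v : ℂ) :
    L v + Complex.I * L (v * Complex.I) = (L 1 + Complex.I * L Complex.I) * starRingEnd ℂ v := by
  have hL : ∀ w : ℂ, L w = w.re * L 1 + w.im * L Complex.I := fun w => by
    conv_lhs => rw [← Complex.re_add_im w]
    rw [map_add, ← Complex.real_smul, ← Complex.real_smul, ← Complex.real_smul, map_smul,
      ← mul_one (w.re : ℂ), ← Complex.real_smul, map_smul, Complex.real_smul, Complex.real_smul]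
  have hconj : starRingEnd ℂ v = v.re - v.im * Complex.I := by
    apply Complex.ext <;> simp
  rw [hL v, hL (v * Complex.I), Complex.mul_I_re, Complex.mul_I_im, Complex.ofReal_neg, hconj]
  linear_combination (v.im * L Complex.I) * Complex.I_sq

/-- The derivative of `F` at the point with polar coordinates `p` about `z`, in the direction `v`
rotated by the polar angle: `v = 1` is the radial direction, `v = I` the angular one. -/
noncomputable def polarFDeriv (F : ℂ → ℂ) (z v : ℂ) (p : ℝ × ℝ) : ℂ :=
  fderiv ℝ F (circleMap z p.1 p.2) (circleMap 0 1 p.2 * v)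

section CauchyPompeiu

variable {F : ℂ → ℂ}

theorem continuous_polarFDeriv (hF : ContDiff ℝ 1 F) (z v : ℂ) :
    Continuous (polarFDeriv F z v) := by
  have hcircle : Continuous fun p : ℝ × ℝ => circleMap z p.1 p.2 := by
    unfold circleMap
    fun_prop
  exact ((hF.continuous_fderiv one_ne_zero).comp hcircle).clm_apply (by fun_prop)

theorem integral_polarFDeriv_one (hF : ContDiff ℝ 1 F) (z : ℂ) (R θ : ℝ) :
    ∫ r in (0)..R, polarFDeriv F z 1 (r, θ) = F (circleMap z R θ) - F z := by
  rw [intervalIntegral.integral_eq_sub_of_hasDerivAt (f := fun r : ℝ => F (circleMap z r θ)),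
    circleMap_zero_radius]
  · rfl
  · intro r _
    have hline : HasDerivAt (fun r : ℝ => circleMap z r θ) (circleMap 0 1 θ * 1) r := by
      simpa [circleMap] using
        ((Complex.ofRealCLM.hasDerivAt (x := r)).mul_const
          (Complex.exp (θ * Complex.I))).const_add z
    exact (hF.differentiable one_ne_zero _).hasFDerivAt.comp_hasDerivAt r hline
  · have hcont := (continuous_polarFDeriv hF z 1).comp (Continuous.prodMk_left θ)
    exact hcont.intervalIntegrable _ _

theorem integral_polarFDeriv_I (hF : ContDiff ℝ 1 F) (z : ℂ) {r : ℝ} (hr : r ≠ 0) :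
    ∫ θ in (-Real.pi)..Real.pi, polarFDeriv F z Complex.I (r, θ) = 0 := by
  suffices h : ∫ θ in (-Real.pi)..Real.pi, r • polarFDeriv F z Complex.I (r, θ) = 0 by
    rw [intervalIntegral.integral_smul] at h
    exact (smul_eq_zero.1 h).resolve_left hr
  rw [intervalIntegral.integral_eq_sub_of_hasDerivAt (f := fun θ : ℝ => F (circleMap z r θ))]
  · simp [circleMap]
  · intro θ _
    have hcircle : HasDerivAt (circleMap z r) (r • (circleMap 0 1 θ * Complex.I)) θ :=
      (hasDerivAt_circleMap z r θ).congr_deriv (by simp [circleMap, mul_assoc])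
    refine ((hF.differentiable one_ne_zero _).hasFDerivAt.comp_hasDerivAt θ hcircle).congr_deriv ?_
    rw [map_smul, polarFDeriv]
  · have hcont := (continuous_polarFDeriv hF z Complex.I).comp (Continuous.prodMk_right r)
    exact (hcont.const_smul r).intervalIntegrable _ _

theorem smul_dbar_div_eq_polarFDeriv (F : ℂ → ℂ) (z : ℂ) {p : ℝ × ℝ} (hp : p.1 ≠ 0) :
    p.1 • (dbar F (z + Complex.polarCoord.symm p) / (z - (z + Complex.polarCoord.symm p))) =
      -(1 / 2) * (polarFDeriv F z 1 p + Complex.I * polarFDeriv F z Complex.I p) := by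
  set u := circleMap 0 1 p.2
  have hu : ‖u‖ = 1 := by simp [u]
  have hpolar : Complex.polarCoord.symm p = p.1 * u := by
    simp [u, Complex.polarCoord_symm_apply, circleMap, Complex.exp_mul_I]
  have hcircle : circleMap z p.1 p.2 = z + p.1 * u := by simp [u, circleMap]
  have hconj : u⁻¹ = starRingEnd ℂ u := Complex.inv_eq_conj hu
  have hp' : (p.1 : ℂ) ≠ 0 := by exact_mod_cast hp
  rw [polarFDeriv, polarFDeriv, mul_one, map_add_I_mul_map_I_mul, ← hconj, hpolar, hcircle, dbar,
    sub_add_cancel_left, Complex.real_smul]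
  have hu0 : u ≠ 0 := norm_pos_iff.1 (hu ▸ one_pos)
  field_simp

/-- The part of the polar coordinate domain that contains the support of functions supported in
the disc of radius `R`. -/
def polarRectangle (R : ℝ) : Set (ℝ × ℝ) := Ioc 0 R ×ˢ Ioo (-Real.pi) Real.pi

theorem integrableOn_polarRectangle {D : ℝ × ℝ → ℂ} (hD : Continuous D) (R : ℝ) :
    IntegrableOn D (polarRectangle R) :=
  (hD.continuousOn.integrableOn_compact (isCompact_Icc.prod isCompact_Icc)).mono_set
    (prod_mono Ioc_subset_Icc_self Ioo_subset_Icc_self)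

theorem setIntegral_polarFDeriv_one (hF : ContDiff ℝ 1 F) {z : ℂ} {R : ℝ} (hR : 0 ≤ R)
    (hFR : ∀ w, R ≤ dist w z → w ∉ tsupport F) :
    ∫ p in polarRectangle R, polarFDeriv F z 1 p = -(2 * Real.pi * F z) := by
  have hFint := integrableOn_polarRectangle (continuous_polarFDeriv hF z 1) R
  rw [polarRectangle, Measure.volume_eq_prod] at hFint ⊢
  rw [← setIntegral_prod_swap, setIntegral_prod _
    (show IntegrableOn (fun p : ℝ × ℝ => polarFDeriv F z 1 p.swap) _ _ from hFint.swap)]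
  have hradial : ∀ θ : ℝ, ∫ r in Ioc 0 R, polarFDeriv F z 1 (r, θ) = -F z := fun θ => by
    rw [← intervalIntegral.integral_of_le hR, integral_polarFDeriv_one hF,
      image_eq_zero_of_notMem_tsupport (hFR _ _), zero_sub]
    simp [dist_eq_norm, circleMap, le_abs_self]
  simp only [Prod.swap_prod_mk, hradial]
  rw [setIntegral_const, measureReal_def, Real.volume_Ioo,
    ENNReal.toReal_ofReal (by linarith [Real.pi_pos]), Complex.real_smul]
  push_cast
  ring

theorem setIntegral_polarFDeriv_I (hF : ContDiff ℝ 1 F) (z : ℂ) (R : ℝ) :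
    ∫ p in polarRectangle R, polarFDeriv F z Complex.I p = 0 := by
  have hFint := integrableOn_polarRectangle (continuous_polarFDeriv hF z Complex.I) R
  rw [polarRectangle, Measure.volume_eq_prod] at hFint ⊢
  rw [setIntegral_prod _ hFint]
  refine setIntegral_eq_zero_of_forall_eq_zero fun r hr => ?_
  rw [← integral_Ioc_eq_integral_Ioo, ← intervalIntegral.integral_of_le (by linarith [Real.pi_pos]),
    integral_polarFDeriv_I hF z hr.1.ne']

theorem integral_dbar_div (hF : ContDiff ℝ 1 F) (hc : HasCompactSupport F) (z : ℂ) :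
    ∫ ζ, dbar F ζ / (z - ζ) = Real.pi * F z := by
  obtain ⟨R, hR0, hR⟩ : ∃ R : ℝ, 0 ≤ R ∧ ∀ w, R ≤ dist w z → w ∉ tsupport F := by
    obtain ⟨R, hR⟩ := (Metric.isBounded_iff_subset_closedBall z).1 hc.isCompact.isBounded
    refine ⟨max R 0 + 1, by positivity, fun w hw hwt => ?_⟩
    linarith [le_max_left R 0, mem_closedBall.1 (hR hwt)]
  rw [← integral_add_left_eq_self _ z, ← Complex.integral_comp_polarCoord_symm,
    setIntegral_congr_fun polarCoord.open_target.measurableSet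
      fun p hp => smul_dbar_div_eq_polarFDeriv F z (ne_of_gt hp.1),
    setIntegral_eq_of_subset_of_forall_sdiff_eq_zero (s := polarRectangle R)
      polarCoord.open_target.measurableSet (prod_mono (fun r hr => hr.1) subset_rfl)]
  · have hFint := fun v => integrableOn_polarRectangle (continuous_polarFDeriv hF z v) R
    rw [integral_const_mul, integral_add (hFint 1) ((hFint Complex.I).const_mul _),
      integral_const_mul, setIntegral_polarFDeriv_one hF hR0 hR, setIntegral_polarFDeriv_I hF]
    ring
  · intro p hp
    have hRp : R ≤ p.1 := by
      by_contra hlt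
      exact hp.2 ⟨⟨hp.1.1, (not_le.1 hlt).le⟩, hp.1.2⟩
    have hnt : circleMap z p.1 p.2 ∉ tsupport F :=
      hR _ (by simpa [dist_eq_norm, circleMap] using hRp.trans (le_abs_self _))
    simp [polarFDeriv, (notMem_tsupport_iff_eventuallyEq.1 hnt).fderiv_eq]

end CauchyPompeiu

/-! ### Polynomial approximation -/

theorem setLIntegral_ball_enorm_inv_sub_le (z : ℂ) {s : ℝ} (hs : 0 ≤ s) :
    ∫⁻ ζ in ball z s, ‖(z - ζ)⁻¹‖ₑ ≤ ENNReal.ofReal (2 * Real.pi * s) := by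
  have hcenter : ∫⁻ ζ in ball z s, ‖(z - ζ)⁻¹‖ₑ =
      ∫⁻ ζ, (ball (0 : ℂ) s).indicator (fun ζ => ‖ζ⁻¹‖ₑ) ζ := by
    rw [← lintegral_indicator measurableSet_ball,
      ← lintegral_add_left_eq_self (μ := (volume : Measure ℂ)) _ z]
    congr 1 with ζ
    simp [indicator, mem_ball, dist_eq_norm, inv_neg]
  have hpolar : ∀ p ∈ polarCoord.target, ENNReal.ofReal p.1 •
      (ball (0 : ℂ) s).indicator (fun ζ => ‖ζ⁻¹‖ₑ) (Complex.polarCoord.symm p) ≤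
        (Ioo 0 s ×ˢ Ioo (-Real.pi) Real.pi).indicator 1 p := by
    intro p hp
    have hp1 : 0 < p.1 := hp.1
    have hnorm : ‖Complex.polarCoord.symm p‖ = p.1 := by
      rw [Complex.norm_polarCoord_symm, abs_of_pos hp1]
    by_cases hps : p.1 < s
    · rw [indicator_of_mem (show p ∈ Ioo 0 s ×ˢ Ioo (-Real.pi) Real.pi from ⟨⟨hp1, hps⟩, hp.2⟩),
        indicator_of_mem (mem_ball_zero_iff.2 (hnorm.trans_lt hps)), ← ofReal_norm, norm_inv, hnorm,
        smul_eq_mul, ← ENNReal.ofReal_mul hp1.le, mul_inv_cancel₀ hp1.ne']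
      simp
    · rw [indicator_of_notMem (by rwa [mem_ball_zero_iff, hnorm])]
      simp
  rw [hcenter, ← Complex.lintegral_comp_polarCoord_symm]
  calc _ ≤ ∫⁻ p in polarCoord.target, (Ioo 0 s ×ˢ Ioo (-Real.pi) Real.pi).indicator 1 p :=
        setLIntegral_mono' polarCoord.open_target.measurableSet hpolar
    _ ≤ ∫⁻ p, (Ioo 0 s ×ˢ Ioo (-Real.pi) Real.pi).indicator 1 p := setLIntegral_le_lintegral _ _
    _ = volume (Ioo 0 s ×ˢ Ioo (-Real.pi) Real.pi) :=
        lintegral_indicator_one (measurableSet_Ioo.prod measurableSet_Ioo)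
    _ = ENNReal.ofReal (2 * Real.pi * s) := by
        rw [Measure.volume_eq_prod, Measure.prod_prod, Real.volume_Ioo, Real.volume_Ioo, sub_zero,
          ← ENNReal.ofReal_mul hs]
        ring_nf

theorem setLIntegral_enorm_inv_sub_le (z : ℂ) {s : ℝ} (hs : 0 < s) (N : Set ℂ) :
    ∫⁻ ζ in N, ‖(z - ζ)⁻¹‖ₑ ≤
      ENNReal.ofReal (2 * Real.pi * s) + ENNReal.ofReal s⁻¹ * volume N := by
  calc ∫⁻ ζ in N, ‖(z - ζ)⁻¹‖ₑ
      ≤ ∫⁻ ζ in N, ((ball z s).indicator (fun ζ => ‖(z - ζ)⁻¹‖ₑ) ζ + ENNReal.ofReal s⁻¹) := by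
        refine lintegral_mono fun ζ => ?_
        by_cases hζ : ζ ∈ ball z s
        · rw [indicator_of_mem hζ]
          exact le_self_add
        · rw [indicator_of_notMem hζ, zero_add, ← ofReal_norm, norm_inv]
          refine ENNReal.ofReal_le_ofReal (inv_anti₀ hs ?_)
          rwa [mem_ball, dist_comm, dist_eq_norm, not_lt] at hζ
    _ = (∫⁻ ζ in N, (ball z s).indicator (fun ζ => ‖(z - ζ)⁻¹‖ₑ) ζ) +
          ENNReal.ofReal s⁻¹ * volume N := by
        rw [lintegral_add_right _ measurable_const, setLIntegral_const]
    _ ≤ _ := by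
        gcongr
        refine (setLIntegral_le_lintegral _ _).trans ?_
        rw [lintegral_indicator measurableSet_ball]
        exact setLIntegral_ball_enorm_inv_sub_le z hs.le

theorem setLIntegral_enorm_div_sub_le {G : ℂ → ℂ} {M : ℝ} (hM : ∀ ζ, ‖G ζ‖ ≤ M) (z : ℂ)
    (N : Set ℂ) :
    ∫⁻ ζ in N, ‖G ζ / (z - ζ)‖ₑ ≤ ENNReal.ofReal M * ∫⁻ ζ in N, ‖(z - ζ)⁻¹‖ₑ := by
  rw [← lintegral_const_mul' _ _ ENNReal.ofReal_ne_top]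
  refine lintegral_mono fun ζ => ?_
  rw [div_eq_mul_inv, enorm_mul, ← ofReal_norm (G ζ)]
  gcongr
  exact hM ζ

theorem exists_pos_forall_norm_setIntegral_div_sub_le {G : ℂ → ℂ} {M : ℝ} (hM : ∀ ζ, ‖G ζ‖ ≤ M)
    {ε : ℝ} (hε : 0 < ε) : ∃ η > 0, ∀ (z : ℂ) (N : Set ℂ), volume N ≤ ENNReal.ofReal η →
      ‖∫ ζ in N, G ζ / (z - ζ)‖ ≤ ε := by
  have hM0 : 0 ≤ M := (norm_nonneg _).trans (hM 0)
  obtain ⟨s, hs, hsε⟩ : ∃ s > 0, M * (2 * Real.pi * s) ≤ ε / 2 :=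
    ⟨ε / 2 / (M * (2 * Real.pi) + 1), by positivity, by
      rw [← mul_assoc, mul_div_assoc', div_le_iff₀ (by positivity)]
      nlinarith⟩
  obtain ⟨η, hη, hηε⟩ : ∃ η > 0, M * (s⁻¹ * η) ≤ ε / 2 :=
    ⟨ε / 2 / (M * s⁻¹ + 1), by positivity, by
      rw [← mul_assoc, mul_div_assoc', div_le_iff₀ (by positivity)]
      nlinarith⟩
  refine ⟨η, hη, fun z N hN => ?_⟩
  rw [← ENNReal.ofReal_le_ofReal_iff hε.le, ofReal_norm]
  calc ‖∫ ζ in N, G ζ / (z - ζ)‖ₑ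
      ≤ ∫⁻ ζ in N, ‖G ζ / (z - ζ)‖ₑ := enorm_integral_le_lintegral_enorm _
    _ ≤ ENNReal.ofReal M * ∫⁻ ζ in N, ‖(z - ζ)⁻¹‖ₑ := setLIntegral_enorm_div_sub_le hM z N
    _ ≤ ENNReal.ofReal M * (ENNReal.ofReal (2 * Real.pi * s) + ENNReal.ofReal s⁻¹ *
          ENNReal.ofReal η) := by
        gcongr
        exact (setLIntegral_enorm_inv_sub_le z hs N).trans (by gcongr)
    _ = ENNReal.ofReal (M * (2 * Real.pi * s) + M * (s⁻¹ * η)) := by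
        rw [← ENNReal.ofReal_mul (by positivity), ← ENNReal.ofReal_add (by positivity)
          (by positivity), ← ENNReal.ofReal_mul hM0, mul_add]
    _ ≤ ENNReal.ofReal ε := ENNReal.ofReal_le_ofReal (by linarith)

theorem integrable_div_sub {G : ℂ → ℂ} (hG : Continuous G) (hc : HasCompactSupport G) (z : ℂ) :
    Integrable fun ζ => G ζ / (z - ζ) := by
  obtain ⟨M, hM⟩ := hc.exists_bound_of_continuous hG
  have hmeas : Measurable fun ζ => G ζ / (z - ζ) :=
    hG.measurable.div (measurable_const.sub measurable_id)
  have hGk : IntegrableOn (fun ζ => G ζ / (z - ζ)) (tsupport G) := by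
    refine ⟨hmeas.aestronglyMeasurable.restrict, (setLIntegral_enorm_div_sub_le hM z _).trans_lt ?_⟩
    refine ENNReal.mul_lt_top ENNReal.ofReal_lt_top
      ((setLIntegral_enorm_inv_sub_le z one_pos _).trans_lt ?_)
    exact ENNReal.add_lt_top.2 ⟨ENNReal.ofReal_lt_top,
      ENNReal.mul_lt_top ENNReal.ofReal_lt_top hc.isCompact.measure_lt_top⟩
  refine (integrableOn_iff_integrable_of_support_subset fun ζ hζ => ?_).1 hGk
  exact subset_tsupport G fun h => hζ (by simp [h])

section Runge

variable {C : Set ℂ}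

/-- In the closed algebra generated by the coordinate function, the spectrum of that function is
obtained from `C` by filling bounded components of the complement. -/
theorem exists_mem_topologicalClosure_polynomialFunctions [CompactSpace C]
    {a : ℂ} (hunb : ¬ Bornology.IsBounded (connectedComponentIn Cᶜ a)) :
    ∃ r ∈ (polynomialFunctions C).topologicalClosure, ∀ z : C, r z = ((z : ℂ) - a)⁻¹ := by
  set S := (polynomialFunctions C).topologicalClosure
  have : IsClosed (S : Set C(C, ℂ)) := Subalgebra.isClosed_topologicalClosure _
  let x : S := ⟨toContinuousMapOn X C, Subalgebra.le_topologicalClosure _ ⟨X, trivial, rfl⟩⟩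
  have hspec : spectrum ℂ (x : C(C, ℂ)) = C := by
    rw [ContinuousMap.spectrum_eq_range]
    ext w
    simp [x]
  have hxa : a ∉ spectrum ℂ x := fun h => hunb (by
    simpa only [hspec] using Subalgebra.spectrum_isBounded_connectedComponentIn S x h)
  obtain ⟨v, hv⟩ := (spectrum.notMem_iff.1 hxa).exists_right_inv
  refine ⟨-(v : C(C, ℂ)), neg_mem v.2, fun z => eq_inv_of_mul_eq_one_left ?_⟩
  have hvz : (a - z) * (v : C(C, ℂ)) z = 1 := by
    simpa [x] using congrArg (fun y : S => (y : C(C, ℂ)) z) hv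
  rw [← hvz, ContinuousMap.neg_apply]
  ring

theorem exists_polynomial_norm_eval_sub_setIntegral_lt (hC : IsCompact C)
    (hunb : ∀ a ∉ C, ¬ Bornology.IsBounded (connectedComponentIn Cᶜ a)) {K : Set ℂ}
    (hK : IsCompact K) (hKC : Disjoint K C) {G : ℂ → ℂ} (hG : ContinuousOn G K) {ε : ℝ}
    (hε : 0 < ε) :
    ∃ p : Polynomial ℂ, ∀ z ∈ C, ‖p.eval z - ∫ ζ in K, G ζ / (z - ζ)‖ < ε := by
  have : CompactSpace C := isCompact_iff_compactSpace.1 hC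
  set S := (polynomialFunctions C).topologicalClosure
  have : CompleteSpace S := (Subalgebra.isClosed_topologicalClosure _).completeSpace_coe
  have hex : ∀ ζ, ∃ r : S, ζ ∈ K → ∀ z : C, (r : C(C, ℂ)) z = ((z : ℂ) - ζ)⁻¹ := fun ζ => by
    by_cases h : ζ ∈ K
    · have hζC := disjoint_left.1 hKC h
      obtain ⟨r, hrS, hr⟩ := exists_mem_topologicalClosure_polynomialFunctions (hunb ζ hζC)
      exact ⟨⟨r, hrS⟩, fun _ => hr⟩
    · exact ⟨0, fun h' => absurd h' h⟩
  choose r hr using hex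
  have hrc : ContinuousOn r K := by
    rw [continuousOn_iff_continuous_domRestrict, Topology.IsInducing.subtypeVal.continuous_iff]
    refine ContinuousMap.continuous_of_continuous_uncurry _ ?_
    have hcont : Continuous fun q : K × C => ((q.2 : ℂ) - (q.1 : ℂ))⁻¹ :=
      (by fun_prop : Continuous fun q : K × C => ((q.2 : ℂ) - (q.1 : ℂ))).inv₀ fun q =>
        sub_ne_zero.2 (hKC.ne_of_mem q.1.2 q.2.2).symm
    refine hcont.congr fun q => ?_
    simp [Function.uncurry, Set.domRestrict, hr q.1 q.1.2 q.2]
  set v : S := ∫ ζ in K, G ζ • r ζ with hv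
  have hvz : ∀ z : C, (v : C(C, ℂ)) z = ∫ ζ in K, G ζ / ((z : ℂ) - ζ) := fun z => by
    let L : S →L[ℂ] ℂ := (ContinuousMap.evalCLM ℂ z).comp (Subalgebra.toSubmodule S).subtypeL
    have hLv : L v = (v : C(C, ℂ)) z := rfl
    have hGr : IntegrableOn (fun ζ => G ζ • r ζ) K := (hG.smul hrc).integrableOn_compact hK
    rw [← hLv, hv, ← ContinuousLinearMap.integral_comp_comm L hGr]
    refine setIntegral_congr_fun hK.measurableSet fun ζ hζ => ?_
    have hLζ : L (G ζ • r ζ) = G ζ * (r ζ : C(C, ℂ)) z := by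
      rw [map_smul]
      rfl
    simp only [hLζ, hr ζ hζ z, div_eq_mul_inv]
  have hvS : (v : C(C, ℂ)) ∈ closure ((polynomialFunctions C : Subalgebra ℂ C(C, ℂ)) :
    Set C(C, ℂ)) := v.2
  obtain ⟨_, ⟨p, -, rfl⟩, hp⟩ := Metric.mem_closure_iff.1 hvS ε hε
  refine ⟨p, fun z hz => ?_⟩
  rw [← hvz ⟨z, hz⟩, ← dist_eq_norm, dist_comm]
  exact (ContinuousMap.dist_apply_le_dist ⟨z, hz⟩).trans_lt hp

/-- The Cauchy–Pompeiu integral over a small neighbourhood of `C` is negligible; the remaining part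
is a superposition of functions `z ↦ (z - ζ)⁻¹` with `ζ` off `C`. -/
theorem exists_polynomial_norm_eval_sub_lt (hC : IsCompact C)
    (hunb : ∀ a ∉ C, ¬ Bornology.IsBounded (connectedComponentIn Cᶜ a)) {F : ℂ → ℂ}
    (hF : ContDiff ℝ 1 F) (hc : HasCompactSupport F)
    (hnull : volume {z ∈ C | dbar F z ≠ 0} = 0) {ε : ℝ} (hε : 0 < ε) :
    ∃ p : Polynomial ℂ, ∀ z ∈ C, ‖p.eval z - F z‖ < ε := by
  set G : ℂ → ℂ := fun ζ => (Real.pi : ℂ)⁻¹ * dbar F ζ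
  have hG : Continuous G := continuous_const.mul (continuous_dbar hF)
  have hG0 : ∀ ζ ∉ tsupport F, G ζ = 0 := fun ζ hζ => by
    simp only [G, dbar_eq_zero_of_notMem_tsupport hζ, mul_zero]
  have hGc : HasCompactSupport G := hc.mono' fun ζ hζ => by_contra fun h => hζ (hG0 ζ h)
  obtain ⟨M, hM⟩ := hGc.exists_bound_of_continuous hG
  obtain ⟨η, hη, hηε⟩ := exists_pos_forall_norm_setIntegral_div_sub_le hM (half_pos hε)
  obtain ⟨E, hCE, hEo, hE⟩ := hC.exists_isOpen_lt_add (μ := volume) (ENNReal.ofReal_pos.2 hη).ne'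
  have hEC : volume (E \ C) ≤ ENNReal.ofReal η := by
    rw [measure_sdiff hCE hC.measurableSet.nullMeasurableSet hC.measure_ne_top]
    exact tsub_le_iff_left.2 hE.le
  set K := tsupport F \ E
  have hK : IsCompact K := hc.isCompact.diff hEo
  obtain ⟨p, hp⟩ := exists_polynomial_norm_eval_sub_setIntegral_lt hC hunb hK
    (disjoint_left.2 fun ζ hζ h => hζ.2 (hCE h)) hG.continuousOn (half_pos hε)
  refine ⟨p, fun z hz => ?_⟩
  have hrest : ∫ ζ in Kᶜ, G ζ / (z - ζ) = ∫ ζ in E \ C, G ζ / (z - ζ) := by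
    refine setIntegral_eq_of_subset_of_ae_sdiff_eq_zero hK.measurableSet.compl.nullMeasurableSet
      (fun ζ hζ h => h.2 hζ.1) ?_
    filter_upwards [measure_eq_zero_iff_ae_notMem.1 hnull] with ζ hζ ⟨hζK, hζE⟩
    suffices hGζ : G ζ = 0 by rw [hGζ, zero_div]
    by_cases hζC : ζ ∈ C
    · simp only [G, not_not.1 fun h => hζ ⟨hζC, h⟩, mul_zero]
    · exact hG0 ζ fun ht => hζK ⟨ht, fun hE => hζE ⟨hE, hζC⟩⟩
  have hpompeiu : F z = (∫ ζ in K, G ζ / (z - ζ)) + ∫ ζ in E \ C, G ζ / (z - ζ) := by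
    rw [← hrest, integral_add_compl hK.measurableSet (integrable_div_sub hG hGc z)]
    simp only [G, mul_div_assoc]
    rw [integral_const_mul, integral_dbar_div hF hc, inv_mul_cancel_left₀]
    exact_mod_cast Real.pi_ne_zero
  rw [hpompeiu, ← sub_sub]
  linarith [norm_sub_le (p.eval z - ∫ ζ in K, G ζ / (z - ζ)) (∫ ζ in E \ C, G ζ / (z - ζ)), hp z hz,
    hηε z _ hEC]

end Runge

/-! ### Continuous logarithms and unbounded complements -/

theorem isSimplyConnected_of_convex {E : Type*} [AddCommGroup E] [Module ℝ E]
    [TopologicalSpace E] [ContinuousAdd E] [ContinuousSMul ℝ E] {s : Set E} (hs : Convex ℝ s)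
    (hne : s.Nonempty) : IsSimplyConnected s := by
  have := hs.contractibleSpace hne
  exact SimplyConnectedSpace.ofContractible s

theorem exists_continuous_exp_eq {X : Type*} [TopologicalSpace X] [SimplyConnectedSpace X]
    [LocallyPathConnectedSpace X] {g : X → ℂ} (hg : Continuous g) (hg0 : ∀ x, g x ≠ 0) :
    ∃ L : X → ℂ, Continuous L ∧ ∀ x, Complex.exp (L x) = g x := by
  obtain ⟨x₀⟩ := (inferInstance : Nonempty X)
  obtain ⟨L, ⟨-, hL⟩, -⟩ := Complex.isCoveringMapOn_exp.existsUnique_continuousMap_lifts ⟨g, hg⟩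
    (Complex.exp_log (hg0 x₀)) hg0
  exact ⟨L, L.continuous, congrFun hL⟩

theorem disjoint_frontier_connectedComponentIn {X : Type*} [TopologicalSpace X]
    [LocallyConnectedSpace X] {U : Set X} (hU : IsOpen U) (a : X) :
    Disjoint (frontier (connectedComponentIn U a)) U := by
  refine disjoint_left.2 fun z hz hzU => ?_
  obtain ⟨w, hwz, hwa⟩ := mem_closure_iff.1 (frontier_subset_closure hz) _
    hU.connectedComponentIn (mem_connectedComponentIn hzU)
  rw [hU.connectedComponentIn.frontier_eq, connectedComponentIn_eq hwa,
    ← connectedComponentIn_eq hwz] at hz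
  exact hz.2 (mem_connectedComponentIn hzU)

theorem not_forall_exp_eq_sub_of_continuous {L : ℂ → ℂ} (hL : Continuous L) {a : ℂ} {R : ℝ}
    (hR : 0 < R) : ¬ ∀ z, ‖z - a‖ = R → Complex.exp (L z) = z - a := by
  intro hexp
  have hR0 : (R : ℂ) ≠ 0 := by exact_mod_cast hR.ne'
  have hturns : ∀ θ : ℝ, ∃ n : ℤ,
      L (circleMap a R θ) - θ * Complex.I - Real.log R = n * (2 * Real.pi * Complex.I) := by
    intro θ
    rw [← Complex.exp_eq_one_iff, Complex.exp_sub, Complex.exp_sub,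
      hexp _ (by simp [abs_of_pos hR]), ← Complex.ofReal_exp, Real.exp_log hR, circleMap_sub_center,
      circleMap_zero, mul_div_cancel_right₀ _ (Complex.exp_ne_zero _), div_self hR0]
  choose n hn using hturns
  have hcont : Continuous n := by
    rw [Int.isClosedEmbedding_coe_real.isInducing.continuous_iff]
    have := continuous_circleMap a R
    have hre : Continuous fun θ : ℝ => ((L (circleMap a R θ) - θ * Complex.I - Real.log R) /
        (2 * Real.pi * Complex.I)).re := Complex.continuous_re.comp (by fun_prop)
    refine hre.congr fun θ => ?_
    rw [hn, mul_div_cancel_right₀ _ Complex.two_pi_I_ne_zero, Complex.intCast_re,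
      Function.comp_apply]
  have hend := hn (0 + 2 * Real.pi)
  rw [periodic_circleMap, PreconnectedSpace.constant inferInstance hcont (y := 0), ← hn] at hend
  push_cast at hend
  exact Complex.two_pi_I_ne_zero (by linear_combination -hend)

/-- The function `z ↦ z - a` has a continuous logarithm on `C`. For compact `C` this says that `C`
does not separate `a` from `∞` (Borsuk's criterion). -/
def HasLogOn (C : Set ℂ) (a : ℂ) : Prop :=
  ∃ l : ℂ → ℂ, ContinuousOn l C ∧ ∀ z ∈ C, Complex.exp (l z) = z - a

namespace HasLogOn

variable {C : Set ℂ} {a : ℂ}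

theorem exists_continuous_ne_zero_eqOn_compl (hC : IsClosed C) (h : HasLogOn C a) {V : Set ℂ}
    (haV : a ∈ V) (hV : frontier V ⊆ C) :
    ∃ g : ℂ → ℂ, Continuous g ∧ (∀ z, g z ≠ 0) ∧ ∀ z ∉ closure V, g z = z - a := by
  classical
  obtain ⟨l, hlc, hl⟩ := h
  obtain ⟨m, hm⟩ := ContinuousMap.exists_restrict_eq (Y := ℂ) hC
    ⟨C.domRestrict l, continuousOn_iff_continuous_domRestrict.1 hlc⟩
  have hml : ∀ z ∈ C, m z = l z := fun z hz => DFunLike.congr_fun hm ⟨z, hz⟩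
  refine ⟨fun z => if z ∈ closure V then Complex.exp (m z) else z - a,
    Continuous.if (fun z hz => ?_) (by fun_prop) (by fun_prop), fun z => ?_, fun z hz => if_neg hz⟩
  · have hzC : z ∈ C := hV (frontier_closure_subset hz)
    rw [hml z hzC, hl z hzC]
  · dsimp only
    split_ifs with hz
    · exact Complex.exp_ne_zero _
    · exact sub_ne_zero.2 fun hza => hz (subset_closure (hza ▸ haV))

/-- If the component were bounded, then its logarithm on `C` would extend inwards to a nonvanishing
function on `ℂ` that agrees with `z - a` near `∞`, and this function would have a logarithm. -/
theorem not_isBounded_connectedComponentIn (hC : IsClosed C) (ha : a ∉ C) (h : HasLogOn C a) :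
    ¬ Bornology.IsBounded (connectedComponentIn Cᶜ a) := by
  intro hb
  set V := connectedComponentIn Cᶜ a
  have hfrontier : frontier V ⊆ C :=
    disjoint_compl_right_iff_subset.1 (disjoint_frontier_connectedComponentIn hC.isOpen_compl a)
  obtain ⟨g, hg, hg0, hgV⟩ := h.exists_continuous_ne_zero_eqOn_compl hC
    (mem_connectedComponentIn ha) hfrontier
  obtain ⟨L, hL, hexp⟩ := exists_continuous_exp_eq hg hg0
  obtain ⟨R, hR⟩ := hb.closure.subset_ball a
  refine not_forall_exp_eq_sub_of_continuous hL (a := a) (R := max R 1) (by positivity)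
    fun z hz => ?_
  refine (hexp z).trans (hgV z fun hzV => ?_)
  have hzR := hR hzV
  rw [mem_ball, dist_eq_norm, hz] at hzR
  exact (le_max_left R 1).not_gt hzR

/-- A radial retraction onto the closed ball produces a logarithm of `θ - a` there; it is carried
over to the image by Tietze's theorem. -/
theorem image_closedBall {θ : ℂ → ℂ} {ρ : ℝ} (hρ : 0 < ρ) (hθ : ContinuousOn θ (closedBall 0 ρ))
    (hinj : InjOn θ (closedBall 0 ρ)) (ha : a ∉ θ '' closedBall 0 ρ) :
    HasLogOn (θ '' closedBall 0 ρ) a := by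
  set r : ℂ → ℂ := fun w => (ρ / max ρ ‖w‖ : ℝ) • w with hr
  have hpos : ∀ w : ℂ, 0 < max ρ ‖w‖ := fun w => lt_max_of_lt_left hρ
  have hrc : Continuous r :=
    (continuous_const.div (by fun_prop) fun w => (hpos w).ne').smul continuous_id
  have hrm : ∀ w, r w ∈ closedBall (0 : ℂ) ρ := fun w => by
    rw [mem_closedBall_zero_iff, hr, norm_smul, Real.norm_of_nonneg (by positivity),
      div_mul_eq_mul_div, div_le_iff₀ (hpos w)]
    exact mul_le_mul_of_nonneg_left (le_max_right _ _) hρ.le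
  have hrid : ∀ w ∈ closedBall (0 : ℂ) ρ, r w = w := fun w hw => by
    rw [mem_closedBall_zero_iff] at hw
    simp only [hr, max_eq_left hw, div_self hρ.ne', one_smul]
  obtain ⟨l, hlc, hl⟩ := exists_continuous_exp_eq (g := fun w => θ (r w) - a)
    ((hθ.comp_continuous hrc hrm).sub continuous_const) fun w =>
      sub_ne_zero.2 fun h => ha ⟨r w, hrm w, h⟩
  have : CompactSpace (closedBall (0 : ℂ) ρ) :=
    isCompact_iff_compactSpace.1 (isCompact_closedBall 0 ρ)
  have hemb : IsClosedEmbedding ((closedBall 0 ρ).domRestrict θ) :=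
    (continuousOn_iff_continuous_domRestrict.1 hθ).isClosedEmbedding (injOn_iff_injective.1 hinj)
  obtain ⟨m, hm⟩ := ContinuousMap.exists_extension (Y := ℂ) hemb
    ⟨fun w => l w, hlc.comp continuous_subtype_val⟩
  refine ⟨m, m.continuous.continuousOn, ?_⟩
  rintro _ ⟨w, hw, rfl⟩
  have hmw : m (θ w) = l w := DFunLike.congr_fun hm ⟨w, hw⟩
  rw [hmw, hl w, hrid w hw]

theorem of_starConvex {p : ℂ} (hC : StarConvex ℝ p C) (hp : p ∈ C) (ha : a ∉ C) :
    HasLogOn C a := by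
  have hpa : p - a ≠ 0 := sub_ne_zero.2 fun h => ha (h ▸ hp)
  refine ⟨fun z => Complex.log ((z - a) / (p - a)) + Complex.log (p - a), ?_, fun z hz => ?_⟩
  · refine ContinuousOn.add (ContinuousOn.clog (by fun_prop) fun z hz => ?_) continuousOn_const
    rw [Complex.mem_slitPlane_iff_not_le_zero]
    intro hle
    obtain ⟨s, hs0, hs⟩ : ∃ s : ℝ, 0 ≤ s ∧ a - z = s • (p - a) := by
      rw [Complex.le_def] at hle
      refine ⟨-((z - a) / (p - a)).re, neg_nonneg.2 hle.1, ?_⟩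
      have hreal : ((((z - a) / (p - a)).re : ℝ) : ℂ) = (z - a) / (p - a) :=
        Complex.ext rfl hle.2.symm
      rw [Complex.real_smul, Complex.ofReal_neg, hreal, neg_mul, div_mul_cancel₀ _ hpa, neg_sub]
    refine ha (hC.segment_subset hz ?_)
    rw [segment_symm, mem_segment_iff_sameRay, hs]
    exact SameRay.sameRay_nonneg_smul_left _ hs0
  · have hza : z - a ≠ 0 := sub_ne_zero.2 fun h => ha (h ▸ hz)
    rw [Complex.exp_add, Complex.exp_log (div_ne_zero hza hpa), Complex.exp_log hpa,
      div_mul_cancel₀ _ hpa]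

theorem union {A B : Set ℂ} (hA : IsClosed A) (hB : IsClosed B) {p : ℂ} (hAB : A ∩ B = {p})
    (hAlog : HasLogOn A a) (hBlog : HasLogOn B a) : HasLogOn (A ∪ B) a := by
  classical
  obtain ⟨l, hlc, hl⟩ := hAlog
  obtain ⟨m, hmc, hm⟩ := hBlog
  obtain ⟨hpA, hpB⟩ : p ∈ A ∩ B := hAB ▸ mem_singleton p
  set g : ℂ → ℂ := fun z => if z ∈ A then l z else m z + (l p - m p) with hg
  have hgA : EqOn g l A := fun z hz => if_pos hz
  have hgB : EqOn g (fun z => m z + (l p - m p)) B := fun z hz => by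
    by_cases hzA : z ∈ A
    · obtain rfl : z = p := hAB.subset ⟨hzA, hz⟩
      simp [hg, hzA]
    · exact if_neg hzA
  refine ⟨g, (hlc.congr hgA).union_of_isClosed ((hmc.add continuousOn_const).congr hgB) hA hB, ?_⟩
  rintro z (hz | hz)
  · rw [hgA hz, hl z hz]
  · have hshift : Complex.exp (l p - m p) = 1 := by
      rw [Complex.exp_sub, hl p hpA, ← hm p hpB, div_self (Complex.exp_ne_zero _)]
    rw [hgB hz, Complex.exp_add, hshift, mul_one, hm z hz]

end HasLogOn

/-! ### Locally univalent maps into the sphere -/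

theorem dist_coe_coe_le (a b : ℂ) : dist (a : OnePoint ℂ) (b : OnePoint ℂ) ≤ ‖a - b‖ := by
  have hone : ∀ z : ℂ, 1 ≤ √(1 + ‖z‖ ^ 2) := fun z => by
    rw [Real.one_le_sqrt]
    nlinarith [norm_nonneg z]
  exact div_le_self (norm_nonneg _) (one_le_mul_of_one_le_of_one_le (hone a) (hone b))

/-- The inversion `w ↦ 1 / w`, as a map from the plane to the sphere. -/
noncomputable def cinv (w : ℂ) : OnePoint ℂ :=
  open Classical in if w = 0 then ∞ else ((w⁻¹ : ℂ) : OnePoint ℂ)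

@[simp] theorem cinv_zero : cinv 0 = ∞ := if_pos rfl

theorem cinv_of_ne_zero {w : ℂ} (h : w ≠ 0) : cinv w = ((w⁻¹ : ℂ) : OnePoint ℂ) := if_neg h

theorem cinv_eq_infty_iff {w : ℂ} : cinv w = ∞ ↔ w = 0 := by
  by_cases h : w = 0 <;> simp [cinv, h]

/-- `F` is meromorphic and locally univalent at `z`: near `z`, either `F` or `1 / F` is a
holomorphic function with nonzero derivative at `z`. -/
def IsLocUnivAt (F : ℂ → OnePoint ℂ) (z : ℂ) : Prop :=
  ∃ g : ℂ → ℂ, AnalyticAt ℂ g z ∧ deriv g z ≠ 0 ∧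
    (F =ᶠ[𝓝 z] (fun w => (g w : OnePoint ℂ)) ∨ F =ᶠ[𝓝 z] fun w => cinv (g w))

theorem isLocUnivAt_coe {g : ℂ → ℂ} {z : ℂ} (hg : AnalyticAt ℂ g z) (hg' : deriv g z ≠ 0) :
    IsLocUnivAt (fun w => (g w : OnePoint ℂ)) z :=
  ⟨g, hg, hg', Or.inl EventuallyEq.rfl⟩

theorem isLocUnivAt_of_eventually_eq_polar {F : ℂ → OnePoint ℂ} {z c : ℂ} {β : ℂ → ℂ}
    (hz : F z = ∞) (hc : c ≠ 0) (hβ : AnalyticAt ℂ β z)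
    (h : ∀ᶠ w in 𝓝[≠] z, F w = ((c / (w - z) + β w : ℂ) : OnePoint ℂ)) : IsLocUnivAt F z := by
  set d : ℂ → ℂ := fun w => c + (w - z) * β w with hd
  have hda : AnalyticAt ℂ d z := by fun_prop
  have hdz : d z ≠ 0 := by simpa [hd] using hc
  refine ⟨fun w => (w - z) * (d w)⁻¹, by fun_prop (disch := assumption), ?_, Or.inr ?_⟩
  · have hderiv : HasDerivAt (fun w => (w - z) * (d w)⁻¹) (d z)⁻¹ z := by
      simpa using ((hasDerivAt_id z).sub_const z).fun_mul
        (hda.differentiableAt.hasDerivAt.fun_inv hdz)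
    rw [hderiv.deriv]
    exact inv_ne_zero hdz
  · rw [eventually_nhdsWithin_iff] at h
    filter_upwards [h, hda.continuousAt.eventually_ne hdz] with w hw hdw
    obtain rfl | hwz := eq_or_ne w z
    · rw [hz, sub_self, zero_mul, cinv_zero]
    · have hwz' : w - z ≠ 0 := sub_ne_zero.2 hwz
      rw [hw hwz, cinv_of_ne_zero (mul_ne_zero hwz' (inv_ne_zero hdw)), mul_inv, inv_inv, hd]
      congr 1
      field_simp

theorem exists_analyticAt_eq_add_sub_mul {g : ℂ → ℂ} {z : ℂ} (hg : AnalyticAt ℂ g z) :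
    ∃ k : ℂ → ℂ, AnalyticAt ℂ k z ∧ k z = deriv g z ∧ ∀ w, g w = g z + (w - z) * k w := by
  refine ⟨dslope g z, ?_, dslope_same g z, fun w => ?_⟩
  · obtain ⟨s, hs, hd⟩ := hg.exists_mem_nhds_analyticOnNhd
    exact ((Complex.differentiableOn_dslope hs).2 hd.differentiableOn).analyticAt hs
  · rw [← smul_eq_mul, sub_smul_dslope, add_sub_cancel]

namespace IsLocUnivAt

variable {F : ℂ → OnePoint ℂ} {z : ℂ}

theorem congr {G : ℂ → OnePoint ℂ} (hF : IsLocUnivAt F z) (h : F =ᶠ[𝓝 z] G) : IsLocUnivAt G z := by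
  obtain ⟨g, hg, hg', hFg⟩ := hF
  exact ⟨g, hg, hg', hFg.imp h.symm.trans h.symm.trans⟩

theorem comp {φ : ℂ → ℂ} (hF : IsLocUnivAt F (φ z)) (hφ : AnalyticAt ℂ φ z)
    (hφ' : deriv φ z ≠ 0) : IsLocUnivAt (fun w => F (φ w)) z := by
  obtain ⟨g, hg, hg', hFg⟩ := hF
  refine ⟨g ∘ φ, hg.comp hφ, ?_, hFg.imp
    (fun h => h.comp_tendsto hφ.continuousAt) (fun h => h.comp_tendsto hφ.continuousAt)⟩
  rw [deriv_comp z hg.differentiableAt hφ.differentiableAt]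
  exact mul_ne_zero hg' hφ'

theorem exists_eventuallyEq_coe (hF : IsLocUnivAt F z) (hz : F z ≠ ∞) :
    ∃ g : ℂ → ℂ, AnalyticAt ℂ g z ∧ deriv g z ≠ 0 ∧ F =ᶠ[𝓝 z] fun w => (g w : OnePoint ℂ) := by
  obtain ⟨g, hg, hg', h | h⟩ := hF
  · exact ⟨g, hg, hg', h⟩
  · have hg0 : g z ≠ 0 := fun h0 => hz (by rw [h.eq_of_nhds, h0, cinv_zero])
    refine ⟨fun w => (g w)⁻¹, hg.inv hg0, ?_, ?_⟩
    · rw [(hg.differentiableAt.hasDerivAt.fun_inv hg0).deriv]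
      exact div_ne_zero (neg_ne_zero.2 hg') (pow_ne_zero 2 hg0)
    · filter_upwards [h, hg.continuousAt.eventually_ne hg0] with w hw hw0
      rw [hw, cinv_of_ne_zero hw0]

theorem exists_eventuallyEq_cinv (hF : IsLocUnivAt F z) (hz : F z = ∞) :
    ∃ g : ℂ → ℂ, AnalyticAt ℂ g z ∧ g z = 0 ∧ deriv g z ≠ 0 ∧ F =ᶠ[𝓝 z] fun w => cinv (g w) := by
  obtain ⟨g, hg, hg', h | h⟩ := hF
  · exact absurd (h.eq_of_nhds.symm.trans hz) (OnePoint.coe_ne_infty _)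
  · exact ⟨g, hg, cinv_eq_infty_iff.1 (h.eq_of_nhds.symm.trans hz), hg', h⟩

theorem exists_eventually_eq_polar (hF : IsLocUnivAt F z) (hz : F z = ∞) :
    ∃ (c : ℂ) (β : ℂ → ℂ), c ≠ 0 ∧ AnalyticAt ℂ β z ∧
      ∀ᶠ w in 𝓝[≠] z, F w = ((c / (w - z) + β w : ℂ) : OnePoint ℂ) := by
  obtain ⟨g, hg, hg0, hg', h⟩ := hF.exists_eventuallyEq_cinv hz
  obtain ⟨k, hk, hkz, hgk⟩ := exists_analyticAt_eq_add_sub_mul hg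
  rw [← hkz] at hg'
  obtain ⟨β, hβ, -, hkβ⟩ := exists_analyticAt_eq_add_sub_mul (hk.fun_inv hg')
  refine ⟨(k z)⁻¹, β, inv_ne_zero hg', hβ, ?_⟩
  filter_upwards [h.filter_mono nhdsWithin_le_nhds,
    (hk.continuousAt.eventually_ne hg').filter_mono nhdsWithin_le_nhds,
    self_mem_nhdsWithin] with w hw hkw hwz
  have hwz' : w - z ≠ 0 := sub_ne_zero.2 hwz
  rw [hw, hgk w, hg0, zero_add, cinv_of_ne_zero (mul_ne_zero hwz' hkw), mul_inv, hkβ w]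
  congr 1
  field_simp

end IsLocUnivAt

theorem meromorphicOrderAt_eq_neg_one_iff {f : ℂ → ℂ} {z : ℂ} :
    meromorphicOrderAt f z = -1 ↔ ∃ (c : ℂ) (β : ℂ → ℂ), c ≠ 0 ∧ AnalyticAt ℂ β z ∧
      ∀ᶠ w in 𝓝[≠] z, f w = c / (w - z) + β w := by
  constructor
  · intro horder
    have hf : MeromorphicAt f z := by
      by_contra h
      simp [meromorphicOrderAt_of_not_meromorphicAt h] at horder
    obtain ⟨g, hg, hgz, hfg⟩ := (meromorphicOrderAt_eq_int_iff hf (n := -1)).1 horder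
    obtain ⟨β, hβ, -, hgβ⟩ := exists_analyticAt_eq_add_sub_mul hg
    refine ⟨g z, β, hgz, hβ, ?_⟩
    filter_upwards [hfg, self_mem_nhdsWithin] with w hw hwz
    have hwz' : w - z ≠ 0 := sub_ne_zero.2 hwz
    rw [hw, hgβ w, zpow_neg_one, smul_eq_mul]
    field_simp
  · rintro ⟨c, β, hc, hβ, hfβ⟩
    have hfg : f =ᶠ[𝓝[≠] z] fun w => (w - z) ^ (-1 : ℤ) • (c + (w - z) * β w) := by
      filter_upwards [hfβ, self_mem_nhdsWithin] with w hw hwz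
      have hwz' : w - z ≠ 0 := sub_ne_zero.2 hwz
      rw [hw, zpow_neg_one, smul_eq_mul]
      field_simp
    have hg : AnalyticAt ℂ (fun w => c + (w - z) * β w) z := by fun_prop
    have hf : MeromorphicAt f z :=
      ((((MeromorphicAt.id z).sub (MeromorphicAt.const z z)).zpow (-1)).smul
        hg.meromorphicAt).congr hfg.symm
    exact (meromorphicOrderAt_eq_int_iff hf (n := -1)).2 ⟨_, hg, by simpa using hc, hfg⟩

/-- The extension of `f` to the plane by the value `∞`. -/
noncomputable def extendInfty {Ω : Set ℂ} (f : SphereMap Ω) : ℂ → OnePoint ℂ :=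
  Function.extend Subtype.val f.toFun fun _ => ∞

section extendInfty

variable {Ω : Set ℂ} {f : SphereMap Ω}

theorem extendInfty_apply (f : SphereMap Ω) (z : Ω) : extendInfty f z = f.toFun z :=
  Subtype.val_injective.extend_apply _ _ _

theorem extendZero_apply (h : Ω → ℂ) (z : Ω) : extendZero h z = h z :=
  Subtype.val_injective.extend_apply _ _ _

theorem finitePart_apply (f : SphereMap Ω) {z : ℂ} (hz : z ∈ Ω) :
    finitePart f z = (extendInfty f z).elim 0 id := by
  rw [finitePart, extendInfty_apply f ⟨z, hz⟩]
  exact extendZero_apply _ ⟨z, hz⟩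

theorem extendInfty_eventuallyEq_finitePart (hΩ : IsOpen Ω) (hf : IsMeromorphic f) {z : ℂ}
    (hz : z ∈ Ω) (h : AnalyticAt ℂ (finitePart f) z) :
    extendInfty f =ᶠ[𝓝 z] fun w => (finitePart f w : OnePoint ℂ) := by
  filter_upwards [h.eventually_analyticAt, hΩ.mem_nhds hz] with w hw hwΩ
  have hfin : extendInfty f w ≠ ∞ := by
    rw [extendInfty_apply f ⟨w, hwΩ⟩]
    obtain ⟨hfin, -⟩ | ⟨-, -, hneg⟩ := hf ⟨w, hwΩ⟩
    · exact hfin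
    · exact absurd hw.meromorphicOrderAt_nonneg hneg.not_ge
  obtain ⟨v, hv⟩ := OnePoint.ne_infty_iff_exists.1 hfin
  rw [finitePart_apply f hwΩ, ← hv]
  rfl

theorem IsLocUnivAt.analyticAt_finitePart (hΩ : IsOpen Ω) {z : ℂ} (hz : z ∈ Ω)
    (h : IsLocUnivAt (extendInfty f) z) (hfz : extendInfty f z ≠ ∞) :
    AnalyticAt ℂ (finitePart f) z ∧ deriv (finitePart f) z ≠ 0 := by
  obtain ⟨g, hg, hg', hfg⟩ := h.exists_eventuallyEq_coe hfz
  have heq : finitePart f =ᶠ[𝓝 z] g := by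
    filter_upwards [hfg, hΩ.mem_nhds hz] with w hw hwΩ
    rw [finitePart_apply f hwΩ, hw]
    rfl
  exact ⟨hg.congr heq.symm, by rwa [heq.deriv_eq]⟩

theorem IsLocUnivAt.meromorphicOrderAt_finitePart (hΩ : IsOpen Ω) {z : ℂ} (hz : z ∈ Ω)
    (h : IsLocUnivAt (extendInfty f) z) (hfz : extendInfty f z = ∞) :
    meromorphicOrderAt (finitePart f) z = -1 := by
  obtain ⟨c, β, hc, hβ, hfβ⟩ := h.exists_eventually_eq_polar hfz
  refine meromorphicOrderAt_eq_neg_one_iff.2 ⟨c, β, hc, hβ, ?_⟩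
  filter_upwards [hfβ, nhdsWithin_le_nhds (hΩ.mem_nhds hz)] with w hw hwΩ
  rw [finitePart_apply f hwΩ, hw]
  rfl

theorem isLocUnivAt_extendInfty (hΩ : IsOpen Ω) (hf : f ∈ locallyUnivalentMeromorphic Ω) {z : ℂ}
    (hz : z ∈ Ω) : IsLocUnivAt (extendInfty f) z := by
  obtain ⟨hmero, hpole, hderiv⟩ := hf
  obtain ⟨hfz, han⟩ | ⟨hfz, hmz, -⟩ := hmero ⟨z, hz⟩
  · exact ⟨finitePart f, han, hderiv ⟨z, hz⟩ hfz,
      Or.inl (extendInfty_eventuallyEq_finitePart hΩ hmero hz han)⟩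
  · obtain ⟨c, β, hc, hβ, hfβ⟩ := meromorphicOrderAt_eq_neg_one_iff.1 (hpole ⟨z, hz⟩ hfz)
    refine isLocUnivAt_of_eventually_eq_polar ((extendInfty_apply f ⟨z, hz⟩).trans hfz) hc hβ ?_
    filter_upwards [hfβ, hmz.eventually_analyticAt, nhdsWithin_le_nhds (hΩ.mem_nhds hz)]
      with w hw han hwΩ
    rw [(extendInfty_eventuallyEq_finitePart hΩ hmero hwΩ han).eq_of_nhds, hw]

theorem mem_locallyUnivalentMeromorphic_iff (hΩ : IsOpen Ω) :
    f ∈ locallyUnivalentMeromorphic Ω ↔ ∀ z ∈ Ω, IsLocUnivAt (extendInfty f) z := by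
  refine ⟨fun hf z => isLocUnivAt_extendInfty hΩ hf, fun h => ?_⟩
  have hfin : ∀ z : Ω, f.toFun z ≠ ∞ →
      AnalyticAt ℂ (finitePart f) z ∧ deriv (finitePart f) z ≠ 0 := fun z hz =>
    (h z z.2).analyticAt_finitePart hΩ z.2 (by rwa [extendInfty_apply])
  have hinf : ∀ z : Ω, f.toFun z = ∞ → meromorphicOrderAt (finitePart f) z = -1 := fun z hz =>
    (h z z.2).meromorphicOrderAt_finitePart hΩ z.2 (by rwa [extendInfty_apply])
  refine ⟨fun z => ?_, hinf, fun z hz => (hfin z hz).2⟩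
  by_cases hz : f.toFun z = ∞
  · have hneg : meromorphicOrderAt (finitePart f) z < 0 := by
      rw [hinf z hz]
      decide
    refine Or.inr ⟨hz, ?_, hneg⟩
    by_contra hm
    simp [meromorphicOrderAt_of_not_meromorphicAt hm] at hneg
  · exact Or.inl ⟨hz, (hfin z hz).1⟩

end extendInfty

/-! ### Polynomial approximation with a prescribed integral -/

theorem exists_contDiff_eventually_eq_one {E : Type*} [NormedAddCommGroup E] [NormedSpace ℝ E]
    [FiniteDimensional ℝ E] {K U : Set E} (hK : IsCompact K) (hU : IsOpen U) (hKU : K ⊆ U) :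
    ∃ χ : E → ℝ, ContDiff ℝ 1 χ ∧ HasCompactSupport χ ∧ tsupport χ ⊆ U ∧
      (∀ᶠ z in 𝓝ˢ K, χ z = 1) ∧ ∀ z, χ z ∈ Icc (0 : ℝ) 1 := by
  obtain ⟨K', hK', hKK', hK'U⟩ := exists_compact_between hK hU hKU
  obtain ⟨f, hf1, hf0, hf⟩ := exists_contMDiffMap_one_nhds_of_subset_interior
    (modelWithCornersSelf ℝ E) (n := 1) hK.isClosed hKK'
  have hsub : tsupport f ⊆ K' := closure_minimal (fun z hz => by_contra fun h => hz (hf0 z h))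
    hK'.isClosed
  exact ⟨f, f.contMDiff.contDiff, HasCompactSupport.of_support_subset_isCompact hK'
    ((subset_tsupport _).trans hsub), hsub.trans hK'U, hf1, hf⟩

theorem contDiff_smul_of_tsupport_subset {χ : ℂ → ℝ} (hχ : ContDiff ℝ 1 χ) {V : Set ℂ}
    (hV : IsOpen V) (hs : tsupport χ ⊆ V) {k : ℂ → ℂ} (hk : DifferentiableOn ℂ k V) :
    ContDiff ℝ 1 fun z => χ z • k z := by
  refine contDiff_iff_contDiffAt.2 fun z => ?_
  by_cases hz : z ∈ V
  · have hkz : ContDiffAt ℂ 1 k z := (hk.analyticAt (hV.mem_nhds hz)).contDiffAt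
    exact hχ.contDiffAt.smul (hkz.restrict_scalars ℝ)
  · have hzero : (fun z => χ z • k z) =ᶠ[𝓝 z] fun _ => (0 : ℂ) := by
      filter_upwards [notMem_tsupport_iff_eventuallyEq.1 fun h => hz (hs h)] with w hw
      rw [hw, Pi.zero_apply, zero_smul]
    exact contDiffAt_const.congr_of_eventuallyEq hzero

theorem addHaar_segment_eq_zero {E : Type*} [NormedAddCommGroup E] [NormedSpace ℝ E]
    [MeasurableSpace E] [BorelSpace E] [FiniteDimensional ℝ E] (μ : Measure E)
    [μ.IsAddHaarMeasure] (hE : 1 < Module.finrank ℝ E) (x y : E) : μ (segment ℝ x y) = 0 := by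
  have hne : line[ℝ, x, y] ≠ ⊤ := fun h => by
    have hrank := (collinear_iff_finrank_le_one).1 (collinear_pair ℝ x y)
    rw [← direction_affineSpan, h, AffineSubspace.direction_top, finrank_top] at hrank
    exact hrank.not_gt hE
  refine measure_mono_null ?_ (Measure.addHaar_affineSubspace μ _ hne)
  rw [← convexHull_pair]
  exact convexHull_subset_affineSpan _

section SimultaneousApproximation

variable {A B V N : Set ℂ} {k L : ℂ → ℂ}

theorem exists_contDiff_eventuallyEq_and_eventually_eq (hA : IsCompact A) (hB : IsCompact B)
    (hV : IsOpen V) (hAV : A ⊆ V) (hk : DifferentiableOn ℂ k V) (hN : IsOpen N) (hBN : B ⊆ N)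
    (hL : DifferentiableOn ℂ L N) :
    ∃ F : ℕ → ℂ → ℂ, (∀ n, ContDiff ℝ 1 (F n)) ∧ (∀ n, HasCompactSupport (F n)) ∧
      (∀ n, ∀ z ∈ A, F n =ᶠ[𝓝 z] k) ∧ (∃ M, ∀ n, ∀ z ∈ B, ‖F n z‖ ≤ M) ∧
      ∀ z ∈ B \ A, ∀ᶠ n in atTop, F n z = L z := by
  obtain ⟨χ, hχ, hχc, hχs, hχ1, -⟩ := exists_contDiff_eventually_eq_one hA hV hAV
  have hχk := contDiff_smul_of_tsupport_subset hχ hV hχs hk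
  have hρ : ∀ n : ℕ, ∃ ρ : ℂ → ℝ, ContDiff ℝ 1 ρ ∧ HasCompactSupport ρ ∧ tsupport ρ ⊆ N \ A ∧
      (∀ᶠ z in 𝓝ˢ (B \ thickening (1 / ((n : ℝ) + 1)) A), ρ z = 1) ∧ ∀ z, ρ z ∈ Icc (0 : ℝ) 1 :=
    fun n => exists_contDiff_eventually_eq_one (hB.diff isOpen_thickening)
      (hN.sdiff hA.isClosed) fun z hz =>
        ⟨hBN hz.1, fun h => hz.2 (self_subset_thickening (by positivity) A h)⟩
  choose ρ hρ hρc hρs hρ1 hρI using hρ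
  have hsmooth : ∀ n, ContDiff ℝ 1 fun z => (1 - ρ n z) • (χ z • k z) + ρ n z • L z := fun n =>
    ((contDiff_const.sub (hρ n)).smul hχk).add
      (contDiff_smul_of_tsupport_subset (hρ n) hN ((hρs n).trans sdiff_subset) hL)
  have hsupp : ∀ n, HasCompactSupport fun z => (1 - ρ n z) • (χ z • k z) + ρ n z • L z := fun n =>
    .add (f := fun z => (1 - ρ n z) • (χ z • k z)) (f' := fun z => ρ n z • L z)
      (hχc.mono fun z hz h => hz (by simp [h])) ((hρc n).mono fun z hz h => hz (by simp [h]))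
  refine ⟨_, hsmooth, hsupp, fun n z hz => ?_, ?_, ?_⟩
  · have hρ0 : ρ n =ᶠ[𝓝 z] 0 := notMem_tsupport_iff_eventuallyEq.1 fun h => (hρs n h).2 hz
    filter_upwards [hρ0, hχ1.filter_mono (nhds_le_nhdsSet hz)] with w hρw hχw
    simp [hρw, hχw]
  · obtain ⟨M₁, hM₁⟩ := hB.exists_bound_of_continuousOn hχk.continuous.continuousOn
    obtain ⟨M₂, hM₂⟩ := hB.exists_bound_of_continuousOn (hL.continuousOn.mono hBN)
    refine ⟨M₁ + M₂, fun n z hz => (norm_add_le _ _).trans (add_le_add ?_ ?_)⟩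
    · rw [norm_smul, Real.norm_of_nonneg (by linarith [(hρI n z).2])]
      exact (mul_le_of_le_one_left (norm_nonneg _) (by linarith [(hρI n z).1])).trans (hM₁ z hz)
    · rw [norm_smul, Real.norm_of_nonneg (hρI n z).1]
      exact (mul_le_of_le_one_left (norm_nonneg _) (hρI n z).2).trans (hM₂ z hz)
  · rintro z ⟨hzB, hzA⟩
    obtain ⟨δ, hδ, hzδ⟩ := Metric.isOpen_iff.1 hA.isClosed.isOpen_compl z hzA
    filter_upwards [tendsto_one_div_add_atTop_nhds_zero_nat.eventually_lt_const hδ] with n hn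
    have hz : z ∉ thickening (1 / ((n : ℝ) + 1)) A := fun h => by
      obtain ⟨w, hwA, hzw⟩ := mem_thickening_iff.1 h
      exact hzδ (mem_ball'.2 (hzw.trans hn)) hwA
    simp [(hρ1 n).self_of_nhdsSet z ⟨hzB, hz⟩]

theorem exists_polynomial_tendstoUniformlyOn_and_tendsto (hA : IsCompact A) (hB : IsCompact B)
    (hB0 : volume B = 0)
    (hunb : ∀ a ∉ A ∪ B, ¬ Bornology.IsBounded (connectedComponentIn (A ∪ B)ᶜ a))
    (hV : IsOpen V) (hAV : A ⊆ V) (hk : DifferentiableOn ℂ k V) (hN : IsOpen N) (hBN : B ⊆ N)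
    (hL : DifferentiableOn ℂ L N) :
    ∃ u : ℕ → Polynomial ℂ, TendstoUniformlyOn (fun n z => (u n).eval z) k atTop A ∧
      (∃ M, ∀ n, ∀ z ∈ B, ‖(u n).eval z‖ ≤ M) ∧
      ∀ z ∈ B \ A, Tendsto (fun n => (u n).eval z) atTop (𝓝 (L z)) := by
  obtain ⟨F, hF, hFc, hFA, ⟨M, hM⟩, hFB⟩ :=
    exists_contDiff_eventuallyEq_and_eventually_eq hA hB hV hAV hk hN hBN hL
  have hnull : ∀ n, volume {z ∈ A ∪ B | dbar (F n) z ≠ 0} = 0 := fun n =>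
    measure_mono_null (fun z hz => hz.1.resolve_left fun hzA => hz.2
      (dbar_eq_zero_of_eventuallyEq (hFA n z hzA)
        (hk.differentiableAt (hV.mem_nhds (hAV hzA))))) hB0
  have happrox : ∀ n : ℕ, ∃ u : Polynomial ℂ, ∀ z ∈ A ∪ B,
      ‖u.eval z - F n z‖ < 1 / ((n : ℝ) + 1) := fun n =>
    exists_polynomial_norm_eval_sub_lt (hA.union hB) hunb (hF n) (hFc n) (hnull n) (by positivity)
  choose u hu using happrox
  have hlim := tendsto_one_div_add_atTop_nhds_zero_nat (𝕜 := ℝ)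
  refine ⟨u, Metric.tendstoUniformlyOn_iff.2 fun ε hε => ?_, ⟨M + 1, fun n z hz => ?_⟩,
    fun z hz => ?_⟩
  · filter_upwards [hlim.eventually_lt_const hε] with n hn z hz
    rw [dist_comm, dist_eq_norm, ← (hFA n z hz).eq_of_nhds]
    exact (hu n z (Or.inl hz)).trans hn
  · have hle : 1 / ((n : ℝ) + 1) ≤ 1 := Nat.one_div_le_one_div n.zero_le |>.trans (by simp)
    linarith [norm_sub_norm_le ((u n).eval z) (F n z), hM n z hz, hu n z (Or.inr hz)]
  · rw [tendsto_iff_norm_sub_tendsto_zero]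
    refine squeeze_zero' (Eventually.of_forall fun _ => norm_nonneg _) ?_ hlim
    filter_upwards [hFB z hz] with n hn
    rw [← hn]
    exact (hu n z (Or.inr hz.1)).le

end SimultaneousApproximation

theorem isCompact_segment {E : Type*} [AddCommGroup E] [Module ℝ E] [TopologicalSpace E]
    [IsTopologicalAddGroup E] [ContinuousSMul ℝ E] (x y : E) : IsCompact (segment ℝ x y) := by
  rw [← convexHull_pair]
  exact (toFinite _).isCompact_convexHull ℝ

/-- The integral of `f` along the segment from `x` to `y`. -/
noncomputable def segmentIntegral (f : ℂ → ℂ) (x y : ℂ) : ℂ :=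
  ∫ t in (0 : ℝ)..1, f (AffineMap.lineMap x y t) * (y - x)

theorem lineMap_mem_segment {E : Type*} [AddCommGroup E] [Module ℝ E] (x y : E) {t : ℝ}
    (ht : t ∈ Icc (0 : ℝ) 1) : AffineMap.lineMap x y t ∈ segment ℝ x y :=
  segment_eq_image_lineMap ℝ x y ▸ mem_image_of_mem _ ht

theorem lineMap_mem_openSegment {E : Type*} [AddCommGroup E] [Module ℝ E] (x y : E) {t : ℝ}
    (ht : t ∈ Ioo (0 : ℝ) 1) : AffineMap.lineMap x y t ∈ openSegment ℝ x y :=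
  openSegment_eq_image_lineMap ℝ x y ▸ mem_image_of_mem _ ht

section segmentIntegral

variable {x y : ℂ}

theorem segmentIntegral_eq_sub {f f' : ℂ → ℂ} (hf : ∀ z ∈ segment ℝ x y, HasDerivAt f (f' z) z)
    (hf' : ContinuousOn f' (segment ℝ x y)) : segmentIntegral f' x y = f y - f x := by
  have hline : ∀ t ∈ uIcc (0 : ℝ) 1, AffineMap.lineMap x y t ∈ segment ℝ x y := fun t ht =>
    lineMap_mem_segment x y (uIcc_of_le (zero_le_one (α := ℝ)) ▸ ht)
  have hf'int :
      IntervalIntegrable (fun t : ℝ => f' (AffineMap.lineMap x y t) * (y - x)) volume 0 1 :=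
    ((hf'.comp AffineMap.lineMap_continuous.continuousOn hline).mul
      continuousOn_const).intervalIntegrable
  rw [segmentIntegral, intervalIntegral.integral_eq_sub_of_hasDerivAt
    (fun t ht => (hf _ (hline t ht)).comp t AffineMap.hasDerivAt_lineMap) hf'int]
  simp

theorem tendsto_segmentIntegral {H : ℂ × ℂ → ℂ} (hH : ContinuousOn H (segment ℝ x y ×ˢ univ))
    {g : ℕ → ℂ → ℂ} {g' : ℂ → ℂ} (hg : ∀ n, ContinuousOn (g n) (segment ℝ x y)) {M : ℝ}
    (hM : ∀ n, ∀ z ∈ segment ℝ x y, ‖g n z‖ ≤ M)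
    (hlim : ∀ z ∈ openSegment ℝ x y, Tendsto (fun n => g n z) atTop (𝓝 (g' z))) :
    Tendsto (fun n => segmentIntegral (fun z => H (z, g n z)) x y) atTop
      (𝓝 (segmentIntegral (fun z => H (z, g' z)) x y)) := by
  have hcompact : IsCompact (segment ℝ x y ×ˢ closedBall (0 : ℂ) M) :=
    (isCompact_segment x y).prod (isCompact_closedBall 0 M)
  obtain ⟨D, hD⟩ := hcompact.exists_bound_of_continuousOn
    (hH.mono (prod_mono_right (subset_univ _)))
  have hline : ∀ t ∈ uIoc (0 : ℝ) 1, AffineMap.lineMap x y t ∈ segment ℝ x y := fun t ht =>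
    lineMap_mem_segment x y (Ioc_subset_Icc_self (uIoc_of_le (zero_le_one (α := ℝ)) ▸ ht))
  refine intervalIntegral.tendsto_integral_filter_of_dominated_convergence
    (fun _ => D * ‖y - x‖) (Eventually.of_forall fun n => ?_)
    (Eventually.of_forall fun n => Eventually.of_forall fun t ht => ?_)
    intervalIntegrable_const ?_
  · refine ContinuousOn.aestronglyMeasurable (ContinuousOn.mul ?_ continuousOn_const)
      measurableSet_uIoc
    exact hH.comp ((continuousOn_id.prodMk (hg n)).comp AffineMap.lineMap_continuous.continuousOn
      hline) fun t ht => ⟨hline t ht, mem_univ _⟩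
  · rw [norm_mul]
    gcongr
    exact hD _ ⟨hline t ht, mem_closedBall_zero_iff.2 (hM n _ (hline t ht))⟩
  · have hne : ∀ᵐ t : ℝ, t ≠ 1 := by simp [ae_iff, measure_singleton]
    filter_upwards [hne] with t ht1 ht
    rw [uIoc_of_le zero_le_one] at ht
    have hopen := lineMap_mem_openSegment x y ⟨ht.1, ht.2.lt_of_ne ht1⟩
    have hseg := openSegment_subset_segment ℝ x y hopen
    refine ((hH _ ⟨hseg, mem_univ (g' (AffineMap.lineMap x y t))⟩).tendsto.comp ?_).mul_const _
    exact tendsto_nhdsWithin_iff.2 ⟨tendsto_const_nhds.prodMk_nhds (hlim _ hopen),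
      Eventually.of_forall fun n => ⟨hseg, mem_univ _⟩⟩

end segmentIntegral

theorem HasLogOn.union_segment {A₁ A₂ : Set ℂ} (hA₁ : IsClosed A₁) (hA₂ : IsClosed A₂)
    (hdisj : Disjoint A₁ A₂) {x y : ℂ} (hx : A₁ ∩ segment ℝ x y = {x})
    (hy : A₂ ∩ segment ℝ x y = {y}) {a : ℂ} (hlog₁ : HasLogOn A₁ a) (hlog₂ : HasLogOn A₂ a)
    (ha : a ∉ segment ℝ x y) : HasLogOn (A₁ ∪ A₂ ∪ segment ℝ x y) a := by
  have hseg : IsClosed (segment ℝ x y) := (isCompact_segment x y).isClosed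
  have hlog : HasLogOn (segment ℝ x y) a :=
    of_starConvex ((convex_segment x y).starConvex (left_mem_segment ℝ x y))
      (left_mem_segment ℝ x y) ha
  rw [union_assoc]
  refine union hA₁ (hA₂.union hseg) (p := x) ?_ hlog₁ (union hA₂ hseg hy hlog₂ hlog)
  rw [inter_union_distrib_left, hdisj.inter_eq, empty_union, hx]

theorem exists_differentiableOn_exp_div_mul_eq {x y : ℂ} (hxy : x ≠ y) (P q : ℂ[X])
    (hP : ∀ z ∈ segment ℝ x y, P.eval z ≠ 0) {c : ℂ} (hc : c ≠ 0) :
    ∃ (N : Set ℂ) (L : ℂ → ℂ), IsOpen N ∧ segment ℝ x y ⊆ N ∧ DifferentiableOn ℂ L N ∧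
      ∀ z ∈ N, Complex.exp (-2 * (q.eval z + P.eval z ^ 2 * L z)) / P.eval z ^ 2 * (y - x) = c := by
  have hyx : y - x ≠ 0 := sub_ne_zero.2 hxy.symm
  obtain ⟨δ, hδ, hδP⟩ := (isCompact_segment x y).exists_thickening_subset_open
    (isOpen_ne_fun P.continuous continuous_const) hP
  set N := thickening δ (segment ℝ x y)
  have hsegN : segment ℝ x y ⊆ N := self_subset_thickening hδ _
  obtain ⟨l, hl, hexp⟩ := exists_differentiableOn_exp_eq isOpen_thickening
    (isSimplyConnected_of_convex ((convex_segment x y).thickening δ)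
      ⟨x, hsegN (left_mem_segment ℝ x y)⟩)
    (g := fun z => c * P.eval z ^ 2 / (y - x)) (by fun_prop)
    fun z hz => div_ne_zero (mul_ne_zero hc (pow_ne_zero 2 (hδP hz))) hyx
  refine ⟨N, fun z => (-(l z) / 2 - q.eval z) / P.eval z ^ 2, isOpen_thickening, hsegN,
    ((hl.neg.div_const 2).sub (by fun_prop)).div (by fun_prop) fun z hz => pow_ne_zero 2 (hδP hz),
    fun z hz => ?_⟩
  have hPz : P.eval z ≠ 0 := hδP hz
  have hexponent : -2 * (q.eval z + P.eval z ^ 2 * ((-(l z) / 2 - q.eval z) / P.eval z ^ 2)) =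
      l z := by
    field_simp
    ring
  rw [hexponent, hexp z hz]
  field_simp

theorem openSegment_subset_segment_sdiff {E : Type*} [AddCommGroup E] [Module ℝ E] {A₁ A₂ : Set E}
    {x y : E} (hxy : x ≠ y) (hx : A₁ ∩ segment ℝ x y = {x}) (hy : A₂ ∩ segment ℝ x y = {y}) :
    openSegment ℝ x y ⊆ segment ℝ x y \ (A₁ ∪ A₂) := by
  intro z hz
  have hzs := openSegment_subset_segment ℝ x y hz
  refine ⟨hzs, ?_⟩
  rintro (hzA | hzA)
  · obtain rfl : z = x := hx.subset ⟨hzA, hzs⟩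
    exact hxy (left_mem_openSegment_iff.1 hz)
  · obtain rfl : z = y := hy.subset ⟨hzA, hzs⟩
    exact hxy (right_mem_openSegment_iff.1 hz)

section PrescribedIntegral

variable {A₁ A₂ V : Set ℂ} {k : ℂ → ℂ} {x y : ℂ} {ε : ℝ}

/-- The polynomials approximate `k` on `A₁ ∪ A₂`, and on the rest of the segment they approximate a
function `L` for which the integrand is constant. -/
theorem exists_polynomial_norm_sub_lt_norm_segmentIntegral_sub_lt_of_ne_zero (hA₁ : IsCompact A₁)
    (hA₂ : IsCompact A₂) (hV : IsOpen V) (hAV : A₁ ∪ A₂ ⊆ V) (hdisj : Disjoint A₁ A₂)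
    (hk : DifferentiableOn ℂ k V) (hlog₁ : ∀ a ∉ A₁, HasLogOn A₁ a)
    (hlog₂ : ∀ a ∉ A₂, HasLogOn A₂ a) (hx : A₁ ∩ segment ℝ x y = {x})
    (hy : A₂ ∩ segment ℝ x y = {y}) (P q : ℂ[X]) (hP : ∀ z ∈ segment ℝ x y, P.eval z ≠ 0) {c : ℂ}
    (hc : c ≠ 0) (hε : 0 < ε) :
    ∃ u : ℂ[X], (∀ z ∈ A₁ ∪ A₂, ‖u.eval z - k z‖ < ε) ∧
      ‖segmentIntegral (fun z => Complex.exp (-2 * (q.eval z + P.eval z ^ 2 * u.eval z)) /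
        P.eval z ^ 2) x y - c‖ < ε := by
  have hxy : x ≠ y := fun h => hdisj.le_bot
    ⟨(hx ▸ mem_singleton x : x ∈ A₁ ∩ segment ℝ x y).1,
      (hy ▸ h.symm ▸ mem_singleton y : x ∈ A₂ ∩ segment ℝ x y).1⟩
  obtain ⟨N, L, hNo, hN, hL, hLc⟩ := exists_differentiableOn_exp_div_mul_eq hxy P q hP hc
  have hseg := isCompact_segment x y
  have hunb : ∀ a ∉ A₁ ∪ A₂ ∪ segment ℝ x y,
      ¬ Bornology.IsBounded (connectedComponentIn (A₁ ∪ A₂ ∪ segment ℝ x y)ᶜ a) := fun a ha =>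
    (HasLogOn.union_segment hA₁.isClosed hA₂.isClosed hdisj hx hy
      (hlog₁ a fun h => ha (Or.inl (Or.inl h))) (hlog₂ a fun h => ha (Or.inl (Or.inr h)))
      fun h => ha (Or.inr h)).not_isBounded_connectedComponentIn
        ((hA₁.union hA₂).union hseg).isClosed ha
  have hnull := addHaar_segment_eq_zero volume (by simp [Complex.finrank_real_complex]) x y
  obtain ⟨u, huk, ⟨M, hM⟩, huL⟩ := exists_polynomial_tendstoUniformlyOn_and_tendsto
    (hA₁.union hA₂) hseg hnull hunb hV hAV hk hNo hN hL
  have hlim := tendsto_segmentIntegral (x := x) (y := y)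
    (H := fun w => Complex.exp (-2 * (q.eval w.1 + P.eval w.1 ^ 2 * w.2)) / P.eval w.1 ^ 2)
    (ContinuousOn.div (by fun_prop) (by fun_prop) fun w hw => pow_ne_zero 2 (hP _ hw.1))
    (fun n => (u n).continuous.continuousOn) hM fun z hz =>
      huL z (openSegment_subset_segment_sdiff hxy hx hy hz)
  have hval : segmentIntegral (fun z => Complex.exp (-2 * (q.eval z + P.eval z ^ 2 * L z)) /
      P.eval z ^ 2) x y = c := by
    rw [segmentIntegral, intervalIntegral.integral_congr (g := fun _ => c) fun t ht =>
      hLc _ (hN (lineMap_mem_segment x y (uIcc_of_le (zero_le_one (α := ℝ)) ▸ ht)))]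
    simp
  rw [hval] at hlim
  obtain ⟨n, hn, hnc⟩ := ((Metric.tendstoUniformlyOn_iff.1 huk ε hε).and
    (Metric.tendsto_nhds.1 hlim ε hε)).exists
  exact ⟨u n, fun z hz => by simpa only [dist_comm (k z), dist_eq_norm] using hn z hz,
    by simpa only [dist_eq_norm] using hnc⟩

theorem exists_polynomial_norm_sub_lt_norm_segmentIntegral_sub_lt (hA₁ : IsCompact A₁)
    (hA₂ : IsCompact A₂) (hV : IsOpen V) (hAV : A₁ ∪ A₂ ⊆ V) (hdisj : Disjoint A₁ A₂)
    (hk : DifferentiableOn ℂ k V) (hlog₁ : ∀ a ∉ A₁, HasLogOn A₁ a)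
    (hlog₂ : ∀ a ∉ A₂, HasLogOn A₂ a) (hx : A₁ ∩ segment ℝ x y = {x})
    (hy : A₂ ∩ segment ℝ x y = {y}) (P q : ℂ[X]) (hP : ∀ z ∈ segment ℝ x y, P.eval z ≠ 0) (c : ℂ)
    (hε : 0 < ε) :
    ∃ u : ℂ[X], (∀ z ∈ A₁ ∪ A₂, ‖u.eval z - k z‖ < ε) ∧
      ‖segmentIntegral (fun z => Complex.exp (-2 * (q.eval z + P.eval z ^ 2 * u.eval z)) /
        P.eval z ^ 2) x y - c‖ < ε := by
  obtain ⟨c', hc', hcc'⟩ : ∃ c' : ℂ, c' ≠ 0 ∧ ‖c' - c‖ < ε / 2 := by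
    have := (dense_compl_singleton (0 : ℂ)).exists_dist_lt c (half_pos hε)
    simpa [dist_comm c, dist_eq_norm] using this
  obtain ⟨u, huk, huc⟩ := exists_polynomial_norm_sub_lt_norm_segmentIntegral_sub_lt_of_ne_zero
    hA₁ hA₂ hV hAV hdisj hk hlog₁ hlog₂ hx hy P q hP hc' (half_pos hε)
  refine ⟨u, fun z hz => (huk z hz).trans (half_lt_self hε), ?_⟩
  linarith [norm_sub_le_norm_sub_add_norm_sub (segmentIntegral (fun z =>
    Complex.exp (-2 * (q.eval z + P.eval z ^ 2 * u.eval z)) / P.eval z ^ 2) x y) c' c]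

end PrescribedIntegral

/-! ### Derivatives of locally univalent meromorphic functions -/

theorem exists_differentiableOn_eventuallyEq {V : Set ℂ} {E : ℂ → ℂ}
    (h : ∀ z ∈ V, ∃ e : ℂ → ℂ, AnalyticAt ℂ e z ∧ E =ᶠ[𝓝[≠] z] e) :
    ∃ G : ℂ → ℂ, DifferentiableOn ℂ G V ∧
      ∀ z (e : ℂ → ℂ), AnalyticAt ℂ e z → E =ᶠ[𝓝[≠] z] e → G z = e z := by
  have hlim : ∀ z (e : ℂ → ℂ), AnalyticAt ℂ e z → E =ᶠ[𝓝[≠] z] e →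
      limUnder (𝓝[≠] z) E = e z := fun z e he hE =>
    ((he.continuousAt.tendsto.mono_left nhdsWithin_le_nhds).congr' hE.symm).limUnder_eq
  refine ⟨fun z => limUnder (𝓝[≠] z) E, fun z hz => ?_, hlim⟩
  obtain ⟨e, he, hE⟩ := h z hz
  have heq : (fun w => limUnder (𝓝[≠] w) E) =ᶠ[𝓝 z] e := by
    filter_upwards [eventually_nhdsWithin_iff.1 (eventually_eventually_nhdsWithin.2 hE),
      he.eventually_analyticAt] with w hw hew
    obtain rfl | hwz := eq_or_ne w z
    · exact hlim w e he hE
    · have hEw : ∀ᶠ v in 𝓝 w, E v = e v := by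
        simpa only [isOpen_compl_singleton.nhdsWithin_eq hwz] using hw hwz
      exact hlim w e hew (hEw.filter_mono nhdsWithin_le_nhds)
  exact (he.congr heq.symm).differentiableAt.differentiableWithinAt

/-- The finite values of a map into the sphere, with the value `0` at the poles. -/
def finiteValue (F : ℂ → OnePoint ℂ) (z : ℂ) : ℂ := (F z).elim 0 id

theorem finiteValue_of_eq_coe {F : ℂ → OnePoint ℂ} {z w : ℂ} (h : F z = (w : OnePoint ℂ)) :
    finiteValue F z = w := by
  rw [finiteValue, h]
  rfl

theorem coe_finiteValue {F : ℂ → OnePoint ℂ} {z : ℂ} (h : F z ≠ ∞) :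
    (finiteValue F z : OnePoint ℂ) = F z := by
  obtain ⟨w, hw⟩ := OnePoint.ne_infty_iff_exists.1 h
  rw [finiteValue_of_eq_coe hw.symm, hw]

/-- `D` has a double pole with residue zero at `a`. These are the poles of the derivatives of
functions with simple poles. -/
def HasResidueFreeDoublePole (D : ℂ → ℂ) (a : ℂ) : Prop :=
  ∃ (c : ℂ) (β : ℂ → ℂ), c ≠ 0 ∧ AnalyticAt ℂ β a ∧
    D =ᶠ[𝓝[≠] a] fun w => -c / (w - a) ^ 2 + β w

theorem HasResidueFreeDoublePole.of_eventually_eq_add {D D' Y : ℂ → ℂ} {a : ℂ}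
    (hD : HasResidueFreeDoublePole D a) (hY : AnalyticAt ℂ Y a)
    (h : D' =ᶠ[𝓝[≠] a] fun w => D w + Y w) : HasResidueFreeDoublePole D' a := by
  obtain ⟨c, β, hc, hβ, hDβ⟩ := hD
  refine ⟨c, fun w => β w + Y w, hc, hβ.add hY, ?_⟩
  filter_upwards [h, hDβ] with w hw hDw
  rw [hw, hDw, add_assoc]

namespace IsLocUnivAt

variable {F : ℂ → OnePoint ℂ} {z : ℂ}

theorem analyticAt_finiteValue (hF : IsLocUnivAt F z) (hz : F z ≠ ∞) :
    AnalyticAt ℂ (finiteValue F) z ∧ deriv (finiteValue F) z ≠ 0 := by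
  obtain ⟨g, hg, hg', h⟩ := hF.exists_eventuallyEq_coe hz
  have heq : finiteValue F =ᶠ[𝓝 z] g := h.mono fun w hw => finiteValue_of_eq_coe hw
  exact ⟨hg.congr heq.symm, by rwa [heq.deriv_eq]⟩

theorem hasResidueFreeDoublePole_deriv_finiteValue (hF : IsLocUnivAt F z) (hz : F z = ∞) :
    HasResidueFreeDoublePole (deriv (finiteValue F)) z := by
  obtain ⟨c, β, hc, hβ, h⟩ := hF.exists_eventually_eq_polar hz
  refine ⟨c, deriv β, hc, hβ.deriv, ?_⟩
  have heq : finiteValue F =ᶠ[𝓝[≠] z] fun w => c / (w - z) + β w :=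
    h.mono fun w hw => finiteValue_of_eq_coe hw
  filter_upwards [heq.nhdsNE_deriv, hβ.eventually_analyticAt.filter_mono nhdsWithin_le_nhds,
    self_mem_nhdsWithin] with w hw hβw hwz
  have hinv := (((hasDerivAt_id w).sub_const z).fun_inv (sub_ne_zero.2 hwz)).const_mul c
  have hderiv : HasDerivAt (fun w => c / (w - z) + β w) (-c / (w - z) ^ 2 + deriv β w) w :=
    (hinv.add hβw.differentiableAt.hasDerivAt).congr_deriv (by simp only [id]; ring)
  rw [hw, hderiv.deriv]

theorem exists_analyticAt_deriv_finiteValue_mul_sq (hF : IsLocUnivAt F z) {p : ℂ → ℂ}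
    (hp : AnalyticAt ℂ p z) (hp0 : p z = 0 ↔ F z = ∞) (hp' : p z = 0 → deriv p z ≠ 0) :
    ∃ e : ℂ → ℂ, AnalyticAt ℂ e z ∧ e z ≠ 0 ∧
      (fun w => deriv (finiteValue F) w * p w ^ 2) =ᶠ[𝓝[≠] z] e := by
  by_cases hz : F z = ∞
  · obtain ⟨c, β, hc, hβ, hev⟩ := hF.hasResidueFreeDoublePole_deriv_finiteValue hz
    obtain ⟨k, hk, hkz, hpk⟩ := exists_analyticAt_eq_add_sub_mul hp
    have hpz : p z = 0 := hp0.2 hz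
    refine ⟨fun w => -c * k w ^ 2 + β w * p w ^ 2, by fun_prop, ?_, ?_⟩
    · simpa [hpz, hkz, hc] using hp' hpz
    · filter_upwards [hev, self_mem_nhdsWithin] with w hw hwz
      have hwz' : w - z ≠ 0 := sub_ne_zero.2 hwz
      rw [hw, hpk w, hpz, zero_add]
      field_simp
  · obtain ⟨hFan, hF'⟩ := hF.analyticAt_finiteValue hz
    exact ⟨_, hFan.deriv.mul (hp.pow 2), mul_ne_zero hF' (pow_ne_zero 2 (mt hp0.1 hz)),
      EventuallyEq.rfl⟩

end IsLocUnivAt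

section ExpDivSq

variable {F : ℂ → OnePoint ℂ} {p : ℂ → ℂ}

theorem exists_hasDerivAt_exp_div_sq {V : Set ℂ} (hV : IsOpen V) (hsc : IsSimplyConnected V)
    (hF : ∀ z ∈ V, IsLocUnivAt F z) (hp : DifferentiableOn ℂ p V)
    (hp0 : ∀ z ∈ V, p z = 0 ↔ F z = ∞) (hp' : ∀ z ∈ V, p z = 0 → deriv p z ≠ 0) :
    ∃ h : ℂ → ℂ, DifferentiableOn ℂ h V ∧ ∀ z ∈ V, F z ≠ ∞ →
      HasDerivAt (finiteValue F) (Complex.exp (-2 * h z) / p z ^ 2) z := by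
  have hpan : ∀ z ∈ V, AnalyticAt ℂ p z := fun z hz => hp.analyticAt (hV.mem_nhds hz)
  have hloc := fun z hz => (hF z hz).exists_analyticAt_deriv_finiteValue_mul_sq (hpan z hz)
    (hp0 z hz) (hp' z hz)
  obtain ⟨G, hGV, hG⟩ := exists_differentiableOn_eventuallyEq fun z hz =>
    let ⟨e, he, _, hE⟩ := hloc z hz
    ⟨e, he, hE⟩
  obtain ⟨l, hl, hexp⟩ := exists_differentiableOn_exp_eq hV hsc hGV fun z hz => by
    obtain ⟨e, he, he0, hE⟩ := hloc z hz
    rwa [hG z e he hE]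
  refine ⟨fun z => -(l z) / 2, hl.neg.div_const 2, fun z hz hFz => ?_⟩
  have hpz : p z ≠ 0 := mt (hp0 z hz).1 hFz
  have hFan := ((hF z hz).analyticAt_finiteValue hFz).1
  refine hFan.differentiableAt.hasDerivAt.congr_deriv ?_
  rw [show -2 * (-(l z) / 2) = l z by ring, hexp z hz,
    hG z _ (hFan.deriv.mul ((hpan z hz).pow 2)) EventuallyEq.rfl]
  simp [hpz]

theorem exists_hasDerivAt_exp_div_sq_union {V₁ V₂ : Set ℂ} (hV₁ : IsOpen V₁) (hV₂ : IsOpen V₂)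
    (hsc₁ : IsSimplyConnected V₁) (hsc₂ : IsSimplyConnected V₂) (hdisj : Disjoint V₁ V₂)
    (hF : ∀ z ∈ V₁ ∪ V₂, IsLocUnivAt F z) (hp : DifferentiableOn ℂ p (V₁ ∪ V₂))
    (hp0 : ∀ z ∈ V₁ ∪ V₂, p z = 0 ↔ F z = ∞) (hp' : ∀ z ∈ V₁ ∪ V₂, p z = 0 → deriv p z ≠ 0) :
    ∃ h : ℂ → ℂ, DifferentiableOn ℂ h (V₁ ∪ V₂) ∧ ∀ z ∈ V₁ ∪ V₂, F z ≠ ∞ →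
      HasDerivAt (finiteValue F) (Complex.exp (-2 * h z) / p z ^ 2) z := by
  classical
  simp only [union_def, mem_ofPred_eq, or_imp, forall_and] at hF hp0 hp'
  obtain ⟨h₁, hd₁, hh₁⟩ := exists_hasDerivAt_exp_div_sq hV₁ hsc₁ hF.1
    (hp.mono subset_union_left) hp0.1 hp'.1
  obtain ⟨h₂, hd₂, hh₂⟩ := exists_hasDerivAt_exp_div_sq hV₂ hsc₂ hF.2
    (hp.mono subset_union_right) hp0.2 hp'.2
  have heq₁ : ∀ z ∈ V₁, V₁.piecewise h₁ h₂ z = h₁ z := fun z => piecewise_eq_of_mem _ _ _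
  have heq₂ : ∀ z ∈ V₂, V₁.piecewise h₁ h₂ z = h₂ z := fun z hz =>
    piecewise_eq_of_notMem _ _ _ (disjoint_right.1 hdisj hz)
  refine ⟨V₁.piecewise h₁ h₂, (hd₁.congr heq₁).union_of_isOpen (hd₂.congr heq₂) hV₁ hV₂, ?_⟩
  rintro z (hz | hz) hFz
  · rw [heq₁ z hz]
    exact hh₁ z hz hFz
  · rw [heq₂ z hz]
    exact hh₂ z hz hFz

end ExpDivSq

section PolarSum

variable {c : ℂ → ℂ} {T : Finset ℂ}

theorem hasDerivAt_sum_div_sub {z : ℂ} (hz : z ∉ T) :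
    HasDerivAt (fun w => ∑ a ∈ T, c a / (w - a)) (-∑ a ∈ T, c a / (z - a) ^ 2) z := by
  rw [← Finset.sum_neg_distrib]
  refine HasDerivAt.fun_sum fun a ha => ?_
  have hza : z - a ≠ 0 := sub_ne_zero.2 fun h => hz (h ▸ ha)
  refine ((((hasDerivAt_id z).sub_const a).fun_inv hza).const_mul (c a)).congr_deriv ?_
  simp only [id]
  ring

theorem analyticAt_sum_div_sub_pow (n : ℕ) {z : ℂ} (hz : z ∉ T) :
    AnalyticAt ℂ (fun w => ∑ a ∈ T, c a / (w - a) ^ n) z :=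
  Finset.analyticAt_fun_sum _ fun a ha => analyticAt_const.div (by fun_prop)
    (pow_ne_zero n (sub_ne_zero.2 fun h => hz (h ▸ ha)))

theorem exists_hasDerivAt_add_sum {D : ℂ → ℂ} (hD : ∀ z ∉ T, AnalyticAt ℂ D z)
    (hT : ∀ a ∈ T, ∃ β : ℂ → ℂ, AnalyticAt ℂ β a ∧
      D =ᶠ[𝓝[≠] a] fun w => -c a / (w - a) ^ 2 + β w) (x v : ℂ) :
    ∃ G : ℂ → ℂ, Differentiable ℂ G ∧ G x + ∑ a ∈ T, c a / (x - a) = v ∧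
      ∀ z ∉ T, HasDerivAt (fun w => G w + ∑ a ∈ T, c a / (w - a)) (D z) z := by
  classical
  obtain ⟨g, hgd, hg⟩ := exists_differentiableOn_eventuallyEq (V := univ)
    (E := fun w => D w + ∑ a ∈ T, c a / (w - a) ^ 2) fun z _ => by
      by_cases hz : z ∈ T
      · obtain ⟨β, hβ, hev⟩ := hT z hz
        refine ⟨_, hβ.add (analyticAt_sum_div_sub_pow (c := c) 2 (Finset.notMem_erase z T)), ?_⟩
        filter_upwards [hev] with w hw
        rw [hw, ← Finset.add_sum_erase T _ hz, Pi.add_apply]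
        ring
      · exact ⟨_, (hD z hz).add (analyticAt_sum_div_sub_pow 2 hz), EventuallyEq.rfl⟩
  obtain ⟨G, hGx, hG⟩ := (differentiableOn_univ.1 hgd).isExactOn_univ.with_val_at x
    (v - ∑ a ∈ T, c a / (x - a))
  refine ⟨G, fun z => (hG z trivial).differentiableAt, by rw [hGx, sub_add_cancel],
    fun z hz => ((hG z trivial).add (hasDerivAt_sum_div_sub hz)).congr_deriv ?_⟩
  rw [hg z _ ((hD z hz).add (analyticAt_sum_div_sub_pow 2 hz)) EventuallyEq.rfl, Pi.add_apply,
    add_neg_cancel_right]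

theorem isLocUnivAt_ite_add_sum {G : ℂ → ℂ} (hG : Differentiable ℂ G) (hc : ∀ a ∈ T, c a ≠ 0)
    (hG' : ∀ z ∉ T, deriv (fun w => G w + ∑ a ∈ T, c a / (w - a)) z ≠ 0) [DecidableEq ℂ] (z : ℂ) :
    IsLocUnivAt (fun z => if z ∈ T then ∞ else ((G z + ∑ a ∈ T, c a / (z - a) : ℂ) : OnePoint ℂ))
      z := by
  have hsum : ∀ (S : Finset ℂ) (z : ℂ), z ∉ S →
      AnalyticAt ℂ (fun w => G w + ∑ a ∈ S, c a / (w - a)) z := fun S z hz => by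
    simpa only [pow_one] using (hG.analyticAt z).fun_add (analyticAt_sum_div_sub_pow (c := c) 1 hz)
  have hnhds : ∀ (S : Finset ℂ) (z : ℂ), z ∉ S → ∀ᶠ w in 𝓝 z, w ∉ S := fun S z hz =>
    S.finite_toSet.isClosed.isOpen_compl.mem_nhds hz
  by_cases hz : z ∈ T
  · refine isLocUnivAt_of_eventually_eq_polar (if_pos hz) (hc z hz)
      (hsum _ z (Finset.notMem_erase z T)) ?_
    filter_upwards [nhdsWithin_le_nhds (hnhds _ z (Finset.notMem_erase z T)),
      self_mem_nhdsWithin] with w hw hwz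
    rw [if_neg fun h => hw (Finset.mem_erase.2 ⟨hwz, h⟩), ← Finset.add_sum_erase T _ hz]
    congr 1
    ring
  · exact (isLocUnivAt_coe (hsum T z hz) (hG' z hz)).congr
      ((hnhds T z hz).mono fun w hw => (if_neg hw).symm)

theorem exists_isLocUnivAt_hasDerivAt {D : ℂ → ℂ} (hD : ∀ z ∉ T, AnalyticAt ℂ D z ∧ D z ≠ 0)
    (hT : ∀ a ∈ T, HasResidueFreeDoublePole D a) {x : ℂ} (hx : x ∉ T) (v : ℂ) :
    ∃ F : ℂ → OnePoint ℂ, (∀ z, IsLocUnivAt F z) ∧ (∀ z, F z = ∞ ↔ z ∈ T) ∧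
      (∀ z ∉ T, HasDerivAt (finiteValue F) (D z) z) ∧ finiteValue F x = v := by
  classical
  choose! c hc using hT
  obtain ⟨G, hG, hGx, hGD⟩ := exists_hasDerivAt_add_sum (fun z hz => (hD z hz).1)
    (fun a ha => let ⟨β, _, h⟩ := hc a ha; ⟨β, h⟩) x v
  refine ⟨fun z => if z ∈ T then ∞ else ((G z + ∑ a ∈ T, c a / (z - a) : ℂ) : OnePoint ℂ),
    isLocUnivAt_ite_add_sum hG (fun a ha => let ⟨_, h, _⟩ := hc a ha; h)
      fun z hz => by simpa only [(hGD z hz).deriv] using (hD z hz).2,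
    fun z => by simp, fun z hz => (hGD z hz).congr_of_eventuallyEq ?_, ?_⟩
  · filter_upwards [T.finite_toSet.isClosed.isOpen_compl.mem_nhds hz] with w hw
    exact finiteValue_of_eq_coe (if_neg hw)
  · rw [finiteValue_of_eq_coe (if_neg hx), hGx]

end PolarSum

/-! ### Approximation on two disjoint conformal discs -/

theorem exists_eq_eval_add_eval_mul {V : Set ℂ} (hV : IsOpen V) {h : ℂ → ℂ}
    (hh : DifferentiableOn ℂ h V) {P : ℂ[X]} (hP : P ≠ 0) (hPV : ∀ a, P.IsRoot a → a ∈ V) :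
    ∃ (q : ℂ[X]) (k : ℂ → ℂ), DifferentiableOn ℂ k V ∧
      ∀ z, h z = q.eval z + P.eval z * k z := by
  suffices hprod : ∀ s : Multiset ℂ, (∀ a ∈ s, a ∈ V) → ∃ (q : ℂ[X]) (k : ℂ → ℂ),
      DifferentiableOn ℂ k V ∧ ∀ z, h z = q.eval z + (s.map fun a => X - C a).prod.eval z * k z by
    obtain ⟨q, k, hk, hq⟩ := hprod P.roots fun a ha => hPV a (isRoot_of_mem_roots ha)
    refine ⟨q, fun z => P.leadingCoeff⁻¹ * k z, hk.const_mul _, fun z => ?_⟩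
    have hlc : P.leadingCoeff ≠ 0 := leadingCoeff_ne_zero.2 hP
    conv_rhs => rw [(IsAlgClosed.splits P).eq_prod_roots]
    rw [hq z, eval_mul, eval_C, leadingCoeff_mul, leadingCoeff_C,
      monic_multisetProd_X_sub_C, mul_one]
    field_simp
  intro s
  induction s using Multiset.induction_on with
  | empty => exact fun _ => ⟨0, h, hh, fun z => by simp⟩
  | cons a s ih =>
    intro hs
    obtain ⟨q, k, hk, hq⟩ := ih fun b hb => hs b (Multiset.mem_cons_of_mem hb)
    refine ⟨q + (s.map fun a => X - C a).prod * C (k a), dslope k a,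
      (Complex.differentiableOn_dslope (hV.mem_nhds (hs a (Multiset.mem_cons_self a s)))).2 hk,
      fun z => ?_⟩
    have hslope : (z - a) * dslope k a z = k z - k a := sub_smul_dslope k a z
    rw [hq z, Multiset.map_cons, Multiset.prod_cons]
    simp only [eval_add, eval_mul, eval_sub, eval_X, eval_C]
    linear_combination (-((s.map fun a => X - C a).prod.eval z)) * hslope

section Perturbation

variable {A V : Set ℂ} {h p : ℂ → ℂ} {η : ℝ}

theorem differentiable_dslope_exp_zero : Differentiable ℂ (dslope Complex.exp 0) :=
  differentiableOn_univ.1 ((Complex.differentiableOn_dslope univ_mem).2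
    Complex.differentiable_exp.differentiableOn)

theorem exp_add_sq_mul_div_sq (h p e : ℂ) (hp : p ≠ 0) :
    Complex.exp (-2 * (h + p ^ 2 * e)) / p ^ 2 = Complex.exp (-2 * h) / p ^ 2 +
      Complex.exp (-2 * h) * (-2 * e) * dslope Complex.exp 0 (-2 * (p ^ 2 * e)) := by
  have hslope : -2 * (p ^ 2 * e) * dslope Complex.exp 0 (-2 * (p ^ 2 * e)) =
      Complex.exp (-2 * (p ^ 2 * e)) - 1 := by
    simpa only [sub_zero, smul_eq_mul, Complex.exp_zero] using
      sub_smul_dslope Complex.exp 0 (-2 * (p ^ 2 * e))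
  have hp2 : p ^ 2 ≠ 0 := pow_ne_zero 2 hp
  rw [mul_add, Complex.exp_add, div_eq_iff hp2, add_mul, div_mul_cancel₀ _ hp2]
  linear_combination (-Complex.exp (-2 * h)) * hslope

theorem exists_forall_norm_lt_exp_div_sq_eq_add (hA : IsCompact A) (hV : IsOpen V) (hAV : A ⊆ V)
    (hh : DifferentiableOn ℂ h V) (hp : DifferentiableOn ℂ p V) (hη : 0 < η) :
    ∃ δ > 0, ∀ e : ℂ → ℂ, DifferentiableOn ℂ e V → (∀ z ∈ A, ‖e z‖ < δ) →
      ∃ Y : ℂ → ℂ, DifferentiableOn ℂ Y V ∧ (∀ z ∈ A, ‖Y z‖ < η) ∧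
        ∀ z, p z ≠ 0 → Complex.exp (-2 * (h z + p z ^ 2 * e z)) / p z ^ 2 =
          Complex.exp (-2 * h z) / p z ^ 2 + Y z := by
  have hsmall : ∀ᶠ v : ℂ in 𝓝 0, ∀ z ∈ A, ‖Complex.exp (-2 * h z) * (-2 * v) *
      dslope Complex.exp 0 (-2 * (p z ^ 2 * v))‖ < η := by
    refine hA.eventually_forall_of_forall_eventually fun z hz => ?_
    have hnhds : V ∈ 𝓝 z := hV.mem_nhds (hAV hz)
    have hhz : ContinuousAt h z := hh.continuousOn.continuousAt hnhds
    have hpz : ContinuousAt p z := hp.continuousOn.continuousAt hnhds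
    have hslope := differentiable_dslope_exp_zero.continuous
    exact ContinuousAt.eventually_lt (by fun_prop) continuousAt_const (by simpa using hη)
  obtain ⟨δ, hδ, hδη⟩ := Metric.eventually_nhds_iff.1 hsmall
  refine ⟨δ, hδ, fun e he heA => ⟨fun z => Complex.exp (-2 * h z) * (-2 * e z) *
    dslope Complex.exp 0 (-2 * (p z ^ 2 * e z)), ?_, fun z hz => hδη (by simpa using heA z hz) z hz,
    fun z => exp_add_sq_mul_div_sq (h z) (p z) (e z)⟩⟩
  have hslope := differentiable_dslope_exp_zero.comp_differentiableOn
    (((hp.pow 2).mul he).const_mul (-2))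
  exact ((hh.const_mul (-2)).cexp.mul (he.const_mul (-2))).mul hslope

end Perturbation

theorem isPreconnected_ball_sdiff_countable {E : Type*} [NormedAddCommGroup E]
    [InnerProductSpace ℝ E] (hE : 1 < Module.rank ℝ E) (x : E) {r : ℝ} (hr : 0 < r) {S : Set E}
    (hS : S.Countable) : IsPreconnected (ball x r \ S) := by
  have hsource := OpenPartialHomeomorph.univBall_source x r
  have hinj : Function.Injective (OpenPartialHomeomorph.univBall x r) := by
    simpa only [hsource, injOn_univ] using (OpenPartialHomeomorph.univBall x r).injOn
  have hrange : range (OpenPartialHomeomorph.univBall x r) = ball x r := by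
    rw [← image_univ, ← hsource, OpenPartialHomeomorph.image_source_eq_target,
      OpenPartialHomeomorph.univBall_target x hr]
  rw [← hrange, ← image_compl_preimage]
  exact ((hS.preimage hinj).isConnected_compl_of_one_lt_rank hE).isPreconnected.image _
    (OpenPartialHomeomorph.continuous_univBall x r).continuousOn

theorem norm_sub_le_of_hasDerivAt_ball_sdiff_finite {c : ℂ} {ρ R : ℝ} (hρR : ρ < R) {S : Set ℂ}
    (hS : S.Finite) {f g : ℂ → ℂ} (hg : DifferentiableOn ℂ g (ball c R))
    (hf : ∀ z ∈ ball c R \ S, HasDerivAt f (g z) z) {η : ℝ}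
    (hη : ∀ z ∈ closedBall c ρ, ‖g z‖ ≤ η) {z w : ℂ} (hz : z ∈ closedBall c ρ \ S)
    (hw : w ∈ closedBall c ρ \ S) : ‖f z - f w‖ ≤ η * ‖z - w‖ := by
  have hsub : closedBall c ρ ⊆ ball c R := closedBall_subset_ball hρR
  obtain ⟨G, hG⟩ := hg.isExactOn_ball
  obtain ⟨K, hK⟩ := (isOpen_ball.sdiff hS.isClosed).exists_eq_add_of_deriv_eq
    (isPreconnected_ball_sdiff_countable (by simp [Complex.rank_real_complex]) c
      (pos_of_mem_ball (hsub hz.1)) hS.countable)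
    (fun v hv => (hf v hv).differentiableAt.differentiableWithinAt)
    (fun v hv => (hG v hv.1).differentiableAt.differentiableWithinAt)
    (fun v hv => by rw [(hf v hv).deriv, (hG v hv.1).deriv])
  rw [hK ⟨hsub hz.1, hz.2⟩, hK ⟨hsub hw.1, hw.2⟩, add_sub_add_right_eq_sub]
  exact (convex_closedBall c ρ).norm_image_sub_le_of_norm_hasDerivWithin_le
    (fun v hv => (hG v (hsub hv)).hasDerivWithinAt) hη hw.1 hz.1

theorem IsConformalEmbedding.exists_forall_norm_sub_lt {θ : ℂ → ℂ} {ρ R ε : ℝ}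
    (hθ : IsConformalEmbedding θ (ball 0 R)) (hρ : 0 < ρ) (hρR : ρ < R) (hε : 0 < ε) :
    ∃ η > 0, ∀ (T : Finset ℂ) (f Y : ℂ → ℂ), DifferentiableOn ℂ Y (θ '' ball 0 R) →
      (∀ z ∈ θ '' ball 0 R, z ∉ T → HasDerivAt f (Y z) z) →
      (∀ z ∈ θ '' closedBall 0 ρ, ‖Y z‖ < η) →
      ∀ z ∈ θ '' closedBall 0 ρ, z ∉ T → ∀ w ∈ θ '' closedBall 0 ρ, w ∉ T → ‖f z - f w‖ < ε := by
  have hsub : closedBall (0 : ℂ) ρ ⊆ ball 0 R := closedBall_subset_ball hρR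
  obtain ⟨N, hN⟩ := (isCompact_closedBall (0 : ℂ) ρ).exists_bound_of_continuousOn
    ((hθ.differentiableOn.deriv isOpen_ball).continuousOn.mono hsub)
  have hN0 : 0 ≤ N := (norm_nonneg _).trans (hN 0 (mem_closedBall_self hρ.le))
  refine ⟨ε / ((N + 1) * (2 * ρ)), by positivity, fun T f Y hY hf hYη => ?_⟩
  rintro _ ⟨z, hz, rfl⟩ hzT _ ⟨w, hw, rfl⟩ hwT
  have hfinite : (ball 0 R ∩ θ ⁻¹' (T : Set ℂ)).Finite :=
    Finite.of_finite_image (T.finite_toSet.subset (image_subset_iff.2 inter_subset_right))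
      (hθ.injOn.mono inter_subset_left)
  have hderiv : ∀ v ∈ ball 0 R \ (ball 0 R ∩ θ ⁻¹' (T : Set ℂ)),
      HasDerivAt (f ∘ θ) (Y (θ v) * deriv θ v) v := fun v hv =>
    (hf _ (mem_image_of_mem θ hv.1) fun h => hv.2 ⟨hv.1, h⟩).comp v (hθ.hasDerivAt hv.1)
  have hbound : ∀ v ∈ closedBall (0 : ℂ) ρ, ‖Y (θ v) * deriv θ v‖ ≤ ε / ((N + 1) * (2 * ρ)) * N :=
    fun v hv => (norm_mul_le _ _).trans (mul_le_mul (hYη _ (mem_image_of_mem θ hv)).le (hN v hv)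
      (norm_nonneg _) (by positivity))
  calc ‖f (θ z) - f (θ w)‖
      ≤ ε / ((N + 1) * (2 * ρ)) * N * ‖z - w‖ :=
        norm_sub_le_of_hasDerivAt_ball_sdiff_finite hρR hfinite
          ((hY.comp hθ.differentiableOn (mapsTo_image θ _)).mul
            (hθ.differentiableOn.deriv isOpen_ball)) hderiv hbound
          ⟨hz, fun h => hzT h.2⟩ ⟨hw, fun h => hwT h.2⟩
    _ ≤ ε / ((N + 1) * (2 * ρ)) * N * (2 * ρ) := by
        gcongr
        linarith [norm_sub_le z w, mem_closedBall_zero_iff.1 hz, mem_closedBall_zero_iff.1 hw]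
    _ < ε := by
        rw [div_mul_eq_mul_div, div_mul_eq_mul_div, div_lt_iff₀ (by positivity)]
        nlinarith

theorem exists_inter_segment_eq_singleton {E : Type*} [NormedAddCommGroup E] [NormedSpace ℝ E]
    {A B : Set E} (hA : IsCompact A) (hB : IsCompact B) (hA0 : A.Nonempty) (hB0 : B.Nonempty) :
    ∃ x y, A ∩ segment ℝ x y = {x} ∧ B ∩ segment ℝ x y = {y} := by
  obtain ⟨⟨x, y⟩, ⟨hx, hy⟩, hmin⟩ := (hA.prod hB).exists_isMinOn (hA0.prod hB0)
    (f := fun p : E × E => dist p.1 p.2) (by fun_prop)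
  refine ⟨x, y, Subset.antisymm ?_ (singleton_subset_iff.2 ⟨hx, left_mem_segment ℝ x y⟩),
    Subset.antisymm ?_ (singleton_subset_iff.2 ⟨hy, right_mem_segment ℝ x y⟩)⟩
  · rintro z ⟨hzA, hz⟩
    have hle : dist x y ≤ dist z y := hmin (mk_mem_prod hzA hy)
    have hdist : dist x z ≤ 0 := by linarith [dist_add_dist_of_mem_segment hz]
    exact (dist_le_zero.1 hdist).symm
  · rintro z ⟨hzB, hz⟩
    have hle : dist x y ≤ dist x z := hmin (mk_mem_prod hx hzB)
    have hdist : dist z y ≤ 0 := by linarith [dist_add_dist_of_mem_segment hz]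
    exact dist_le_zero.1 hdist

theorem notMem_interior_of_inter_segment_eq_singleton {E : Type*} [NormedAddCommGroup E]
    [NormedSpace ℝ E] {A : Set E} {x y z : E} (hxy : x ≠ y) (h : A ∩ segment ℝ x y = {x})
    (hz : z ∈ segment ℝ x y) : z ∉ interior A := by
  intro hzA
  obtain rfl : z = x := by
    rw [← mem_singleton_iff, ← h]
    exact ⟨interior_subset hzA, hz⟩
  have hlim : Tendsto (fun t : ℝ => AffineMap.lineMap z y t) (𝓝[>] (0 : ℝ)) (𝓝 z) := by
    have := (AffineMap.lineMap_continuous (p := z) (q := y) (R := ℝ)).tendsto 0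
    rw [AffineMap.lineMap_apply_zero] at this
    exact this.mono_left nhdsWithin_le_nhds
  obtain ⟨t, htA, ht⟩ := ((hlim.eventually (mem_interior_iff_mem_nhds.1 hzA)).and
    (Ioo_mem_nhdsGT zero_lt_one)).exists
  have htz : AffineMap.lineMap z y t ∈ ({z} : Set E) :=
    h ▸ ⟨htA, lineMap_mem_segment z y (Ioo_subset_Icc_self ht)⟩
  rw [mem_singleton_iff, AffineMap.lineMap_eq_left_iff] at htz
  exact htz.elim hxy ht.1.ne'

theorem exists_segment_inter_eq_singleton {E : Type*} [NormedAddCommGroup E] [NormedSpace ℝ E]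
    {A B : Set E} (hA : IsCompact A) (hB : IsCompact B) (hA0 : A.Nonempty) (hB0 : B.Nonempty)
    (hdisj : Disjoint A B) :
    ∃ x y, A ∩ segment ℝ x y = {x} ∧ B ∩ segment ℝ x y = {y} ∧
      ∀ z ∈ segment ℝ x y, z ∉ interior A ∧ z ∉ interior B := by
  obtain ⟨x, y, hx, hy⟩ := exists_inter_segment_eq_singleton hA hB hA0 hB0
  have hxy : x ≠ y := hdisj.ne_of_mem (hx.ge rfl).1 (hy.ge rfl).1
  refine ⟨x, y, hx, hy, fun z hz => ⟨notMem_interior_of_inter_segment_eq_singleton hxy hx hz, ?_⟩⟩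
  rw [segment_symm] at hy hz
  exact notMem_interior_of_inter_segment_eq_singleton hxy.symm hy hz

section TwoCompacts

variable {A₁ A₂ V : Set ℂ} {x y : ℂ} {P : ℂ[X]} {h : ℂ → ℂ} {η : ℝ}

theorem exists_exp_div_sq_eq_add_norm_segmentIntegral_sub_lt (hA₁ : IsCompact A₁)
    (hA₂ : IsCompact A₂) (hV : IsOpen V) (hAV : A₁ ∪ A₂ ⊆ V) (hdisj : Disjoint A₁ A₂)
    (hlog₁ : ∀ a ∉ A₁, HasLogOn A₁ a) (hlog₂ : ∀ a ∉ A₂, HasLogOn A₂ a)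
    (hx : A₁ ∩ segment ℝ x y = {x}) (hy : A₂ ∩ segment ℝ x y = {y})
    (hh : DifferentiableOn ℂ h V) (hP : ∀ z ∈ segment ℝ x y, P.eval z ≠ 0)
    (hPV : ∀ a, P.IsRoot a → a ∈ V) (c : ℂ) (hη : 0 < η) :
    ∃ (r : ℂ[X]) (Y : ℂ → ℂ), DifferentiableOn ℂ Y V ∧ (∀ z ∈ A₁ ∪ A₂, ‖Y z‖ < η) ∧
      (∀ z, P.eval z ≠ 0 → Complex.exp (-2 * r.eval z) / P.eval z ^ 2 =
        Complex.exp (-2 * h z) / P.eval z ^ 2 + Y z) ∧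
      ‖segmentIntegral (fun z => Complex.exp (-2 * r.eval z) / P.eval z ^ 2) x y - c‖ < η := by
  have hP0 : P ≠ 0 := fun h0 => hP x (left_mem_segment ℝ x y) (by rw [h0, eval_zero])
  obtain ⟨q, k, hk, hqk⟩ := exists_eq_eval_add_eval_mul hV hh (pow_ne_zero 2 hP0) fun a ha =>
    hPV a (eq_zero_of_pow_eq_zero ((eval_pow 2).symm.trans ha))
  obtain ⟨δ, hδ, hδη⟩ := exists_forall_norm_lt_exp_div_sq_eq_add (hA₁.union hA₂) hV hAV hh
    (P.differentiable.differentiableOn (s := V)) hη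
  obtain ⟨u, huk, hu⟩ := exists_polynomial_norm_sub_lt_norm_segmentIntegral_sub_lt hA₁ hA₂ hV hAV
    hdisj hk hlog₁ hlog₂ hx hy P q hP c (lt_min hδ hη)
  obtain ⟨Y, hY, hYη, hYeq⟩ := hδη (fun z => u.eval z - k z)
    (u.differentiable.differentiableOn.sub hk) fun z hz => (huk z hz).trans_le (min_le_left _ _)
  refine ⟨q + P ^ 2 * u, Y, hY, hYη, fun z hz => ?_, ?_⟩
  · rw [← hYeq z hz, hqk z, eval_pow, eval_add, eval_mul, eval_pow]
    congr 3
    ring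
  · simpa only [eval_add, eval_mul, eval_pow] using hu.trans_le (min_le_right _ _)

theorem exists_isLocUnivAt_hasDerivAt_finiteValue_sub (hA₁ : IsCompact A₁) (hA₂ : IsCompact A₂)
    (hV : IsOpen V) (hAV : A₁ ∪ A₂ ⊆ V) (hdisj : Disjoint A₁ A₂)
    (hlog₁ : ∀ a ∉ A₁, HasLogOn A₁ a) (hlog₂ : ∀ a ∉ A₂, HasLogOn A₂ a)
    (hx : A₁ ∩ segment ℝ x y = {x}) (hy : A₂ ∩ segment ℝ x y = {y}) {H : ℂ → OnePoint ℂ}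
    (hH : ∀ z ∈ V, IsLocUnivAt H z) (hPH : ∀ z ∈ V, P.IsRoot z ↔ H z = ∞)
    (hP : ∀ z ∈ segment ℝ x y, P.eval z ≠ 0) (hPV : ∀ a, P.IsRoot a → a ∈ V)
    (hh : DifferentiableOn ℂ h V) (hhH : ∀ z ∈ V, H z ≠ ∞ →
      HasDerivAt (finiteValue H) (Complex.exp (-2 * h z) / P.eval z ^ 2) z) (hη : 0 < η) :
    ∃ (F : ℂ → OnePoint ℂ) (Y : ℂ → ℂ), (∀ z, IsLocUnivAt F z) ∧ (∀ z, F z = ∞ ↔ P.IsRoot z) ∧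
      DifferentiableOn ℂ Y V ∧ (∀ z ∈ A₁ ∪ A₂, ‖Y z‖ < η) ∧
      (∀ z ∈ V, ¬ P.IsRoot z →
        HasDerivAt (fun w => finiteValue F w - finiteValue H w) (Y z) z) ∧
      finiteValue F x = finiteValue H x ∧ ‖finiteValue F y - finiteValue H y‖ < η := by
  have hP0 : P ≠ 0 := fun h0 => hP x (left_mem_segment ℝ x y) (by rw [h0, eval_zero])
  have hroots : ∀ z, z ∈ P.roots.toFinset ↔ P.IsRoot z := fun z => by
    rw [Multiset.mem_toFinset, mem_roots hP0]
  obtain ⟨r, Y, hY, hYη, hYeq, hr⟩ := exists_exp_div_sq_eq_add_norm_segmentIntegral_sub_lt hA₁ hA₂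
    hV hAV hdisj hlog₁ hlog₂ hx hy hh hP hPV (finiteValue H y - finiteValue H x) hη
  set D : ℂ → ℂ := fun z => Complex.exp (-2 * r.eval z) / P.eval z ^ 2
  have hD : ∀ z ∉ P.roots.toFinset, AnalyticAt ℂ D z ∧ D z ≠ 0 := fun z hz => by
    have hPz : P.eval z ^ 2 ≠ 0 := pow_ne_zero 2 (mt (hroots z).2 hz)
    exact ⟨((r.differentiable.const_mul (-2)).cexp.analyticAt z).div
      ((P.differentiable.pow 2).analyticAt z) hPz, div_ne_zero (Complex.exp_ne_zero _) hPz⟩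
  have hpole : ∀ a ∈ P.roots.toFinset, HasResidueFreeDoublePole D a := fun a ha => by
    have haV : a ∈ V := hPV a ((hroots a).1 ha)
    refine ((hH a haV).hasResidueFreeDoublePole_deriv_finiteValue
      ((hPH a haV).1 ((hroots a).1 ha))).of_eventually_eq_add
      (hY.analyticAt (hV.mem_nhds haV)) ?_
    filter_upwards [nhdsWithin_le_nhds (hV.mem_nhds haV),
      nhdsNE_le_cofinite a P.roots.toFinset.finite_toSet.compl_mem_cofinite] with w hwV hw
    have hPw : ¬ P.IsRoot w := mt (hroots w).2 hw
    rw [(hhH w hwV (mt (hPH w hwV).2 hPw)).deriv]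
    exact hYeq w hPw
  have hseg : ∀ z ∈ segment ℝ x y, z ∉ P.roots.toFinset := fun z hz => mt (hroots z).1 (hP z hz)
  obtain ⟨F, hF, hFP, hFD, hFx⟩ := exists_isLocUnivAt_hasDerivAt hD hpole
    (hseg x (left_mem_segment ℝ x y)) (finiteValue H x)
  refine ⟨F, Y, hF, fun z => (hFP z).trans (hroots z), hY, hYη, fun z hz hPz => ?_, hFx, ?_⟩
  · refine ((hFD z (mt (hroots z).1 hPz)).sub (hhH z hz (mt (hPH z hz).2 hPz))).congr_deriv ?_
    exact sub_eq_of_eq_add' (hYeq z hPz)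
  · rw [segmentIntegral_eq_sub (fun z hz => hFD z (hseg z hz))
      fun z hz => (hD z (hseg z hz)).1.continuousAt.continuousWithinAt, hFx] at hr
    simpa only [sub_sub_sub_cancel_right] using hr

end TwoCompacts

section TwoDiscs

variable {θ₁ θ₂ : ℂ → ℂ} {ρ R ε : ℝ} {H : ℂ → OnePoint ℂ}

theorem IsConformalEmbedding.isCompact_image_closedBall {θ : ℂ → ℂ}
    (hθ : IsConformalEmbedding θ (ball 0 R)) (hρR : ρ < R) : IsCompact (θ '' closedBall 0 ρ) :=
  (isCompact_closedBall 0 ρ).image_of_continuousOn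
    (hθ.differentiableOn.continuousOn.mono (closedBall_subset_ball hρR))

theorem IsConformalEmbedding.image_ball_subset_interior {θ : ℂ → ℂ}
    (hθ : IsConformalEmbedding θ (ball 0 R)) (hρR : ρ < R) :
    θ '' ball 0 ρ ⊆ interior (θ '' closedBall 0 ρ) :=
  interior_maximal (image_mono ball_subset_closedBall)
    ((hθ.mono (ball_subset_ball hρR.le)).isOpen_image isOpen_ball)

theorem IsConformalEmbedding.hasLogOn_image_closedBall {θ : ℂ → ℂ}
    (hθ : IsConformalEmbedding θ (ball 0 R)) (hρ : 0 < ρ) (hρR : ρ < R) {a : ℂ}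
    (ha : a ∉ θ '' closedBall 0 ρ) : HasLogOn (θ '' closedBall 0 ρ) a :=
  have hsub : closedBall (0 : ℂ) ρ ⊆ ball 0 R := closedBall_subset_ball hρR
  HasLogOn.image_closedBall hρ (hθ.differentiableOn.continuousOn.mono hsub) (hθ.injOn.mono hsub) ha

theorem IsConformalEmbedding.exists_forall_dist_lt {θ : ℂ → ℂ}
    (hθ : IsConformalEmbedding θ (ball 0 R)) (hρ : 0 < ρ) (hρR : ρ < R) (hε : 0 < ε) :
    ∃ η > 0, ∀ (T : Finset ℂ) (F H : ℂ → OnePoint ℂ) (Y : ℂ → ℂ),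
      DifferentiableOn ℂ Y (θ '' ball 0 R) → (∀ z ∈ θ '' ball 0 R, z ∉ T →
        HasDerivAt (fun w => finiteValue F w - finiteValue H w) (Y z) z) →
      (∀ z ∈ θ '' closedBall 0 ρ, ‖Y z‖ < η) →
      (∀ z ∈ θ '' closedBall 0 ρ, (F z = ∞ ↔ z ∈ T) ∧ (H z = ∞ ↔ z ∈ T)) →
      ∀ x ∈ θ '' closedBall 0 ρ, x ∉ T → ‖finiteValue F x - finiteValue H x‖ < η →
        ∀ z ∈ θ '' closedBall 0 ρ, dist (F z) (H z) < ε := by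
  obtain ⟨η, hη, hclose⟩ := hθ.exists_forall_norm_sub_lt hρ hρR (half_pos hε)
  refine ⟨min η (ε / 2), lt_min hη (half_pos hε), ?_⟩
  intro T F H Y hY hFH hYη hT x hxA hxT hx z hz
  by_cases hzT : z ∈ T
  · rwa [(hT z hz).1.2 hzT, (hT z hz).2.2 hzT, dist_self]
  · have hzx := hclose T _ Y hY hFH (fun v hv => (hYη v hv).trans_le (min_le_left _ _))
      z hz hzT x hxA hxT
    rw [← coe_finiteValue (mt (hT z hz).1.1 hzT), ← coe_finiteValue (mt (hT z hz).2.1 hzT)]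
    refine (dist_coe_coe_le _ _).trans_lt ?_
    linarith [hx.trans_le (min_le_right _ _), norm_le_norm_add_norm_sub'
      (finiteValue F z - finiteValue H z) (finiteValue F x - finiteValue H x)]

theorem exists_segment_inter_image_closedBall_eq_singleton (hρ : 0 < ρ) (hρR : ρ < R)
    (h₁ : IsConformalEmbedding θ₁ (ball 0 R)) (h₂ : IsConformalEmbedding θ₂ (ball 0 R))
    (hdisj : Disjoint (θ₁ '' closedBall 0 ρ) (θ₂ '' closedBall 0 ρ)) :
    ∃ x y, θ₁ '' closedBall 0 ρ ∩ segment ℝ x y = {x} ∧ θ₂ '' closedBall 0 ρ ∩ segment ℝ x y = {y} ∧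
      Disjoint (segment ℝ x y) (θ₁ '' ball 0 ρ ∪ θ₂ '' ball 0 ρ) := by
  have hne : (closedBall (0 : ℂ) ρ).Nonempty := nonempty_closedBall.2 hρ.le
  obtain ⟨x, y, hx, hy, hinter⟩ := exists_segment_inter_eq_singleton
    (h₁.isCompact_image_closedBall hρR) (h₂.isCompact_image_closedBall hρR) (hne.image θ₁)
    (hne.image θ₂) hdisj
  exact ⟨x, y, hx, hy, disjoint_left.2 fun z hz hzA => hzA.elim
    (fun hzA => (hinter z hz).1 (h₁.image_ball_subset_interior hρR hzA))
    fun hzA => (hinter z hz).2 (h₂.image_ball_subset_interior hρR hzA)⟩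

theorem exists_polynomial_isRoot_iff_mem (T : Finset ℂ) :
    ∃ P : ℂ[X], (∀ z, P.IsRoot z ↔ z ∈ T) ∧ ∀ z, P.IsRoot z → deriv (fun w => P.eval w) z ≠ 0 := by
  refine ⟨∏ a ∈ T, (X - C a), fun z => ?_, fun z hz => ?_⟩
  · simp [IsRoot, eval_prod, Finset.prod_eq_zero_iff, sub_eq_zero]
  · rw [Polynomial.deriv]
    exact (separable_prod_X_sub_C_iff'.2 fun _ _ _ _ h => h).eval₂_derivative_ne_zero
      (RingHom.id ℂ) hz

theorem exists_polynomial_hasDerivAt_exp_div_sq {V₁ V₂ : Set ℂ} (hV₁ : IsOpen V₁) (hV₂ : IsOpen V₂)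
    (hsc₁ : IsSimplyConnected V₁) (hsc₂ : IsSimplyConnected V₂) (hdisj : Disjoint V₁ V₂)
    (hH : ∀ z ∈ V₁ ∪ V₂, IsLocUnivAt H z) {T : Finset ℂ} (hT : ∀ z ∈ V₁ ∪ V₂, H z = ∞ ↔ z ∈ T) :
    ∃ (P : ℂ[X]) (h : ℂ → ℂ), (∀ z, P.IsRoot z ↔ z ∈ T) ∧ DifferentiableOn ℂ h (V₁ ∪ V₂) ∧
      ∀ z ∈ V₁ ∪ V₂, H z ≠ ∞ →
        HasDerivAt (finiteValue H) (Complex.exp (-2 * h z) / P.eval z ^ 2) z := by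
  obtain ⟨P, hPT, hP'⟩ := exists_polynomial_isRoot_iff_mem T
  obtain ⟨h, hh, hhH⟩ := exists_hasDerivAt_exp_div_sq_union hV₁ hV₂ hsc₁ hsc₂ hdisj hH
    P.differentiable.differentiableOn (fun z hz => (hPT z).trans (hT z hz).symm) fun z _ => hP' z
  exact ⟨P, h, hPT, hh, hhH⟩

theorem exists_isLocUnivAt_dist_lt (hρ : 0 < ρ) (hρR : ρ < R)
    (h₁ : IsConformalEmbedding θ₁ (ball 0 R)) (h₂ : IsConformalEmbedding θ₂ (ball 0 R))
    (hdisj : Disjoint (θ₁ '' ball 0 R) (θ₂ '' ball 0 R))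
    (hH : ∀ z ∈ θ₁ '' ball 0 R ∪ θ₂ '' ball 0 R, IsLocUnivAt H z) {T : Finset ℂ}
    (hT : ∀ z ∈ θ₁ '' ball 0 R ∪ θ₂ '' ball 0 R, H z = ∞ ↔ z ∈ T)
    (hTρ : (T : Set ℂ) ⊆ θ₁ '' ball 0 ρ ∪ θ₂ '' ball 0 ρ) (hε : 0 < ε) :
    ∃ F : ℂ → OnePoint ℂ, (∀ z, IsLocUnivAt F z) ∧
      ∀ z ∈ θ₁ '' closedBall 0 ρ ∪ θ₂ '' closedBall 0 ρ, dist (F z) (H z) < ε := by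
  have hV₁ : IsOpen (θ₁ '' ball 0 R) := h₁.isOpen_image isOpen_ball
  have hV₂ : IsOpen (θ₂ '' ball 0 R) := h₂.isOpen_image isOpen_ball
  have hsub : closedBall (0 : ℂ) ρ ⊆ ball 0 R := closedBall_subset_ball hρR
  have hAV : θ₁ '' closedBall 0 ρ ∪ θ₂ '' closedBall 0 ρ ⊆ θ₁ '' ball 0 R ∪ θ₂ '' ball 0 R :=
    union_subset_union (image_mono hsub) (image_mono hsub)
  have hTV : (T : Set ℂ) ⊆ θ₁ '' ball 0 R ∪ θ₂ '' ball 0 R := hTρ.trans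
    (union_subset_union (image_mono (ball_subset_ball hρR.le))
      (image_mono (ball_subset_ball hρR.le)))
  have hAdisj : Disjoint (θ₁ '' closedBall 0 ρ) (θ₂ '' closedBall 0 ρ) :=
    hdisj.mono (image_mono hsub) (image_mono hsub)
  have hball : IsSimplyConnected (ball (0 : ℂ) R) :=
    isSimplyConnected_of_convex (convex_ball 0 R) ⟨0, mem_ball_self (hρ.trans hρR)⟩
  obtain ⟨x, y, hx, hy, hxy⟩ :=
    exists_segment_inter_image_closedBall_eq_singleton hρ hρR h₁ h₂ hAdisj
  have hseg : ∀ z ∈ segment ℝ x y, z ∉ T := fun z hz hzT => disjoint_left.1 hxy hz (hTρ hzT)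
  obtain ⟨P, h, hPT, hh, hhH⟩ := exists_polynomial_hasDerivAt_exp_div_sq hV₁ hV₂
    (h₁.isSimplyConnected_image isOpen_ball hball) (h₂.isSimplyConnected_image isOpen_ball hball)
    hdisj hH hT
  obtain ⟨η₁, hη₁, hclose₁⟩ := h₁.exists_forall_dist_lt hρ hρR hε
  obtain ⟨η₂, hη₂, hclose₂⟩ := h₂.exists_forall_dist_lt hρ hρR hε
  obtain ⟨F, Y, hF, hFP, hY, hYη, hFH, hFx, hFy⟩ :=
    exists_isLocUnivAt_hasDerivAt_finiteValue_sub (h₁.isCompact_image_closedBall hρR)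
      (h₂.isCompact_image_closedBall hρR) (hV₁.union hV₂) hAV hAdisj
      (fun _ => h₁.hasLogOn_image_closedBall hρ hρR) (fun _ => h₂.hasLogOn_image_closedBall hρ hρR)
      hx hy hH (fun z hz => (hPT z).trans (hT z hz).symm) (fun z hz => mt (hPT z).1 (hseg z hz))
      (fun a ha => hTV ((hPT a).1 ha)) hh hhH (lt_min hη₁ hη₂)
  have hpole : ∀ z ∈ θ₁ '' closedBall 0 ρ ∪ θ₂ '' closedBall 0 ρ,
      (F z = ∞ ↔ z ∈ T) ∧ (H z = ∞ ↔ z ∈ T) := fun z hz =>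
    ⟨(hFP z).trans (hPT z), hT z (hAV hz)⟩
  simp only [mem_union, or_imp, forall_and, hPT] at hYη hFH hpole ⊢
  exact ⟨F, hF,
    hclose₁ T F H Y (hY.mono subset_union_left) hFH.1
      (fun z hz => (hYη.1 z hz).trans_le (min_le_left _ _))
      (fun z hz => ⟨hpole.1.1 z hz, hpole.2.1 z hz⟩) x (hx.ge rfl).1
      (hseg x (left_mem_segment ℝ x y)) (by rwa [hFx, sub_self, norm_zero]),
    hclose₂ T F H Y (hY.mono subset_union_right) hFH.2
      (fun z hz => (hYη.2 z hz).trans_le (min_le_right _ _))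
      (fun z hz => ⟨hpole.1.2 z hz, hpole.2.2 z hz⟩) y (hy.ge rfl).1
      (hseg y (right_mem_segment ℝ x y)) (hFy.trans_le (min_le_right _ _))⟩

end TwoDiscs

/-! ### Approximation on a compact set and on its image under a self-map -/

theorem IsLocUnivAt.eventually_ne_infty {F : ℂ → OnePoint ℂ} {z : ℂ} (hF : IsLocUnivAt F z) :
    ∀ᶠ w in 𝓝[≠] z, F w ≠ ∞ := by
  by_cases hz : F z = ∞
  · obtain ⟨c, β, -, -, hpolar⟩ := hF.exists_eventually_eq_polar hz
    exact hpolar.mono fun w hw => hw ▸ OnePoint.coe_ne_infty _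
  · obtain ⟨g, -, -, hFg⟩ := hF.exists_eventuallyEq_coe hz
    exact (hFg.filter_mono nhdsWithin_le_nhds).mono fun w hw => hw ▸ OnePoint.coe_ne_infty _

theorem finite_setOf_eq_infty {F : ℂ → OnePoint ℂ} {K : Set ℂ} (hK : IsCompact K)
    (hF : ∀ z ∈ K, IsLocUnivAt F z) : {z ∈ K | F z = ∞}.Finite := by
  obtain ⟨t, -, ht⟩ := hK.elim_nhds_subcover (fun z => {w | w ≠ z → F w ≠ ∞} ∪ Kᶜ) fun z hz =>
    mem_of_superset (eventually_nhdsWithin_iff.1 (hF z hz).eventually_ne_infty) subset_union_left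
  refine t.finite_toSet.subset ?_
  rintro w ⟨hwK, hw⟩
  obtain ⟨z, hz, hwz⟩ := mem_iUnion₂.1 (ht hwK)
  obtain rfl : w = z := by
    by_contra hne
    exact hwz.elim (fun h => h hne hw) fun h => h hwK
  exact hz

theorem IsConformalEmbedding.isLocUnivAt_comp_iff {θ : ℂ → ℂ} {B : Set ℂ}
    (hθ : IsConformalEmbedding θ B) (hB : IsOpen B) {z : ℂ} (hz : z ∈ B) {F : ℂ → OnePoint ℂ} :
    IsLocUnivAt (fun w => F (θ w)) z ↔ IsLocUnivAt F (θ z) := by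
  refine ⟨fun h => ?_, fun h => h.comp (hθ.differentiableOn.analyticAt (hB.mem_nhds hz))
    (hθ.deriv_ne_zero z hz)⟩
  obtain ⟨ψ, hψ, hψθ⟩ := hθ.exists_inverse hB
  have hV : θ '' B ∈ 𝓝 (θ z) := (hθ.isOpen_image hB).mem_nhds (mem_image_of_mem θ hz)
  have hcomp : IsLocUnivAt (fun p => F (θ (ψ p))) (θ z) :=
    IsLocUnivAt.comp (F := fun w => F (θ w)) ((hψθ z hz).symm ▸ h)
      (hψ.differentiableOn.analyticAt hV) (hψ.deriv_ne_zero _ (mem_image_of_mem θ hz))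
  refine hcomp.congr (eventually_of_mem hV ?_)
  rintro _ ⟨w, hw, rfl⟩
  simp only [hψθ w hw]

theorem exists_isLocUnivAt_image_union {θ₁ θ₂ : ℂ → ℂ} {B₁ B₂ : Set ℂ} {F₁ F₂ : ℂ → OnePoint ℂ}
    (h₁ : IsConformalEmbedding θ₁ B₁) (h₂ : IsConformalEmbedding θ₂ B₂) (hB₁ : IsOpen B₁)
    (hB₂ : IsOpen B₂) (hdisj : Disjoint (θ₁ '' B₁) (θ₂ '' B₂))
    (hF₁ : ∀ z ∈ B₁, IsLocUnivAt F₁ z) (hF₂ : ∀ z ∈ B₂, IsLocUnivAt F₂ z) :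
    ∃ H : ℂ → OnePoint ℂ, (∀ z ∈ B₁, H (θ₁ z) = F₁ z) ∧ (∀ z ∈ B₂, H (θ₂ z) = F₂ z) ∧
      ∀ p ∈ θ₁ '' B₁ ∪ θ₂ '' B₂, IsLocUnivAt H p := by
  classical
  set H : ℂ → OnePoint ℂ := fun p => if p ∈ θ₁ '' B₁ then F₁ (Function.invFunOn θ₁ B₁ p)
    else F₂ (Function.invFunOn θ₂ B₂ p)
  have hH₁ : ∀ z ∈ B₁, H (θ₁ z) = F₁ z := fun z hz =>
    (if_pos (mem_image_of_mem θ₁ hz)).trans (by rw [h₁.injOn.leftInvOn_invFunOn hz])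
  have hH₂ : ∀ z ∈ B₂, H (θ₂ z) = F₂ z := fun z hz =>
    (if_neg (hdisj.notMem_of_mem_right (mem_image_of_mem θ₂ hz))).trans
      (by rw [h₂.injOn.leftInvOn_invFunOn hz])
  refine ⟨H, hH₁, hH₂, ?_⟩
  rintro _ (⟨z, hz, rfl⟩ | ⟨z, hz, rfl⟩)
  · exact (h₁.isLocUnivAt_comp_iff hB₁ hz).1 ((hF₁ z hz).congr
      (eventually_of_mem (hB₁.mem_nhds hz) fun w hw => (hH₁ w hw).symm))
  · exact (h₂.isLocUnivAt_comp_iff hB₂ hz).1 ((hF₂ z hz).congr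
      (eventually_of_mem (hB₂.mem_nhds hz) fun w hw => (hH₂ w hw).symm))

theorem exists_disjoint_Ico_of_finite {N : Set ℝ} (hN : N.Finite) {a b : ℝ} (hab : a < b) :
    ∃ ρ R, a < ρ ∧ ρ < R ∧ R ≤ b ∧ Disjoint N (Ico ρ R) := by
  have hN' : Nᶜ ∈ 𝓝[>] a :=
    (nhdsGT_le_nhdsNE a).trans (nhdsNE_le_cofinite a) hN.compl_mem_cofinite
  obtain ⟨R, ⟨haR, hRb⟩, hR⟩ := (mem_nhdsGT_iff_exists_mem_Ioc_Ioo_subset hab).1 hN'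
  obtain ⟨ρ, haρ, hρR⟩ := exists_between haR
  exact ⟨ρ, R, haρ, hρR, hRb,
    disjoint_left.2 fun x hxN hx => hR ⟨haρ.trans_le hx.1, hx.2⟩ hxN⟩

theorem exists_radii_eq_infty_imp_mem_ball {r R₀ : ℝ} (hrR : r < R₀) {F₁ F₂ : ℂ → OnePoint ℂ}
    (hF₁ : ∀ z ∈ ball (0 : ℂ) R₀, IsLocUnivAt F₁ z)
    (hF₂ : ∀ z ∈ ball (0 : ℂ) R₀, IsLocUnivAt F₂ z) :
    ∃ ρ R, r < ρ ∧ ρ < R ∧ R < R₀ ∧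
      ∀ z ∈ ball (0 : ℂ) R, F₁ z = ∞ ∨ F₂ z = ∞ → z ∈ ball (0 : ℂ) ρ := by
  obtain ⟨R₁, hrR₁, hR₁⟩ := exists_between hrR
  have hsub : closedBall (0 : ℂ) R₁ ⊆ ball 0 R₀ := closedBall_subset_ball hR₁
  have hS₁ := finite_setOf_eq_infty (isCompact_closedBall 0 R₁) fun z hz => hF₁ z (hsub hz)
  have hS₂ := finite_setOf_eq_infty (isCompact_closedBall 0 R₁) fun z hz => hF₂ z (hsub hz)
  obtain ⟨ρ, R, hrρ, hρR, hRR₁, hdisj⟩ :=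
    exists_disjoint_Ico_of_finite ((hS₁.union hS₂).image norm) hrR₁
  refine ⟨ρ, R, hrρ, hρR, hRR₁.trans_lt hR₁, fun z hz hzF => ?_⟩
  have hzR₁ : z ∈ closedBall (0 : ℂ) R₁ := ball_subset_closedBall (ball_subset_ball hRR₁ hz)
  rw [mem_ball_zero_iff] at hz ⊢
  by_contra! hρz
  exact disjoint_left.1 hdisj (mem_image_of_mem _ (hzF.imp (⟨hzR₁, ·⟩) (⟨hzR₁, ·⟩))) ⟨hρz, hz⟩

theorem exists_isLocUnivAt_dist_comp_lt {r R₀ : ℝ} (hr : 0 < r) (hrR : r < R₀) {θ₁ θ₂ : ℂ → ℂ}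
    (h₁ : IsConformalEmbedding θ₁ (ball 0 R₀)) (h₂ : IsConformalEmbedding θ₂ (ball 0 R₀))
    (hdisj : Disjoint (θ₁ '' ball 0 R₀) (θ₂ '' ball 0 R₀)) {F₁ F₂ : ℂ → OnePoint ℂ}
    (hF₁ : ∀ z ∈ ball (0 : ℂ) R₀, IsLocUnivAt F₁ z) (hF₂ : ∀ z ∈ ball (0 : ℂ) R₀, IsLocUnivAt F₂ z)
    {ε : ℝ} (hε : 0 < ε) : ∃ F : ℂ → OnePoint ℂ, (∀ z, IsLocUnivAt F z) ∧
      ∀ z ∈ closedBall (0 : ℂ) r, dist (F (θ₁ z)) (F₁ z) < ε ∧ dist (F (θ₂ z)) (F₂ z) < ε := by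
  obtain ⟨ρ, R, hrρ, hρR, hRR₀, hpole⟩ := exists_radii_eq_infty_imp_mem_ball hrR hF₁ hF₂
  obtain ⟨H, hH₁, hH₂, hH⟩ :=
    exists_isLocUnivAt_image_union h₁ h₂ isOpen_ball isOpen_ball hdisj hF₁ hF₂
  have hR : closedBall (0 : ℂ) R ⊆ ball 0 R₀ := closedBall_subset_ball hRR₀
  have hR' : ball (0 : ℂ) R ⊆ ball 0 R₀ := ball_subset_ball hRR₀.le
  have hVK : θ₁ '' ball 0 R ∪ θ₂ '' ball 0 R ⊆ θ₁ '' closedBall 0 R ∪ θ₂ '' closedBall 0 R :=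
    union_subset_union (image_mono ball_subset_closedBall) (image_mono ball_subset_closedBall)
  have hK : IsCompact (θ₁ '' closedBall 0 R ∪ θ₂ '' closedBall 0 R) :=
    (h₁.isCompact_image_closedBall hRR₀).union (h₂.isCompact_image_closedBall hRR₀)
  have hT : {p ∈ θ₁ '' ball 0 R ∪ θ₂ '' ball 0 R | H p = ∞}.Finite :=
    (finite_setOf_eq_infty hK fun p hp =>
      hH p (union_subset_union (image_mono hR) (image_mono hR) hp)).subset
      fun p hp => ⟨hVK hp.1, hp.2⟩
  have hTρ : (hT.toFinset : Set ℂ) ⊆ θ₁ '' ball 0 ρ ∪ θ₂ '' ball 0 ρ := by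
    rw [Finite.coe_toFinset]
    rintro _ ⟨⟨z, hz, rfl⟩ | ⟨z, hz, rfl⟩, hHz⟩
    · exact Or.inl (mem_image_of_mem θ₁ (hpole z hz (Or.inl (hH₁ z (hR' hz) ▸ hHz))))
    · exact Or.inr (mem_image_of_mem θ₂ (hpole z hz (Or.inr (hH₂ z (hR' hz) ▸ hHz))))
  obtain ⟨F, hF, hFH⟩ := exists_isLocUnivAt_dist_lt (hr.trans hrρ) hρR (h₁.mono hR') (h₂.mono hR')
    (hdisj.mono (image_mono hR') (image_mono hR'))
    (fun p hp => hH p (union_subset_union (image_mono hR') (image_mono hR') hp))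
    (fun p hp => by rw [Finite.mem_toFinset]; exact (and_iff_right hp).symm) hTρ hε
  refine ⟨F, hF, fun z hz => ?_⟩
  have hzρ : z ∈ closedBall (0 : ℂ) ρ := closedBall_subset_closedBall hrρ.le hz
  have hzR₀ : z ∈ ball (0 : ℂ) R₀ := hR' (closedBall_subset_ball hρR hzρ)
  rw [← hH₁ z hzR₀, ← hH₂ z hzR₀]
  exact ⟨hFH _ (Or.inl (mem_image_of_mem θ₁ hzρ)), hFH _ (Or.inr (mem_image_of_mem θ₂ hzρ))⟩

theorem isConformalEmbedding_id (B : Set ℂ) : IsConformalEmbedding id B :=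
  ⟨injOn_id B, fun z _ => by simp⟩

section Domain

variable {Ω : Set ℂ}

theorem exists_isConformalEmbedding_image_subset_closedBall (hΩ : IsOpen Ω)
    (hsc : IsSimplyConnected Ω) {K : Set ℂ} (hK : IsCompact K) (hKΩ : K ⊆ Ω) :
    ∃ (ψ : ℂ → ℂ) (r R : ℝ), IsConformalEmbedding ψ Ω ∧ 0 < r ∧ r < R ∧
      ψ '' K ⊆ closedBall 0 r ∧ closedBall 0 R ⊆ ψ '' Ω := by
  by_cases hne : Ω = univ
  · obtain ⟨r, hr, hKr⟩ := hK.isBounded.subset_closedBall_lt 0 0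
    exact ⟨id, r, r + 1, isConformalEmbedding_id Ω, hr, lt_add_one r, by rwa [image_id],
      by simp [hne]⟩
  · obtain ⟨ψ, hψ, hball⟩ := exists_isConformalEmbedding_image_eq_ball hΩ hsc hne
    have hψK : IsCompact (ψ '' K) := hK.image_of_continuousOn
      (hψ.differentiableOn.continuousOn.mono hKΩ)
    obtain ⟨s, hs, hKs⟩ := exists_lt_subset_ball hψK.isClosed ((image_mono hKΩ).trans hball.subset)
    obtain ⟨r, hr, hr1⟩ := exists_between (max_lt zero_lt_one hs)
    obtain ⟨R, hrR, hR1⟩ := exists_between hr1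
    exact ⟨ψ, r, R, hψ, (le_max_left 0 s).trans_lt hr, hrR,
      hKs.trans (ball_subset_closedBall.trans
        (closedBall_subset_closedBall ((le_max_right 0 s).trans hr.le))),
      hball.symm ▸ closedBall_subset_ball hR1⟩

theorem exists_isCompact_forall_exists_isLocUnivAt_dist_lt (hΩ : IsOpen Ω)
    (hsc : IsSimplyConnected Ω) {K : Set ℂ} (hK : IsCompact K) (hKΩ : K ⊆ Ω) :
    ∃ L ⊆ Ω, IsCompact L ∧ ∀ φ : ℂ → ℂ, IsConformalEmbedding φ L → MapsTo φ L Ω →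
      Disjoint L (φ '' L) → ∀ f g : ℂ → OnePoint ℂ, (∀ z ∈ Ω, IsLocUnivAt f z) →
        (∀ z ∈ Ω, IsLocUnivAt g z) → ∀ ε > 0, ∃ F : ℂ → OnePoint ℂ, (∀ z ∈ Ω, IsLocUnivAt F z) ∧
          ∀ z ∈ K, dist (F z) (f z) < ε ∧ dist (F (φ z)) (g z) < ε := by
  obtain ⟨ψ, r, R, hψ, hr, hrR, hKr, hRΩ⟩ :=
    exists_isConformalEmbedding_image_subset_closedBall hΩ hsc hK hKΩ
  obtain ⟨χ, hχ, hχψ⟩ := hψ.exists_inverse hΩ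
  have hχΩ : MapsTo χ (closedBall 0 R) Ω := fun w hw => by
    obtain ⟨z, hz, rfl⟩ := hRΩ hw
    rwa [hχψ z hz]
  refine ⟨χ '' closedBall 0 R, hχΩ.image_subset, (isCompact_closedBall 0 R).image_of_continuousOn
    (hχ.differentiableOn.continuousOn.mono hRΩ), fun φ hφ hφΩ hdisj f g hf hg ε hε => ?_⟩
  have hBR : ball (0 : ℂ) R ⊆ closedBall 0 R := ball_subset_closedBall
  have hχR : IsConformalEmbedding χ (ball 0 R) := hχ.mono (hBR.trans hRΩ)
  have hφχ : MapsTo (φ ∘ χ) (ball 0 R) Ω := fun w hw => hφΩ (mem_image_of_mem χ (hBR hw))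
  have hθ : IsConformalEmbedding (ψ ∘ φ ∘ χ) (ball 0 R) :=
    hψ.comp (hφ.comp hχR fun w hw => mem_image_of_mem χ (hBR hw)) hφχ
  have hdisj' : Disjoint (id '' ball (0 : ℂ) R) ((ψ ∘ φ ∘ χ) '' ball 0 R) := by
    rw [image_id, disjoint_left]
    rintro _ hw ⟨v, hv, rfl⟩
    refine disjoint_left.1 hdisj (mem_image_of_mem χ (hBR hw)) ?_
    rw [Function.comp_apply, hχψ _ (hφχ hv)]
    exact mem_image_of_mem φ (mem_image_of_mem χ (hBR hv))
  obtain ⟨F, hF, hFfg⟩ := exists_isLocUnivAt_dist_comp_lt hr hrR (isConformalEmbedding_id _) hθ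
    hdisj' (fun w hw => (hχR.isLocUnivAt_comp_iff isOpen_ball hw).2 (hf _ (hχΩ (hBR hw))))
    (fun w hw => (hχR.isLocUnivAt_comp_iff isOpen_ball hw).2 (hg _ (hχΩ (hBR hw)))) hε
  refine ⟨fun z => F (ψ z), fun z hz => (hψ.isLocUnivAt_comp_iff hΩ hz).2 (hF _), fun z hz => ?_⟩
  simpa only [id, Function.comp_apply, hχψ z (hKΩ hz)] using
    hFfg (ψ z) (hKr (mem_image_of_mem ψ hz))

theorem exists_ge_image_inter_eq_empty (hne : Ω.Nonempty) {φ : ℕ → Ω → Ω}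
    (hrun : IsRunAway φ) {K : Set Ω} (hK : IsCompact K) (N : ℕ) :
    ∃ n ≥ N, φ n '' K ∩ K = ∅ := by
  obtain ⟨z, hz⟩ := hne
  set z₀ : Ω := ⟨z, hz⟩
  -- Adding `z₀` and its images under `φ 0, …, φ (N - 1)` to `K` rules out the indices below `N`.
  obtain ⟨n, hn⟩ := hrun (K ∪ insert z₀ ((fun m => φ m z₀) '' Iio N))
    (hK.union (((finite_Iio N).image _).insert _).isCompact)
  refine ⟨n, ?_, subset_empty_iff.1 (hn ▸ inter_subset_inter (image_mono subset_union_left)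
    subset_union_left)⟩
  by_contra! hnN
  have hmem : φ n z₀ ∈ (∅ : Set Ω) := hn ▸ ⟨mem_image_of_mem _ (Or.inr (mem_insert _ _)),
    Or.inr (mem_insert_of_mem _ ⟨n, hnN, rfl⟩)⟩
  exact hmem

theorem ofFun_mem_locallyUnivalentMeromorphic (hΩ : IsOpen Ω) {F : ℂ → OnePoint ℂ}
    (hF : ∀ z ∈ Ω, IsLocUnivAt F z) :
    UniformOnFun.ofFun _ (fun z : Ω => F z) ∈ locallyUnivalentMeromorphic Ω :=
  (mem_locallyUnivalentMeromorphic_iff hΩ).2 fun z hz => (hF z hz).congr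
    (eventually_of_mem (hΩ.mem_nhds hz) fun w hw =>
      (extendInfty_apply (UniformOnFun.ofFun _ fun z : Ω => F z) ⟨w, hw⟩).symm)

theorem comp_mem_locallyUnivalentMeromorphic (hΩ : IsOpen Ω) {f : SphereMap Ω}
    (hf : f ∈ locallyUnivalentMeromorphic Ω) {φ : Ω → Ω} (hφ : IsLocallyUnivalentSelfMap φ) :
    f.comp φ ∈ locallyUnivalentMeromorphic Ω := by
  set φ' : ℂ → ℂ := extendZero fun z => (φ z : ℂ)
  have hφ' : ∀ z : Ω, φ' z = φ z := extendZero_apply _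
  have hcomp : f.comp φ = UniformOnFun.ofFun _ fun z : Ω => extendInfty f (φ' z) := by
    refine congrArg (UniformOnFun.ofFun _) (funext fun z => ?_)
    rw [hφ', extendInfty_apply, Function.comp_apply]
  rw [hcomp]
  refine ofFun_mem_locallyUnivalentMeromorphic hΩ (F := fun z => extendInfty f (φ' z))
    fun z hz => IsLocUnivAt.comp ?_ (hφ.1.analyticAt (hΩ.mem_nhds hz)) (hφ.2 z hz)
  rw [hφ' ⟨z, hz⟩]
  exact (mem_locallyUnivalentMeromorphic_iff hΩ).1 hf _ (φ ⟨z, hz⟩).2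

theorem exists_mem_dist_lt (hΩ : IsOpen Ω) (hsc : IsSimplyConnected Ω)
    {φ : ℕ → Ω → Ω} (hφ : ∀ n, IsLocallyUnivalentSelfMap (φ n)) (hrun : IsRunAway φ)
    (hinj : IsEventuallyInjective φ) {f g : SphereMap Ω} (hf : f ∈ locallyUnivalentMeromorphic Ω)
    (hg : g ∈ locallyUnivalentMeromorphic Ω) {K : Set Ω} (hK : IsCompact K) {ε : ℝ} (hε : 0 < ε) :
    ∃ F ∈ locallyUnivalentMeromorphic Ω, ∃ n, ∀ z ∈ K,
      dist (F.toFun z) (f.toFun z) < ε ∧ dist ((F.comp (φ n)).toFun z) (g.toFun z) < ε := by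
  rw [mem_locallyUnivalentMeromorphic_iff hΩ] at hf hg
  obtain ⟨L, hLΩ, hL, happrox⟩ := exists_isCompact_forall_exists_isLocUnivAt_dist_lt hΩ hsc
    (hK.image continuous_subtype_val) (Subtype.coe_image_subset Ω K)
  have hL' : IsCompact ((↑) ⁻¹' L : Set Ω) := by
    rwa [Subtype.isCompact_iff, Subtype.image_preimage_coe, inter_eq_right.2 hLΩ]
  obtain ⟨N, hN⟩ := hinj _ hL'
  obtain ⟨n, hnN, hn⟩ := exists_ge_image_inter_eq_empty hsc.nonempty hrun hL' N
  set φ' : ℂ → ℂ := extendZero fun z => (φ n z : ℂ)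
  have hφ' : ∀ z : Ω, φ' z = φ n z := extendZero_apply _
  have hemb : IsConformalEmbedding φ' L := by
    refine ⟨fun z hz w hw hzw => ?_, fun z hz => (hφ n).2 z (hLΩ hz)⟩
    rw [hφ' ⟨z, hLΩ hz⟩, hφ' ⟨w, hLΩ hw⟩] at hzw
    exact congrArg Subtype.val (hN n hnN (show (⟨z, hLΩ hz⟩ : Ω) ∈ _ from hz)
      (show (⟨w, hLΩ hw⟩ : Ω) ∈ _ from hw) (Subtype.ext hzw))
  have hmaps : MapsTo φ' L Ω := fun z hz => hφ' ⟨z, hLΩ hz⟩ ▸ (φ n ⟨z, hLΩ hz⟩).2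
  have hdisj : Disjoint L (φ' '' L) := by
    rw [disjoint_left]
    rintro _ hwL ⟨z, hz, rfl⟩
    rw [hφ' ⟨z, hLΩ hz⟩] at hwL
    exact (disjoint_iff_inter_eq_empty.2 hn).ne_of_mem (mem_image_of_mem (φ n) hz) hwL rfl
  obtain ⟨F, hF, hFfg⟩ := happrox φ' hemb hmaps hdisj _ _ hf hg ε hε
  refine ⟨_, ofFun_mem_locallyUnivalentMeromorphic hΩ hF, n, fun z hz => ?_⟩
  have hFz := hFfg z (mem_image_of_mem _ hz)
  simp only [extendInfty_apply, hφ'] at hFz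
  exact hFz

end Domain

/-! ### Limits of locally univalent maps -/

section LocallyUniform

variable {ι X Y Z : Type*} [TopologicalSpace X] [UniformSpace Y] {p : Filter ι} {G : ι → X → Y}
  {F : X → Y} {U : Set X}

theorem tendsto_uncurry_of_tendstoLocallyUniformlyOn (h : TendstoLocallyUniformlyOn G F p U)
    {z : X} (hz : z ∈ U) (hF : ContinuousWithinAt F U z) :
    Tendsto (Function.uncurry G) (p ×ˢ 𝓝[U] z) (𝓝 (F z)) :=
  (hF.tendsto.comp tendsto_snd).congr_uniformity
    (tendstoLocallyUniformlyOn_iff_forall_tendsto.1 h z hz)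

theorem tendstoLocallyUniformlyOn_comp_of_continuousAt [UniformSpace Z]
    (h : TendstoLocallyUniformlyOn G F p U) (hF : ContinuousOn F U) {v : Y → Z}
    (hv : ∀ z ∈ U, ContinuousAt v (F z)) :
    TendstoLocallyUniformlyOn (fun i => v ∘ G i) (v ∘ F) p U :=
  tendstoLocallyUniformlyOn_iff_forall_tendsto.2 fun z hz =>
    have hGz := tendsto_uncurry_of_tendstoLocallyUniformlyOn h hz (hF z hz)
    (((hv z hz).tendsto.comp ((hF z hz).tendsto.comp tendsto_snd)).prodMk_nhds
      ((hv z hz).tendsto.comp hGz)).mono_right (nhds_le_uniformity _)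

end LocallyUniform

/-- The inversion `x ↦ 1 / x` of the Riemann sphere; it exchanges poles and zeros, so that
statements at a pole follow from those at a finite value. -/
noncomputable def sphereInv (x : OnePoint ℂ) : OnePoint ℂ := x.elim (0 : ℂ) cinv

@[simp] theorem sphereInv_infty : sphereInv ∞ = ((0 : ℂ) : OnePoint ℂ) := rfl

@[simp] theorem sphereInv_coe (w : ℂ) : sphereInv (w : OnePoint ℂ) = cinv w := rfl

theorem sphereInv_cinv (w : ℂ) : sphereInv (cinv w) = w := by
  by_cases h : w = 0
  · rw [h, cinv_zero, sphereInv_infty]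
  · rw [cinv_of_ne_zero h, sphereInv_coe, cinv_of_ne_zero (inv_ne_zero h), inv_inv]

theorem involutive_sphereInv : Function.Involutive sphereInv := fun x => by
  induction x with
  | infty => rw [sphereInv_infty, sphereInv_coe, cinv_zero]
  | coe w => rw [sphereInv_coe, sphereInv_cinv]

theorem continuous_cinv : Continuous cinv := by
  refine continuous_iff_continuousAt.2 fun w => ?_
  by_cases hw : w = 0
  · rw [hw, continuousAt_iff_punctured_nhds, cinv_zero]
    have hinv : Tendsto (fun v : ℂ => ((v⁻¹ : ℂ) : OnePoint ℂ)) (𝓝[≠] 0) (𝓝 ∞) :=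
      OnePoint.tendsto_coe_infty.comp (coclosedCompact_eq_cocompact (X := ℂ) ▸
        cobounded_eq_cocompact (α := ℂ) ▸ tendsto_inv₀_nhdsNE_zero)
    exact hinv.congr' (eventually_nhdsWithin_of_forall fun v hv => (cinv_of_ne_zero hv).symm)
  · refine (OnePoint.continuous_coe.continuousAt.comp (continuousAt_inv₀ hw)).congr ?_
    exact (eventually_ne_nhds hw).mono fun v hv => (cinv_of_ne_zero hv).symm

theorem continuous_sphereInv : Continuous sphereInv := by
  refine (OnePoint.continuous_iff _).2 ⟨?_, continuous_cinv⟩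
  have hinv : Tendsto (fun v : ℂ => ((v⁻¹ : ℂ) : OnePoint ℂ)) (coclosedCompact ℂ)
      (𝓝 ((0 : ℂ) : OnePoint ℂ)) := by
    rw [coclosedCompact_eq_cocompact, ← cobounded_eq_cocompact]
    exact (OnePoint.continuous_coe.tendsto 0).comp tendsto_inv₀_cobounded
  have hne : ∀ᶠ v : ℂ in coclosedCompact ℂ, v ≠ 0 :=
    isCompact_singleton.compl_mem_coclosedCompact_of_isClosed isClosed_singleton
  exact hinv.congr' (hne.mono fun v hv => (cinv_of_ne_zero hv).symm)

namespace IsLocUnivAt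

variable {F : ℂ → OnePoint ℂ} {z : ℂ}

theorem continuousAt (hF : IsLocUnivAt F z) : ContinuousAt F z := by
  obtain ⟨g, hg, -, h | h⟩ := hF
  · exact (OnePoint.continuous_coe.continuousAt.comp hg.continuousAt).congr h.symm
  · exact (continuous_cinv.continuousAt.comp hg.continuousAt).congr h.symm

theorem sphereInv_comp (hF : IsLocUnivAt F z) : IsLocUnivAt (sphereInv ∘ F) z := by
  obtain ⟨g, hg, hg', h | h⟩ := hF
  · exact ⟨g, hg, hg', Or.inr (h.mono fun w hw => by
      rw [Function.comp_apply, hw, sphereInv_coe])⟩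
  · exact ⟨g, hg, hg', Or.inl (h.mono fun w hw => by
      rw [Function.comp_apply, hw, sphereInv_cinv])⟩

theorem not_eventually_eq (hF : IsLocUnivAt F z) : ¬ ∀ᶠ w in 𝓝 z, F w = F z := by
  intro hconst
  by_cases hz : F z = ∞
  · obtain ⟨w, hw, hwz⟩ :=
      (hF.eventually_ne_infty.and (hconst.filter_mono nhdsWithin_le_nhds)).exists
    exact hw (hwz.trans hz)
  · obtain ⟨-, hderiv⟩ := hF.analyticAt_finiteValue hz
    have hfin : finiteValue F =ᶠ[𝓝 z] fun _ => finiteValue F z := hconst.mono fun w hw => by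
      simp only [finiteValue, hw]
    exact hderiv (by rw [hfin.deriv_eq, deriv_const])

theorem eventually (hF : IsLocUnivAt F z) : ∀ᶠ w in 𝓝 z, IsLocUnivAt F w := by
  obtain ⟨g, hg, hg', hFg⟩ := hF
  have hFg' : ∀ᶠ w in 𝓝 z, F =ᶠ[𝓝 w] (fun v => (g v : OnePoint ℂ)) ∨
      F =ᶠ[𝓝 w] fun v => cinv (g v) :=
    hFg.elim (fun h => h.eventually_nhds.mono fun _ => Or.inl)
      fun h => h.eventually_nhds.mono fun _ => Or.inr
  filter_upwards [hg.eventually_analyticAt, hg.deriv.continuousAt.eventually_ne hg', hFg']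
    with w hgw hgw' hFw
  exact ⟨g, hgw, hgw', hFw⟩

end IsLocUnivAt

theorem continuousAt_elim_coe (a : ℂ) :
    ContinuousAt (fun x : OnePoint ℂ => x.elim 0 id) (a : OnePoint ℂ) :=
  OnePoint.continuousAt_coe.2 continuousAt_id

section Limit

variable {ι : Type*} {p : Filter ι} {U : Set ℂ} {G : ι → ℂ → OnePoint ℂ} {F : ℂ → OnePoint ℂ}

theorem exists_isOpen_forall_ne_infty (hU : IsOpen U) (h : TendstoLocallyUniformlyOn G F p U)
    (hF : ContinuousOn F U) {z : ℂ} (hz : z ∈ U) (hFz : F z ≠ ∞) :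
    ∃ V ⊆ U, IsOpen V ∧ z ∈ V ∧ (∀ w ∈ V, F w ≠ ∞) ∧ ∀ᶠ i in p, ∀ w ∈ V, G i w ≠ ∞ := by
  have hlim := tendsto_uncurry_of_tendstoLocallyUniformlyOn h hz (hF z hz)
  rw [hU.nhdsWithin_eq hz] at hlim
  obtain ⟨P, hP, Q, hQ, hPQ⟩ := eventually_prod_iff.1 (hlim.eventually_ne hFz)
  have hF' : ∀ᶠ w in 𝓝 z, F w ≠ ∞ := (hF.continuousAt (hU.mem_nhds hz)).eventually_ne hFz
  obtain ⟨V, hV, hVo, hzV⟩ := _root_.mem_nhds_iff.1 (hQ.and (hF'.and (hU.mem_nhds hz)))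
  exact ⟨V, fun w hw => (hV hw).2.2, hVo, hzV, fun w hw => (hV hw).2.1,
    hP.mono fun i hi w hw => hPQ hi (hV hw).1⟩

variable [NeBot p]

theorem deriv_ne_zero_or_eventually_eq {g : ι → ℂ → ℂ} {f : ℂ → ℂ} (hU : IsOpen U)
    (h : TendstoLocallyUniformlyOn g f p U)
    (hg : ∀ᶠ i in p, DifferentiableOn ℂ (g i) U ∧ ∀ w ∈ U, deriv (g i) w ≠ 0) {z : ℂ}
    (hz : z ∈ U) : deriv f z ≠ 0 ∨ ∀ᶠ w in 𝓝 z, f w = f z := by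
  refine or_iff_not_imp_left.2 fun hfz => ?_
  have hgd : ∀ᶠ i in p, DifferentiableOn ℂ (g i) U := hg.mono fun i hi => hi.1
  have hderiv : ∀ᶠ w in 𝓝 z, deriv f w = 0 :=
    eventually_eq_zero_of_tendstoLocallyUniformlyOn hU (h.deriv hgd hU)
      (hgd.mono fun i hi => hi.deriv hU) (hg.mono fun i hi => hi.2) hz (not_not.1 hfz)
  obtain ⟨r, hr, hball⟩ := Metric.mem_nhds_iff.1 (inter_mem hderiv (hU.mem_nhds hz))
  filter_upwards [ball_mem_nhds z hr] with w hw
  exact isOpen_ball.is_const_of_deriv_eq_zero (convex_ball z r).isPreconnected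
    ((h.differentiableOn hgd hU).mono fun v hv => (hball hv).2) (fun v hv => (hball hv).1) hw
    (mem_ball_self hr)

theorem isLocUnivAt_or_eventually_eq_of_ne_infty (hU : IsOpen U)
    (h : TendstoLocallyUniformlyOn G F p U) (hG : ∀ᶠ i in p, ∀ z ∈ U, IsLocUnivAt (G i) z)
    (hF : ContinuousOn F U) {z : ℂ} (hz : z ∈ U) (hFz : F z ≠ ∞) :
    IsLocUnivAt F z ∨ ∀ᶠ w in 𝓝 z, F w = F z := by
  obtain ⟨V, hVU, hV, hzV, hFV, hGV⟩ := exists_isOpen_forall_ne_infty hU h hF hz hFz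
  have hconv : TendstoLocallyUniformlyOn (fun i => finiteValue (G i)) (finiteValue F) p V :=
    tendstoLocallyUniformlyOn_comp_of_continuousAt (v := fun x : OnePoint ℂ => x.elim 0 id)
      (h.mono hVU) (hF.mono hVU) fun w hw => coe_finiteValue (hFV w hw) ▸ continuousAt_elim_coe _
  have hGfin : ∀ᶠ i in p, ∀ w ∈ V, AnalyticAt ℂ (finiteValue (G i)) w ∧
      deriv (finiteValue (G i)) w ≠ 0 := by
    filter_upwards [hG, hGV] with i hGi hGiV w hw
    exact (hGi w (hVU hw)).analyticAt_finiteValue (hGiV w hw)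
  have hGdiff : ∀ᶠ i in p, DifferentiableOn ℂ (finiteValue (G i)) V := hGfin.mono
    fun i hi w hw => (hi w hw).1.differentiableAt.differentiableWithinAt
  have hFcoe : ∀ᶠ w in 𝓝 z, F w = finiteValue F w :=
    eventually_of_mem (hV.mem_nhds hzV) fun w hw => (coe_finiteValue (hFV w hw)).symm
  refine (deriv_ne_zero_or_eventually_eq hV hconv (hGdiff.and (hGfin.mono fun i hi w hw =>
    (hi w hw).2)) hzV).imp (fun hderiv => ?_) fun hconst => ?_
  · exact (isLocUnivAt_coe ((hconv.differentiableOn hGdiff hV).analyticAt (hV.mem_nhds hzV))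
      hderiv).congr (hFcoe.mono fun w hw => hw.symm)
  · filter_upwards [hFcoe, hconst] with w hw hwz
    rw [hw, hwz, coe_finiteValue hFz]

theorem isLocUnivAt_or_eventually_eq (hU : IsOpen U)
    (h : TendstoLocallyUniformlyOn G F p U) (hG : ∀ᶠ i in p, ∀ z ∈ U, IsLocUnivAt (G i) z)
    (hF : ContinuousOn F U) {z : ℂ} (hz : z ∈ U) :
    IsLocUnivAt F z ∨ ∀ᶠ w in 𝓝 z, F w = F z := by
  by_cases hFz : F z = ∞
  · have hne : (sphereInv ∘ F) z ≠ ∞ := by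
      rw [Function.comp_apply, hFz, sphereInv_infty]
      exact OnePoint.coe_ne_infty 0
    refine (isLocUnivAt_or_eventually_eq_of_ne_infty hU
      (tendstoLocallyUniformlyOn_comp_of_continuousAt h hF fun _ _ =>
        continuous_sphereInv.continuousAt)
      (hG.mono fun i hi z hz => (hi z hz).sphereInv_comp)
      (continuous_sphereInv.comp_continuousOn hF) hz hne).imp (fun hinv => ?_) fun hconst =>
      hconst.mono fun w hw => involutive_sphereInv.injective hw
    simpa only [← Function.comp_assoc, involutive_sphereInv.comp_self, Function.id_comp] using
      hinv.sphereInv_comp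
  · exact isLocUnivAt_or_eventually_eq_of_ne_infty hU h hG hF hz hFz

theorem forall_isLocUnivAt_or_forall_eq (hU : IsOpen U) (hconn : IsPreconnected U)
    (h : TendstoLocallyUniformlyOn G F p U) (hG : ∀ᶠ i in p, ∀ z ∈ U, IsLocUnivAt (G i) z)
    (hF : ContinuousOn F U) :
    (∀ z ∈ U, IsLocUnivAt F z) ∨ ∀ z ∈ U, ∀ w ∈ U, F z = F w := by
  have hopen : IsOpen {z | IsLocUnivAt F z} := isOpen_iff_mem_nhds.2 fun z hz => hz.eventually
  have hopen' : IsOpen {z | ∀ᶠ w in 𝓝 z, F w = F z} := isOpen_iff_mem_nhds.2 fun z hz => by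
    filter_upwards [hz.eventually_nhds, hz] with w hw hwz
    exact hw.mono fun v hv => hv.trans hwz.symm
  refine (hconn.subset_or_subset hopen hopen'
    (disjoint_left.2 fun z hz hz' => hz.not_eventually_eq hz')
    fun z hz => isLocUnivAt_or_eventually_eq hU h hG hF hz).imp (fun hsub z hz => hsub hz) ?_
  intro hsub z hz w hw
  exact hconn.induction₂ (fun z w => F z = F w)
    (fun v hv => ((hsub hv).mono fun _ => Eq.symm).filter_mono nhdsWithin_le_nhds)
    (fun _ _ _ _ _ _ => Eq.trans) (fun _ _ _ _ => Eq.symm) hz hw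

end Limit

/-! ### Universality and the Baire category theorem -/

section Universality

open TopologicalSpace

theorem baireSpace_of_isLocallyClosed {X : Type*} [TopologicalSpace X]
    [IsCompletelyPseudoMetrizableSpace X] {s : Set X} (hs : IsLocallyClosed s) : BaireSpace s := by
  have : IsCompletelyPseudoMetrizableSpace (closure s) :=
    isClosed_closure.isCompletelyPseudoMetrizableSpace
  have hemb : IsOpenEmbedding (inclusion (subset_closure : s ⊆ closure s)) :=
    ⟨.inclusion subset_closure, by
      rw [range_inclusion]
      exact hs.isOpen_preimage_val_closure⟩
  exact hemb.baireSpace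

variable {ι X Y : Type*} [TopologicalSpace Y] [SecondCountableTopology Y]

theorem setOf_dense_range_eq_biInter (T : ι → X → Y) :
    {x | Dense (range fun i => T i x)} = ⋂ U ∈ countableBasis Y, ⋃ i, T i ⁻¹' U := by
  ext x
  rw [mem_ofPred_eq, (isBasis_countableBasis Y).dense_iff, mem_iInter₂]
  refine forall₂_congr fun U hU => ?_
  rw [imp_iff_right (nonempty_of_mem_countableBasis hU), inter_comm, ← image_univ,
    image_inter_nonempty_iff]
  simp only [univ_inter, mem_iUnion, Set.Nonempty, mem_preimage]

variable [TopologicalSpace X] {T : ι → X → Y}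

theorem isGδ_setOf_dense_range (hT : ∀ i, Continuous (T i)) :
    IsGδ {x | Dense (range fun i => T i x)} := by
  rw [setOf_dense_range_eq_biInter]
  exact .biInter_of_isOpen (countable_countableBasis Y) fun U hU =>
    isOpen_iUnion fun i => (isOpen_of_mem_countableBasis hU).preimage (hT i)

theorem dense_setOf_dense_range [BaireSpace X] (hT : ∀ i, Continuous (T i))
    (htrans : ∀ V : Set X, IsOpen V → V.Nonempty → ∀ U : Set Y, IsOpen U → U.Nonempty →
      ∃ i, (V ∩ T i ⁻¹' U).Nonempty) :
    Dense {x | Dense (range fun i => T i x)} := by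
  rw [setOf_dense_range_eq_biInter]
  refine dense_biInter_of_isOpen (fun U hU => isOpen_iUnion fun i =>
    (isOpen_of_mem_countableBasis hU).preimage (hT i)) (countable_countableBasis Y) fun U hU => ?_
  refine dense_iff_inter_open.2 fun V hV hVne => ?_
  obtain ⟨i, x, hxV, hxU⟩ :=
    htrans V hV hVne U (isOpen_of_mem_countableBasis hU) (nonempty_of_mem_countableBasis hU)
  exact ⟨x, hxV, mem_iUnion.2 ⟨i, hxU⟩⟩

end Universality

section Domain

variable {Ω : Set ℂ}

theorem continuous_toFun_of_mem (hΩ : IsOpen Ω) {f : SphereMap Ω}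
    (hf : f ∈ locallyUnivalentMeromorphic Ω) : Continuous f.toFun := by
  rw [mem_locallyUnivalentMeromorphic_iff hΩ] at hf
  have hcont : ContinuousOn (extendInfty f) Ω := fun z hz =>
    (hf z hz).continuousAt.continuousWithinAt
  exact (continuousOn_iff_continuous_domRestrict.1 hcont).congr (extendInfty_apply f)

/-- The locally univalent meromorphic functions, as a subset of the space of continuous maps into
the sphere. That space is Polish, unlike the space `SphereMap Ω` of all maps. -/
def continuousLocallyUnivalent (Ω : Set ℂ) : Set C(Ω, OnePoint ℂ) :=
  ContinuousMap.toUniformOnFunIsCompact ⁻¹' locallyUnivalentMeromorphic Ω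

/-- The bijection of `continuousLocallyUnivalent Ω` with `locallyUnivalentMeromorphic Ω` given by
the underlying functions, as a homeomorphism. -/
noncomputable def continuousLocallyUnivalentHomeomorph (hΩ : IsOpen Ω) :
    continuousLocallyUnivalent Ω ≃ₜ locallyUnivalentMeromorphic Ω :=
  ContinuousMap.isUniformEmbedding_toUniformOnFunIsCompact.isEmbedding.homeomorphOfSubsetRange
    fun (f : SphereMap Ω) hf => ⟨⟨f.toFun, continuous_toFun_of_mem hΩ hf⟩, rfl⟩

theorem closure_continuousLocallyUnivalent_subset (hΩ : IsOpen Ω) (hconn : IsPreconnected Ω) :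
    closure (continuousLocallyUnivalent Ω) ⊆
      continuousLocallyUnivalent Ω ∪ {f | ∀ z w, f z = f w} := by
  have : LocallyCompactSpace Ω := hΩ.locallyCompactSpace
  intro f hf
  rw [mem_closure_iff_nhdsWithin_neBot] at hf
  have hconv : TendstoLocallyUniformlyOn
      (fun g : C(Ω, OnePoint ℂ) => extendInfty g.toUniformOnFunIsCompact)
      (extendInfty f.toUniformOnFunIsCompact) (𝓝[continuousLocallyUnivalent Ω] f) Ω := by
    rw [tendstoLocallyUniformlyOn_iff_tendstoLocallyUniformly_comp_coe]
    convert ContinuousMap.tendsto_iff_tendstoLocallyUniformly.1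
      (tendsto_id.mono_left (nhdsWithin_le_nhds (s := continuousLocallyUnivalent Ω) (a := f)))
      using 1
    · ext g z
      exact extendInfty_apply _ z
    · ext z
      exact extendInfty_apply _ z
  have hcont : ContinuousOn (extendInfty f.toUniformOnFunIsCompact) Ω := by
    rw [continuousOn_iff_continuous_domRestrict]
    exact f.continuous.congr fun z => (extendInfty_apply _ z).symm
  refine (forall_isLocUnivAt_or_forall_eq hΩ hconn hconv (eventually_of_mem self_mem_nhdsWithin
    fun g hg => (mem_locallyUnivalentMeromorphic_iff hΩ).1 hg) hcont).imp
    (mem_locallyUnivalentMeromorphic_iff hΩ).2 fun hconst z w => ?_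
  have hzw := hconst z z.2 w w.2
  rwa [extendInfty_apply, extendInfty_apply] at hzw

theorem disjoint_continuousLocallyUnivalent (hΩ : IsOpen Ω) (hne : Ω.Nonempty) :
    Disjoint (continuousLocallyUnivalent Ω) {f | ∀ z w, f z = f w} := by
  rw [disjoint_left]
  intro f hf hconst
  obtain ⟨z, hz⟩ := hne
  refine ((mem_locallyUnivalentMeromorphic_iff hΩ).1 hf z hz).not_eventually_eq ?_
  filter_upwards [hΩ.mem_nhds hz] with w hw
  rw [extendInfty_apply _ ⟨w, hw⟩, extendInfty_apply _ ⟨z, hz⟩]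
  exact hconst _ _

theorem isLocallyClosed_continuousLocallyUnivalent (hΩ : IsOpen Ω) (hconn : IsConnected Ω) :
    IsLocallyClosed (continuousLocallyUnivalent Ω) := by
  have hclosed : IsClosed {f : C(Ω, OnePoint ℂ) | ∀ z w, f z = f w} := by
    simp only [ofPred_forall]
    exact isClosed_iInter fun z => isClosed_iInter fun w =>
      isClosed_eq (continuous_eval_const z) (continuous_eval_const w)
  refine ⟨_, _, hclosed.isOpen_compl, isClosed_closure (s := continuousLocallyUnivalent Ω),
    subset_antisymm (fun f hf => ⟨?_, subset_closure hf⟩) fun f hf =>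
      (closure_continuousLocallyUnivalent_subset hΩ hconn.isPreconnected hf.2).resolve_right hf.1⟩
  exact disjoint_left.1 (disjoint_continuousLocallyUnivalent hΩ hconn.nonempty) hf

theorem baireSpace_locallyUnivalentMeromorphic (hΩ : IsOpen Ω) (hconn : IsConnected Ω) :
    BaireSpace (locallyUnivalentMeromorphic Ω) := by
  have : LocallyCompactSpace Ω := hΩ.locallyCompactSpace
  have := baireSpace_of_isLocallyClosed (isLocallyClosed_continuousLocallyUnivalent hΩ hconn)
  exact (continuousLocallyUnivalentHomeomorph hΩ).baireSpace

theorem secondCountableTopology_locallyUnivalentMeromorphic (hΩ : IsOpen Ω) :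
    SecondCountableTopology (locallyUnivalentMeromorphic Ω) := by
  have : LocallyCompactSpace Ω := hΩ.locallyCompactSpace
  exact (continuousLocallyUnivalentHomeomorph hΩ).symm.secondCountableTopology

theorem nonempty_locallyUnivalentMeromorphic (hΩ : IsOpen Ω) :
    (locallyUnivalentMeromorphic Ω).Nonempty :=
  ⟨_, ofFun_mem_locallyUnivalentMeromorphic hΩ fun z _ =>
    isLocUnivAt_coe (z := z) analyticAt_id (by simp)⟩

theorem exists_isCompact_forall_dist_lt_imp_mem {U : Set (SphereMap Ω)} {f : SphereMap Ω}
    (hU : U ∈ 𝓝 f) : ∃ K : Set Ω, IsCompact K ∧ ∃ ε > 0, ∀ g : SphereMap Ω,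
      (∀ z ∈ K, dist (g.toFun z) (f.toFun z) < ε) → g ∈ U := by
  obtain ⟨⟨K, ε⟩, ⟨hK, hε⟩, hsub⟩ := (UniformOnFun.hasBasis_nhds_of_basis Ω (OnePoint ℂ)
    {K : Set Ω | IsCompact K} f ⟨∅, isCompact_empty⟩
    (fun K hK L hL => ⟨K ∪ L, IsCompact.union hK hL, subset_union_left, subset_union_right⟩)
    Metric.uniformity_basis_dist).mem_iff.1 hU
  exact ⟨K, hK, ε, hε, fun g hg => hsub hg⟩

theorem continuous_of_isLocallyUnivalentSelfMap {φ : Ω → Ω} (hφ : IsLocallyUnivalentSelfMap φ) :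
    Continuous φ :=
  continuous_induced_rng.2 <| (continuousOn_iff_continuous_domRestrict.1 hφ.1.continuousOn).congr
    (extendZero_apply _)

/-- Composition with a locally univalent self-map of `Ω`, as an operator on the locally univalent
meromorphic functions. -/
def compSelfMap (hΩ : IsOpen Ω) {φ : Ω → Ω} (hφ : IsLocallyUnivalentSelfMap φ)
    (f : locallyUnivalentMeromorphic Ω) : locallyUnivalentMeromorphic Ω :=
  ⟨f.1.comp φ, comp_mem_locallyUnivalentMeromorphic hΩ f.2 hφ⟩

theorem continuous_compSelfMap (hΩ : IsOpen Ω) {φ : Ω → Ω} (hφ : IsLocallyUnivalentSelfMap φ) :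
    Continuous (compSelfMap hΩ hφ) := by
  have hcomp : Continuous fun f : SphereMap Ω => f.comp φ :=
    (UniformOnFun.precomp_uniformContinuous (𝔖 := {K : Set Ω | IsCompact K})
      (𝔗 := {K : Set Ω | IsCompact K}) fun _ hK =>
        IsCompact.image hK (continuous_of_isLocallyUnivalentSelfMap hφ)).continuous
  exact (hcomp.comp continuous_subtype_val).subtype_mk _

variable {Φ : Set (Ω → Ω)}

theorem isUniversalIn_iff_dense_range (hΩ : IsOpen Ω) (hΦ : ∀ φ ∈ Φ, IsLocallyUnivalentSelfMap φ)
    (f : locallyUnivalentMeromorphic Ω) :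
    IsUniversalIn Φ (locallyUnivalentMeromorphic Ω) (f : SphereMap Ω) ↔
      Dense (range fun φ : Φ => compSelfMap hΩ (hΦ φ φ.2) f) := by
  have hrange : (Subtype.val '' range fun φ : Φ => compSelfMap hΩ (hΦ φ φ.2) f) =
      {h | ∃ φ ∈ Φ, h = (f : SphereMap Ω).comp φ} := by
    rw [← range_comp]
    ext h
    simp only [mem_range, Subtype.exists, mem_ofPred_eq, exists_prop, eq_comm (a := h),
      Function.comp_apply, compSelfMap]
  rw [Subtype.dense_iff, hrange]
  refine ⟨fun h => h.2.2, fun h => ⟨f.2, ?_, h⟩⟩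
  rintro _ ⟨φ, hφ, rfl⟩
  exact comp_mem_locallyUnivalentMeromorphic hΩ f.2 (hΦ φ hφ)

theorem exists_nonempty_inter_preimage_compSelfMap (hΩ : IsOpen Ω) (hsc : IsSimplyConnected Ω)
    (hΦ : ∀ φ ∈ Φ, IsLocallyUnivalentSelfMap φ) {φ : ℕ → Ω → Ω} (hmem : ∀ n, φ n ∈ Φ)
    (hrun : IsRunAway φ) (hinj : IsEventuallyInjective φ)
    {V U : Set (locallyUnivalentMeromorphic Ω)} (hV : IsOpen V) (hVne : V.Nonempty)
    (hU : IsOpen U) (hUne : U.Nonempty) :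
    ∃ φ : Φ, (V ∩ compSelfMap hΩ (hΦ φ φ.2) ⁻¹' U).Nonempty := by
  obtain ⟨f, hf⟩ := hVne
  obtain ⟨g, hg⟩ := hUne
  obtain ⟨U', hU', rfl⟩ := isOpen_induced_iff.1 hU
  obtain ⟨V', hV', rfl⟩ := isOpen_induced_iff.1 hV
  obtain ⟨K, hK, ε, hε, hKU⟩ := exists_isCompact_forall_dist_lt_imp_mem (hU'.mem_nhds hg)
  obtain ⟨L, hL, δ, hδ, hLV⟩ := exists_isCompact_forall_dist_lt_imp_mem (hV'.mem_nhds hf)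
  obtain ⟨F, hF, n, hFfg⟩ := exists_mem_dist_lt hΩ hsc (fun n => hΦ _ (hmem n)) hrun hinj f.2 g.2
    (hK.union hL) (lt_min hε hδ)
  exact ⟨⟨φ n, hmem n⟩, ⟨F, hF⟩,
    hLV F fun z hz => (hFfg z (Or.inr hz)).1.trans_le (min_le_right _ _),
    hKU _ fun z hz => (hFfg z (Or.inl hz)).2.trans_le (min_le_left _ _)⟩

end Domain

end LocallyUnivalent

open LocallyUnivalent

theorem mainTheorem8 (Ω : Set ℂ) (hΩ : IsOpen Ω) (hsc : IsSimplyConnected Ω)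
    (Φ : Set (Ω → Ω)) (hΦ : ∀ φ ∈ Φ, IsLocallyUnivalentSelfMap φ)
    (φ : ℕ → Ω → Ω) (hmem : ∀ n, φ n ∈ Φ)
    (hrun : IsRunAway φ) (hinj : IsEventuallyInjective φ) :
    (∃ f, IsUniversalIn Φ (locallyUnivalentMeromorphic Ω) f) ∧
      Dense {f : locallyUnivalentMeromorphic Ω |
        IsUniversalIn Φ (locallyUnivalentMeromorphic Ω) f} ∧
      IsGδ {f : locallyUnivalentMeromorphic Ω |
        IsUniversalIn Φ (locallyUnivalentMeromorphic Ω) f} := by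
  have := baireSpace_locallyUnivalentMeromorphic hΩ hsc.isPathConnected.isConnected
  have := secondCountableTopology_locallyUnivalentMeromorphic hΩ
  have := (nonempty_locallyUnivalentMeromorphic hΩ).to_subtype
  have hcont : ∀ ψ : Φ, Continuous (compSelfMap hΩ (hΦ ψ ψ.2)) := fun ψ =>
    continuous_compSelfMap hΩ _
  have hdense := dense_setOf_dense_range hcont fun _ hV hVne _ hU hUne =>
    exists_nonempty_inter_preimage_compSelfMap hΩ hsc hΦ hmem hrun hinj hV hVne hU hUne
  simp only [isUniversalIn_iff_dense_range hΩ hΦ]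
  obtain ⟨f, hf⟩ := hdense.nonempty
  exact ⟨⟨f, (isUniversalIn_iff_dense_range hΩ hΦ f).2 hf⟩, hdense, isGδ_setOf_dense_range hcont⟩
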